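/- Let $n\ge 2$, $\lambda_0\in(0,1]$, $M_0>0$. Write points of $\mathbb R^n$ as $(x,y)$ with $x\in\mathbb R^{n-1}$, $y\in\mathbb R$, put $\mathbb R^n_\pm=\{(x,y): y\gtrless 0\}$, let $H_\pm$ be the characteristic function of $\mathbb R^n_\pm$, and let $\nu=-e_n$. Let $A_\pm(y)=\{a^\pm_{ij}(y)\}_{i,j=1}^n$ be real symmetric matrices with $$\lambda_0|z|^2\le A_\pm(y)z\cdot z\le\lambda_0^{-1}|z|^2\quad(y\in\mathbb R,\ z\in\mathbb R^n),\qquad |A_\pm(y')-A_\pm(y'')|\le M_0|y'-y''|\quad(y',y''\in\mathbb R),\tag{1}$$ where $|A|=\max_{i,j}|a_{ij}|$ (a bound in the operator or the Frobenius norm implies this one). Put $b^\pm_{jk}=a^\pm_{jk}-a^\pm_{nj}a^\pm_{nk}/a^\pm_{nn}$ for $1\le j,k\le n-1$, and $$m_\pm(\xi,y)=\Big(\frac{1}{a^\pm_{nn}(y)}\sum_{j,k=1}^{n-1} b^\pm_{jk}(y)\xi_j\xi_k\Big)^{1/2},\qquad L=\sup_{\xi\in\mathbb R^{n-1}\setminus\{0\}}\frac{m_+(\xi,0)}{m_-(\xi,0)}.$$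 For $\alpha_\pm,\beta>0$, $s\in[0,1]$ and $\gamma\in\mathbb R^{n-1}$ with $|\gamma|\le1$ put $\phi_\pm(x,y)=\alpha_\pm y+\beta y^2/2+s\,\gamma\cdot x$ and let $\phi(x,0)=s\,\gamma\cdot x$ be their common value at $y=0$. For $w_\pm\in C^\infty(\mathbb R^n;\mathbb C)$ let $w=H_+w_++H_-w_-$, and $$\mathcal L(y,\partial)w=\sum_\pm H_\pm\,\mathrm{div}_{x,y}(A_\pm(y)\nabla_{x,y}w_\pm)\quad\text{(defined a.e.)},$$ $$\theta_0(x)=w_+(x,0)-w_-(x,0),\qquad \theta_1(x)=A_+(0)\nabla_{x,y} w_+(x,0)\cdot\nu-A_-(0)\nabla_{x,y} w_-(x,0)\cdot\nu .$$ Let $|D^kw|^2$ be the sum of the squared moduli of all partial derivatives $\partial_{i_1}\cdots\partial_{i_k}w$, and let $$[f]_{1/2}^2=\int_{\mathbb R^{n-1}}\int_{\mathbb R^{n-1}}\frac{|f(x)-f(x')|^2}{|x-x'|^n}\,dx'\,dx,$$ summed over the components if $f$ is vector-valued. Let $B_1\subset\mathbb R^{n-1}$ be the closed unit ball. **Theorem.**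 (a) For all $A_\pm$ as in (1), $L\le\lambda_0^{-2}$. (b) Let $\alpha_+,\alpha_->0$ and $\ell<\alpha_+/\alpha_-$. There exist positive constants $\tau_0$, $s_0<1$, $C$ and $\beta_0$, depending only on $n,\lambda_0,M_0,\alpha_\pm,\ell$, and for every $\beta\ge\beta_0$ there exists $r_0>0$, depending only on these data and $\beta$, such that for all $A_\pm$ as in (1) with $L\le\ell$, all $\tau\ge\tau_0$, $0<s\le s_0$, $\gamma\in\mathbb R^{n-1}$ with $|\gamma|\le1$, and all $w_\pm\in C^\infty(\mathbb R^n;\mathbb C)$ with $\operatorname{supp}w\subset B_1\times[-r_0,r_0]$, $$\begin{aligned} &\sum_\pm\sum_{k=0}^2\tau^{3-2k}\int_{\mathbb R^n_\pm}|D^kw_\pm|^2e^{2\tau\phi_\pm}\,dx\,dy+\sum_\pm\sum_{k=0}^1\tau^{3-2k}\int_{\mathbb R^{n-1}}|D^kw_\pm(x,0)|^2e^{2\tau\phi(x,0)}\,dx\\ &+\sum_\pm\tau^2\big[(e^{\tau\phi_\pm}w_\pm)(\cdot,0)\big]_{1/2}^2+\sum_\pm\big[\partial_y(e^{\tau\phi_\pm}w_\pm)(\cdot,0)\big]_{1/2}^2+\sum_\pm\big[\nabla_x(e^{\tau\phi_\pm}w_\pm)(\cdot,0)\big]_{1/2}^2\\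 \le\ &C\Big(\sum_\pm\int_{\mathbb R^n_\pm}|\mathcal L(y,\partial)w|^2e^{2\tau\phi_\pm}\,dx\,dy+\big[\nabla_x(e^{\tau\phi(\cdot,0)}\theta_0)\big]_{1/2}^2+\big[e^{\tau\phi(\cdot,0)}\theta_1\big]_{1/2}^2\\ &\qquad+\tau\int_{\mathbb R^{n-1}}e^{2\tau\phi(x,0)}|\theta_1|^2\,dx+\tau^3\int_{\mathbb R^{n-1}}e^{2\tau\phi(x,0)}|\theta_0|^2\,dx\Big). \end{aligned}$$ In particular, if $\alpha_\pm$ are fixed in terms of $\lambda_0$ alone with $\alpha_+/\alpha_->\lambda_0^{-2}$, then one may take $\ell=\lambda_0^{-2}$; by (a) the estimate then holds for all $A_\pm$ as in (1), with $\tau_0,s_0,C,\beta_0$ depending only on $n,\lambda_0,M_0$. -/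

import Mathlib

noncomputable section

namespace Carleman

open scoped ENNReal

/-- Tangential space `ℝ^{n-1}`, with `d = n - 1`. -/
abbrev Tan (d : ℕ) : Type := EuclideanSpace ℝ (Fin d)

/-- `ℝ^n = ℝ^{n-1} × ℝ`, with points `(x, y)`; only its topology, its linear structure and its
Lebesgue measure are used. -/
abbrev Spc (d : ℕ) : Type := Tan d × ℝ

/-- The coordinate vectors of `ℝ^n`: the indices `Fin.castSucc j` are the tangential directions
and `Fin.last d` is the normal direction `e_n`. -/
def basisVec {d : ℕ} (i : Fin (d + 1)) : Spc d :=
  Fin.lastCases (motive := fun _ => Spc d) ((0 : Tan d), (1 : ℝ))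
    (fun j : Fin d => (EuclideanSpace.single j (1 : ℝ), (0 : ℝ))) i

/-- The partial derivative `∂_i f`. -/
def pd {d : ℕ} (i : Fin (d + 1)) (f : Spc d → ℂ) (p : Spc d) : ℂ :=
  lineDeriv ℝ f p (basisVec i)

/-- The partial derivative `∂_j g` of a function on `ℝ^{n-1}`. -/
def tpd {d : ℕ} (j : Fin d) (g : Tan d → ℂ) (x : Tan d) : ℂ :=
  lineDeriv ℝ g x (EuclideanSpace.single j (1 : ℝ))

/-- `|D^k f|^2`, the sum of `|∂_{i_1} ⋯ ∂_{i_k} f|^2` over all indices. -/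
def sqD {d : ℕ} : ℕ → (Spc d → ℂ) → Spc d → ℝ≥0∞
  | 0, f, p => ‖f p‖ₑ ^ 2
  | k + 1, f, p => ∑ i : Fin (d + 1), sqD k (pd i f) p

/-- Coefficient matrices depending on the normal variable only. -/
abbrev Coeff (d : ℕ) : Type := ℝ → Matrix (Fin (d + 1)) (Fin (d + 1)) ℝ

/-- Symmetry, ellipticity with constant `lam0` and Lipschitz continuity with constant `M0`.
The Lipschitz bound is entrywise, i.e. in the max norm, which is dominated by the Euclidean
operator norm and by the Frobenius norm. -/
structure Admissible {d : ℕ} (lam0 M0 : ℝ) (A : Coeff d) : Prop where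
  symm : ∀ y, (A y).IsSymm
  lower : ∀ (y : ℝ) (z : Fin (d + 1) → ℝ), lam0 * (z ⬝ᵥ z) ≤ z ⬝ᵥ (A y).mulVec z
  upper : ∀ (y : ℝ) (z : Fin (d + 1) → ℝ), z ⬝ᵥ (A y).mulVec z ≤ lam0⁻¹ * (z ⬝ᵥ z)
  lipschitz : ∀ (y y' : ℝ) (i j : Fin (d + 1)), |A y' i j - A y i j| ≤ M0 * |y' - y|

/-- `div (A(y) ∇ w)`; it exists in the classical sense for almost every `y`
when `A` is Lipschitz and `w` is smooth. -/
def divGrad {d : ℕ} (A : Coeff d) (w : Spc d → ℂ) (p : Spc d) : ℂ :=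
  ∑ i : Fin (d + 1), pd i (fun q => ∑ j : Fin (d + 1), A q.2 i j • pd j w q) p

/-- `B(ξ, ξ, y) = ∑ (a_jk - a_nj a_nk / a_nn) ξ_j ξ_k`. -/
def formB {d : ℕ} (A : Coeff d) (ξ : Tan d) (y : ℝ) : ℝ :=
  ∑ j : Fin d, ∑ k : Fin d,
    (A y j.castSucc k.castSucc
      - A y (Fin.last d) j.castSucc * A y (Fin.last d) k.castSucc
        / A y (Fin.last d) (Fin.last d)) * ξ j * ξ k

/-- `m(ξ, y) = sqrt (B(ξ, ξ, y) / a_nn(y))`. -/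
def symbolM {d : ℕ} (A : Coeff d) (ξ : Tan d) (y : ℝ) : ℝ :=
  Real.sqrt (formB A ξ y / A y (Fin.last d) (Fin.last d))

/-- `L = sup_{ξ ≠ 0} m_+(ξ, 0) / m_-(ξ, 0)`. -/
def ratioL {d : ℕ} (Ap Am : Coeff d) : ℝ :=
  ⨆ ξ : {ξ : Tan d // ξ ≠ 0}, symbolM Ap ξ.1 0 / symbolM Am ξ.1 0

/-- `φ_±(x, y) = α_± y + β y² / 2 + s γ·x`, where `α` stands for `α_+` or `α_-`. -/
def phase {d : ℕ} (α β s : ℝ) (γ : Tan d) (p : Spc d) : ℝ :=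
  α * p.2 + β * p.2 ^ 2 / 2 + s * inner ℝ γ p.1

/-- `H_+ w_+ + H_- w_-`, with `H_±` the characteristic functions of `{y > 0}` and `{y < 0}`. -/
def glue {d : ℕ} (wp wm : Spc d → ℂ) (p : Spc d) : ℂ :=
  Set.indicator {q : Spc d | 0 < q.2} wp p + Set.indicator {q : Spc d | q.2 < 0} wm p

/-- The squared seminorm `[f]²_{1/2, ℝ^{n-1}}`, where `n = d + 1`. -/
def halfSq {d : ℕ} (f : Tan d → ℂ) : ℝ≥0∞ :=
  ∫⁻ x : Tan d, ∫⁻ x' : Tan d, ENNReal.ofReal (‖f x - f x'‖ ^ 2 / ‖x - x'‖ ^ (d + 1))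

/-- The vector `ν = -e_n`. -/
def nu {d : ℕ} (i : Fin (d + 1)) : ℝ := if i = Fin.last d then -1 else 0

/-- `A(0) ∇w(x, 0) · ν`. -/
def conormal {d : ℕ} (A : Coeff d) (w : Spc d → ℂ) (x : Tan d) : ℂ :=
  ∑ i : Fin (d + 1), nu i • ∑ j : Fin (d + 1), A 0 i j • pd j w (x, 0)

/-- `θ_0`, the jump of `w` across `{y = 0}`. -/
def theta0 {d : ℕ} (wp wm : Spc d → ℂ) (x : Tan d) : ℂ := wp (x, 0) - wm (x, 0)

/-- `θ_1`, the jump of the conormal derivative across `{y = 0}`. -/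
def theta1 {d : ℕ} (Ap Am : Coeff d) (wp wm : Spc d → ℂ) (x : Tan d) : ℂ :=
  conormal Ap wp x - conormal Am wm x

/-- The contribution to the left-hand side of one of the two sides, whose half space is `Ω`,
whose phase is `φ` and whose function is `w`. -/
def lhsSide {d : ℕ} (τ : ℝ) (Ω : Set (Spc d)) (φ : Spc d → ℝ) (w : Spc d → ℂ) : ℝ≥0∞ :=
  (∑ k ∈ Finset.range 3, ENNReal.ofReal (τ ^ (3 - 2 * (k : ℤ))) *
      ∫⁻ p in Ω, sqD k w p * ENNReal.ofReal (Real.exp (2 * τ * φ p)))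
  + (∑ k ∈ Finset.range 2, ENNReal.ofReal (τ ^ (3 - 2 * (k : ℤ))) *
      ∫⁻ x : Tan d, sqD k w (x, 0) * ENNReal.ofReal (Real.exp (2 * τ * φ (x, 0))))
  + ENNReal.ofReal (τ ^ 2) * halfSq (fun x => Real.exp (τ * φ (x, 0)) • w (x, 0))
  + halfSq (fun x => pd (Fin.last d) (fun q => Real.exp (τ * φ q) • w q) (x, 0))
  + ∑ j : Fin d,
      halfSq (fun x => pd j.castSucc (fun q => Real.exp (τ * φ q) • w q) (x, 0))

/-- The left-hand side of the Carleman estimate. -/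
def carlemanLHS {d : ℕ} (αp αm β s τ : ℝ) (γ : Tan d) (wp wm : Spc d → ℂ) : ℝ≥0∞ :=
  lhsSide τ {p : Spc d | 0 < p.2} (phase αp β s γ) wp
    + lhsSide τ {p : Spc d | p.2 < 0} (phase αm β s γ) wm

/-- The right-hand side of the Carleman estimate, without the constant. On `{y = 0}` the phase is
`s γ·x`, whatever `α` and `β` are. -/
def carlemanRHS {d : ℕ} (Ap Am : Coeff d) (αp αm β s τ : ℝ) (γ : Tan d)
    (wp wm : Spc d → ℂ) : ℝ≥0∞ :=
  (∫⁻ p in {p : Spc d | 0 < p.2}, ‖divGrad Ap wp p‖ₑ ^ 2 *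
      ENNReal.ofReal (Real.exp (2 * τ * phase αp β s γ p)))
  + (∫⁻ p in {p : Spc d | p.2 < 0}, ‖divGrad Am wm p‖ₑ ^ 2 *
      ENNReal.ofReal (Real.exp (2 * τ * phase αm β s γ p)))
  + (∑ j : Fin d, halfSq (tpd j
      (fun x => Real.exp (τ * phase αp β s γ (x, 0)) • theta0 wp wm x)))
  + halfSq (fun x => Real.exp (τ * phase αp β s γ (x, 0)) • theta1 Ap Am wp wm x)
  + ENNReal.ofReal τ * (∫⁻ x : Tan d,
      ENNReal.ofReal (Real.exp (2 * τ * phase αp β s γ (x, 0))) * ‖theta1 Ap Am wp wm x‖ₑ ^ 2)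
  + ENNReal.ofReal (τ ^ 3) * (∫⁻ x : Tan d,
      ENNReal.ofReal (Real.exp (2 * τ * phase αp β s γ (x, 0))) * ‖theta0 wp wm x‖ₑ ^ 2)

end Carleman

end

/-! ### First-order weighted estimates and factorization of the second-order operator. -/

noncomputable section

namespace Carleman

open MeasureTheory Set Filter Topology

/-! The coefficients depend on y alone and the phase is affine in x, so a Fourier transform in x
reduces the estimate to ordinary differential equations in y, to be treated uniformly in the
frequency. Let X be the length of the angular frequency 2πξ, Λ = τ + X, ζ = 2πξ + iτsγ, D = ∂_y −
τ∂_yφ, and let v be the transform of e^{τφ}w. Up to first-order terms coming from derivatives of the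
coefficients, the source is a_nn (D² + 2itD − (t² + Q))v with t = Σ a_nj ζ_j / a_nn and Q = Σ b_jk
ζ_j ζ_k / a_nn; moreover Q is within O(sΛ²) of m². If μ² = Q, the operator is (D + it − μ)(D + it +
μ) up to a residual of size O(Λ), produced by the derivatives of t and μ.

For u' = ku + f and κ = Re k, integrating (κ|u|²)' bounds (κ² + κ')|u|² by |f|² and boundary terms
(`first_order`). The factors have κ = τ∂_yφ + Im t ± Re μ. With the sign + this is positive of order
Λ. With the sign − it may be small, but only where Λ = O(τ), and there κ' ≥ τβ − O(Λ) wins once β is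
large: this is `Side.convexity_bound`, whose lower bound cΛ²/τ accounts for the loss in the interior
weights.

The sign of κ at the interface decides which boundary terms are controlled. At low frequencies
(`Side.low`) one takes μ = 0 and both factors are positive, so the source on the plus side controls
the whole Cauchy data there. At high frequencies (`Side.high`) the same holds if the − factor of the
plus side is clearly positive at 0. Otherwise τα_+ is at most about m_+ ≤ ℓ m_-, and ℓ < α_+/α_-
makes τα_- smaller than m_- by a definite margin; this is where the hypothesis on L enters. Then the
plus side controls v1 + (it + μ)v at 0, and the minus side, factored in the opposite order, controls
v1 + (it − μ)v. With the two jump relations these determine the Cauchy data, because a_+μ_+ + a_-μ_-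
has real part at least of order Λ (`trace_elliptic`). In every case `trace_transfer` carries the
data across the interface, and the minus side is bounded by its own source and trace. The outcome is
`transmission`.

Large τ absorbs the first-order terms and the equation itself yields the second normal derivative
(`transmission_lower`). Plancherel and the identity [g]²_{1/2} = c ∫ 2π|ξ||ĝ|² (`exists_halfSq_eq`)
turn the estimate at each frequency into the stated norms. Part (a) follows by completing the square
in the normal component, which places m between λ₀|ξ| and λ₀⁻¹|ξ|. -/

/-- Absolute continuity passes to any function whose increments are dominated. -/
theorem ac_of_dist_le {X Y : Type*} [PseudoMetricSpace X] [PseudoMetricSpace Y] {f : ℝ → X}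
    {g : ℝ → Y} {a b K : ℝ} (hf : AbsolutelyContinuousOnInterval f a b)
    (h : ∀ x ∈ uIcc a b, ∀ y ∈ uIcc a b, dist (g x) (g y) ≤ K * dist (f x) (f y)) :
    AbsolutelyContinuousOnInterval g a b := by
  have hlim : Tendsto (fun E : ℕ × (ℕ → ℝ × ℝ) ↦
      K * ∑ i ∈ Finset.range E.1, dist (f (E.2 i).1) (f (E.2 i).2))
    (AbsolutelyContinuousOnInterval.totalLengthFilter ⊓
      𝓟 (AbsolutelyContinuousOnInterval.disjWithin a b)) (𝓝 0) := by
    have := Tendsto.const_mul K hf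
    simpa using this
  unfold AbsolutelyContinuousOnInterval
  refine squeeze_zero' (Eventually.of_forall fun _ ↦ Finset.sum_nonneg fun i _ ↦ dist_nonneg) ?_ hlim
  rw [eventually_inf_principal]
  refine Eventually.of_forall fun E hE ↦ ?_
  rw [Finset.mul_sum]
  refine Finset.sum_le_sum fun i hi ↦ ?_
  have := hE.1 i hi
  exact h _ this.1 _ this.2

theorem ac_normSq {u : ℝ → ℂ} {a b : ℝ} (hu : AbsolutelyContinuousOnInterval u a b) :
    AbsolutelyContinuousOnInterval (fun y ↦ ‖u y‖ ^ 2) a b := by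
  have h1 : AbsolutelyContinuousOnInterval (fun y ↦ ‖u y‖) a b :=
    ac_of_dist_le (K := 1) hu fun x _ y _ ↦ by
      rw [one_mul, Real.dist_eq, dist_eq_norm]; exact abs_norm_sub_norm_le _ _
  simpa [sq] using h1.fun_mul h1

theorem ac_of_lip {E : Type*} [NormedAddCommGroup E] {f : ℝ → E} {L a b : ℝ}
    (h : ∀ y y', ‖f y - f y'‖ ≤ L * |y - y'|) : AbsolutelyContinuousOnInterval f a b := by
  have : LipschitzWith (Real.toNNReal L) f :=
    LipschitzWith.of_dist_le' fun x y ↦ by simpa [dist_eq_norm] using h x y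
  exact (this.lipschitzOnWith (s := uIcc a b)).absolutelyContinuousOnInterval

/-- The symbols inherit only Lipschitz regularity from the coefficients. Rademacher's theorem gives
a derivative almost everywhere, and absolute continuity is what still permits integrating it. -/
theorem ae_hasDerivAt_of_lip {E : Type*} [NormedAddCommGroup E] [NormedSpace ℝ E]
    [FiniteDimensional ℝ E] {f : ℝ → E} {L : ℝ} (hL : 0 ≤ L)
    (h : ∀ y y', ‖f y - f y'‖ ≤ L * |y - y'|) :
    ∀ᵐ y, HasDerivAt f (deriv f y) y ∧ ‖deriv f y‖ ≤ L := by
  have h1 : LipschitzWith (Real.toNNReal L) f :=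
    LipschitzWith.of_dist_le' fun x y ↦ by simpa [dist_eq_norm] using h x y
  filter_upwards [h1.ae_differentiableAt] with y hy
  refine ⟨hy.hasDerivAt, ?_⟩
  have := norm_deriv_le_of_lipschitz (x₀ := y) h1
  simpa [hL] using this

theorem ac_of_hasDerivAt {u u' : ℝ → ℂ} {a b : ℝ} (h : ∀ y, HasDerivAt u (u' y) y)
    (hc : Continuous u') : AbsolutelyContinuousOnInterval u a b := by
  have : ContDiff ℝ 1 u := by
    rw [contDiff_one_iff_deriv]
    refine ⟨fun y ↦ (h y).differentiableAt, ?_⟩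
    rwa [show deriv u = u' from funext fun y ↦ (h y).deriv]
  exact this.contDiffOn.absolutelyContinuousOnInterval

/-- The weighted estimate for the first order operator `u' - k u`. -/
theorem first_order {u f k : ℝ → ℂ} {κ κ' F : ℝ → ℝ} {a b c : ℝ} (hab : a ≤ b)
    (hu : AbsolutelyContinuousOnInterval u a b) (hκ : AbsolutelyContinuousOnInterval κ a b)
    (hk : ∀ y, (k y).re = κ y)
    (hd : ∀ᵐ y, y ∈ Icc a b → HasDerivAt u (k y * u y + f y) y ∧ HasDerivAt κ (κ' y) y ∧
      ‖f y‖ ^ 2 ≤ F y ∧ c ≤ κ y ^ 2 + κ' y)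
    (hF : IntervalIntegrable F volume a b) :
    c * (∫ y in a..b, ‖u y‖ ^ 2) ≤
      (∫ y in a..b, F y) + (κ b * ‖u b‖ ^ 2 - κ a * ‖u a‖ ^ 2) := by
  -- Everything rests on (κ|u|²)' = (κ² + κ')|u|² + |κu + f|² − |f|²; the imaginary part of k drops
  -- out. The majorant F replaces |f|² so that f, which contains almost-everywhere derivatives, need
  -- not be integrated.
  have hE := hκ.fun_mul (ac_normSq hu)
  rw [← hE.integral_deriv_eq_sub, ← intervalIntegral.integral_const_mul,
    ← intervalIntegral.integral_add hF hE.intervalIntegrable_deriv]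
  have hint : IntervalIntegrable (fun y ↦ c * ‖u y‖ ^ 2) volume a b :=
    ((ac_normSq hu).continuousOn.const_mul c).intervalIntegrable
  refine intervalIntegral.integral_mono_ae_restrict hab hint
    (hF.add hE.intervalIntegrable_deriv) ?_
  rw [EventuallyLE, ae_restrict_iff' measurableSet_Icc]
  filter_upwards [hd] with y hy hyI
  obtain ⟨h1, h2, h3, h4⟩ := hy hyI
  have h5 : HasDerivAt (fun y ↦ ‖u y‖ ^ 2)
      (2 * ((u y).re * (k y * u y + f y).re + (u y).im * (k y * u y + f y).im)) y := by
    have hre : HasDerivAt (fun y ↦ (u y).re) (k y * u y + f y).re y :=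
      (Complex.reCLM.hasFDerivAt.comp_hasDerivAt y h1)
    have him : HasDerivAt (fun y ↦ (u y).im) (k y * u y + f y).im y :=
      (Complex.imCLM.hasFDerivAt.comp_hasDerivAt y h1)
    have := (hre.mul hre).add (him.mul him)
    refine (this.congr_deriv (by ring)).congr_of_eventuallyEq (Eventually.of_forall fun x ↦ ?_)
    simp [← Complex.normSq_eq_norm_sq, Complex.normSq_apply]
  have h6 : HasDerivAt (fun y ↦ κ y * ‖u y‖ ^ 2) _ y := h2.mul h5
  rw [h6.deriv]
  have e1 : ‖u y‖ ^ 2 = (u y).re ^ 2 + (u y).im ^ 2 := by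
    rw [← Complex.normSq_eq_norm_sq, Complex.normSq_apply]; ring
  have e2 : ‖f y‖ ^ 2 = (f y).re ^ 2 + (f y).im ^ 2 := by
    rw [← Complex.normSq_eq_norm_sq, Complex.normSq_apply]; ring
  simp only [Complex.add_re, Complex.mul_re, Complex.add_im, Complex.mul_im, hk, e1]
  rw [e2] at h3
  nlinarith [mul_le_mul_of_nonneg_right h4 (add_nonneg (sq_nonneg (u y).re) (sq_nonneg (u y).im)),
    sq_nonneg (κ y * (u y).re + (f y).re), sq_nonneg (κ y * (u y).im + (f y).im)]

/-- Estimates for a second order operator `v'' + ...` through its factorization into two first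
order operators, up to a residual term `R v`. -/
theorem second_order {t μ Q v v1 v2 : ℝ → ℂ} {τ α β Lt Lμ N a b c₁ c₂ : ℝ} (hab : a ≤ b)
    (hLt : 0 ≤ Lt) (hLμ : 0 ≤ Lμ)
    (ht : ∀ y y', ‖t y - t y'‖ ≤ Lt * |y - y'|) (hμ : ∀ y y', ‖μ y - μ y'‖ ≤ Lμ * |y - y'|)
    (hv : ∀ y, HasDerivAt v (v1 y + (τ * (α + β * y) : ℝ) * v y) y)
    (hv1 : ∀ y, HasDerivAt v1 (v2 y + (τ * (α + β * y) : ℝ) * v1 y) y)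
    (hv2 : Continuous v2) (hQ : Continuous Q)
    (hN : ∀ y ∈ Icc a b, ‖Q y - μ y ^ 2‖ + Lt + Lμ ≤ N)
    (h1 : ∀ y ∈ Icc a b, c₁ ≤ (τ * (α + β * y) + (t y).im + (μ y).re) ^ 2 + (τ * β - Lt - Lμ))
    (h2 : ∀ y ∈ Icc a b, c₂ ≤ (τ * (α + β * y) + (t y).im - (μ y).re) ^ 2 + (τ * β - Lt - Lμ)) :
    (c₁ * (∫ y in a..b, ‖v1 y + (Complex.I * t y + μ y) * v y‖ ^ 2) ≤
      2 * (∫ y in a..b, ‖v2 y + 2 * Complex.I * t y * v1 y - (t y ^ 2 + Q y) * v y‖ ^ 2)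
        + 2 * N ^ 2 * (∫ y in a..b, ‖v y‖ ^ 2)
        + ((τ * (α + β * b) + (t b).im + (μ b).re) * ‖v1 b + (Complex.I * t b + μ b) * v b‖ ^ 2
        - (τ * (α + β * a) + (t a).im + (μ a).re) * ‖v1 a + (Complex.I * t a + μ a) * v a‖ ^ 2)) ∧
    c₂ * (∫ y in a..b, ‖v y‖ ^ 2) ≤
      (∫ y in a..b, ‖v1 y + (Complex.I * t y + μ y) * v y‖ ^ 2)
        + ((τ * (α + β * b) + (t b).im - (μ b).re) * ‖v b‖ ^ 2
        - (τ * (α + β * a) + (t a).im - (μ a).re) * ‖v a‖ ^ 2) := by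
  have act : AbsolutelyContinuousOnInterval t a b := ac_of_lip ht
  have acμ : AbsolutelyContinuousOnInterval μ a b := ac_of_lip hμ
  have cv : Continuous v := continuous_iff_continuousAt.2 fun y ↦ (hv y).continuousAt
  have cv1 : Continuous v1 := continuous_iff_continuousAt.2 fun y ↦ (hv1 y).continuousAt
  have acv : AbsolutelyContinuousOnInterval v a b := ac_of_hasDerivAt hv (by fun_prop)
  have acv1 : AbsolutelyContinuousOnInterval v1 a b := ac_of_hasDerivAt hv1 (by fun_prop)
  have ct : Continuous t := by
    have : LipschitzWith (Real.toNNReal Lt) t :=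
      LipschitzWith.of_dist_le' fun x y ↦ by simpa [dist_eq_norm] using ht x y
    exact this.continuous
  have cμ : Continuous μ := by
    have : LipschitzWith (Real.toNNReal Lμ) μ :=
      LipschitzWith.of_dist_le' fun x y ↦ by simpa [dist_eq_norm] using hμ x y
    exact this.continuous
  have aclin : AbsolutelyContinuousOnInterval (fun y : ℝ ↦ τ * (α + β * y)) a b :=
    (ContDiff.contDiffOn (by fun_prop)).absolutelyContinuousOnInterval
  have actim : AbsolutelyContinuousOnInterval (fun y ↦ (t y).im) a b :=
    ac_of_dist_le (K := 1) act fun x _ y _ ↦ by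
      rw [one_mul, Real.dist_eq, dist_eq_norm, ← Complex.sub_im]; exact Complex.abs_im_le_norm _
  have acμre : AbsolutelyContinuousOnInterval (fun y ↦ (μ y).re) a b :=
    ac_of_dist_le (K := 1) acμ fun x _ y _ ↦ by
      rw [one_mul, Real.dist_eq, dist_eq_norm, ← Complex.sub_re]; exact Complex.abs_re_le_norm _
  have acω : AbsolutelyContinuousOnInterval (fun y ↦ Complex.I * t y + μ y) a b :=
    (act.const_smul Complex.I).fun_add acμ
  have acz : AbsolutelyContinuousOnInterval (fun y ↦ v1 y + (Complex.I * t y + μ y) * v y) a b :=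
    acv1.fun_add (acω.fun_smul acv)
  have dt := ae_hasDerivAt_of_lip hLt ht
  have dμ := ae_hasDerivAt_of_lip hLμ hμ
  have dlin : ∀ y, HasDerivAt (fun y : ℝ ↦ τ * (α + β * y)) (τ * β) y := fun y ↦ by
    simpa using (((hasDerivAt_id y).const_mul β).const_add α).const_mul τ
  constructor
  -- With z = (D + it + μ)v one has (D + it − μ)z = Pv + (Q − μ² + it' + μ')v, where P is the
  -- conjugated operator. The last term is the residual, and N bounds its coefficient.
  · set z := fun y ↦ v1 y + (Complex.I * t y + μ y) * v y with hz
    have hI1 : IntervalIntegrable (fun y ↦ 2 * ‖v2 y + 2 * Complex.I * t y * v1 y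
      - (t y ^ 2 + Q y) * v y‖ ^ 2) volume a b := Continuous.intervalIntegrable (by fun_prop) _ _
    have hI2 : IntervalIntegrable (fun y ↦ 2 * N ^ 2 * ‖v y‖ ^ 2) volume a b :=
      Continuous.intervalIntegrable (by fun_prop) _ _
    rw [← intervalIntegral.integral_const_mul (2 : ℝ),
      ← intervalIntegral.integral_const_mul (2 * N ^ 2), ← intervalIntegral.integral_add hI1 hI2]
    refine first_order (k := fun y ↦ (τ * (α + β * y) : ℝ) - Complex.I * t y + μ y)
      (κ := fun y ↦ τ * (α + β * y) + (t y).im + (μ y).re)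
      (κ' := fun y ↦ τ * β + (deriv t y).im + (deriv μ y).re)
      (f := fun y ↦ (v2 y + 2 * Complex.I * t y * v1 y - (t y ^ 2 + Q y) * v y)
        + ((Q y - μ y ^ 2) + Complex.I * deriv t y + deriv μ y) * v y) hab acz
        ((aclin.fun_add actim).fun_add acμre) (fun y ↦ by simp) ?_ (hI1.add hI2)
    filter_upwards [dt, dμ] with y hty hμy hyI
    refine ⟨?_, ?_, ?_, ?_⟩
    · have := (hv1 y).add ((((hty.1.const_mul Complex.I).add hμy.1)).mul (hv y))
      refine this.congr_deriv ?_
      have hI : Complex.I ^ 2 = -1 := Complex.I_sq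
      simp only [Pi.add_apply]
      linear_combination ((t y) ^ 2 * v y) * hI
    · have h1 : HasDerivAt (fun y ↦ (t y).im) (deriv t y).im y :=
        (Complex.imCLM.hasFDerivAt.comp_hasDerivAt y hty.1)
      have h2 : HasDerivAt (fun y ↦ (μ y).re) (deriv μ y).re y :=
        (Complex.reCLM.hasFDerivAt.comp_hasDerivAt y hμy.1)
      exact ((dlin y).add h1).add h2
    · have hb : ‖((Q y - μ y ^ 2) + Complex.I * deriv t y + deriv μ y) * v y‖ ≤ N * ‖v y‖ := by
        rw [norm_mul]
        refine mul_le_mul_of_nonneg_right (le_trans ?_ (hN y hyI)) (norm_nonneg _)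
        refine (norm_add_le _ _).trans (add_le_add ((norm_add_le _ _).trans
          (add_le_add le_rfl ?_)) hμy.2)
        simpa using hty.2
      refine (pow_le_pow_left₀ (norm_nonneg _) ((norm_add_le _ _).trans
        (add_le_add_right hb _)) 2).trans ?_
      nlinarith [sq_nonneg (‖v2 y + 2 * Complex.I * t y * v1 y - (t y ^ 2 + Q y) * v y‖
        - N * ‖v y‖)]
    · have e1 := (abs_le.1 ((Complex.abs_im_le_norm (deriv t y)).trans hty.2)).1
      have e2 := (abs_le.1 ((Complex.abs_re_le_norm (deriv μ y)).trans hμy.2)).1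
      have := h1 y hyI
      linarith
  -- The second factor is exact: (D + it + μ)v = z, so z itself is the source.
  · refine first_order (k := fun y ↦ (τ * (α + β * y) : ℝ) - Complex.I * t y - μ y)
      (κ := fun y ↦ τ * (α + β * y) + (t y).im - (μ y).re)
      (κ' := fun y ↦ τ * β + (deriv t y).im - (deriv μ y).re)
      (f := fun y ↦ v1 y + (Complex.I * t y + μ y) * v y) hab acv
        ((aclin.fun_add actim).fun_sub acμre) (fun y ↦ by simp) ?_
        (Continuous.intervalIntegrable (by fun_prop) _ _)
    filter_upwards [dt, dμ] with y hty hμy hyI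
    refine ⟨?_, ?_, le_rfl, ?_⟩
    · exact (hv y).congr_deriv (by ring)
    · have h1 : HasDerivAt (fun y ↦ (t y).im) (deriv t y).im y :=
        (Complex.imCLM.hasFDerivAt.comp_hasDerivAt y hty.1)
      have h2 : HasDerivAt (fun y ↦ (μ y).re) (deriv μ y).re y :=
        (Complex.reCLM.hasFDerivAt.comp_hasDerivAt y hμy.1)
      exact ((dlin y).add h1).sub h2
    · have e1 := (abs_le.1 ((Complex.abs_im_le_norm (deriv t y)).trans hty.2)).1
      have e2 := (abs_le.1 ((Complex.abs_re_le_norm (deriv μ y)).trans hμy.2)).2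
      have := h2 y hyI
      linarith

end Carleman

end

/-! ### The one-sided problem at a fixed frequency: combining the two factors. -/

noncomputable section

namespace Carleman

open MeasureTheory Set Filter Topology

/-- The data of the one-dimensional problem on one side of the interface, at a fixed frequency of
size `X`. The sign `ε` is `1` on `[0, b]` and `-1` on `[a, 0]`; `v`, `v1`, `v2` are the weighted
function and its weighted first and second normal derivatives. -/
structure Side (ε a b K τ s X α β : ℝ) (t Q : ℝ → ℂ) (m : ℝ → ℝ) (v v1 v2 : ℝ → ℂ) : Prop where
  hab : a ≤ b
  ends : (ε = 1 ∧ a = 0 ∧ v b = 0 ∧ v1 b = 0) ∨ (ε = -1 ∧ b = 0 ∧ v a = 0 ∧ v1 a = 0)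
  range : ∀ y ∈ Icc a b, α / 2 ≤ α + β * y ∧ α + β * y ≤ 2 * α
  t_lip : ∀ y y', ‖t y - t y'‖ ≤ K * (τ + X) * |y - y'|
  t_bd : ∀ y, ‖t y‖ ≤ K * (τ + X)
  t_im : ∀ y, |(t y).im| ≤ K * s * τ
  Q_lip : ∀ y y', ‖Q y - Q y'‖ ≤ K * (τ + X) ^ 2 * |y - y'|
  Q_near : ∀ y, ‖Q y - (m y : ℂ) ^ 2‖ ≤ K * s * (τ + X) ^ 2
  m_lower : ∀ y, X ≤ K * m y
  m_upper : ∀ y, m y ≤ K * X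
  v_deriv : ∀ y, HasDerivAt v (v1 y + (τ * (α + β * y) : ℝ) * v y) y
  v1_deriv : ∀ y, HasDerivAt v1 (v2 y + (τ * (α + β * y) : ℝ) * v1 y) y
  v2_cont : Continuous v2

/-- The conjugated operator in normal form. -/
def conjOp (t Q v v1 v2 : ℝ → ℂ) (y : ℝ) : ℂ :=
  v2 y + 2 * Complex.I * t y * v1 y - (t y ^ 2 + Q y) * v y

/-- The interior energy of order at most one. -/
def bulk (a b τ Λ : ℝ) (v v1 : ℝ → ℂ) : ℝ :=
  Λ ^ 4 / τ * (∫ y in a..b, ‖v y‖ ^ 2) + Λ ^ 2 / τ * (∫ y in a..b, ‖v1 y‖ ^ 2)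

/-- The boundary energy. -/
def trace (Λ : ℝ) (v v1 : ℝ → ℂ) : ℝ := Λ ^ 3 * ‖v 0‖ ^ 2 + Λ * ‖v1 0‖ ^ 2

theorem norm_sq_le_of_norm_le_add {x y z : ℂ} {G : ℝ} (h : ‖x‖ ≤ ‖y‖ + G * ‖z‖) :
    ‖x‖ ^ 2 ≤ 2 * ‖y‖ ^ 2 + 2 * G ^ 2 * ‖z‖ ^ 2 := by
  have := pow_le_pow_left₀ (norm_nonneg x) h 2
  nlinarith [sq_nonneg (‖y‖ - G * ‖z‖)]

/-- The arithmetic behind `Side.combine`. -/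
theorem combine_arith {ε τ Λ N c k G D e V V1 Z H A0 B0 Z1 κ1 κ2 W T : ℝ} (hε : |ε| ≤ 1)
    (hτ : 1 ≤ τ) (hΛ0 : 0 < Λ) (hc : 0 < c) (hD : 0 ≤ D) (he : 0 < e)
    (hNk : 8 * N ^ 2 ≤ c * Λ ^ 2 * k) (hk : c * Λ ^ 2 ≤ k * τ)
    (hD1 : |κ1| ≤ D * Λ) (hD2 : |κ2| ≤ D * Λ) (V0 : 0 ≤ V) (Z0 : 0 ≤ Z) (H0 : 0 ≤ H)
    (A00 : 0 ≤ A0) (B00 : 0 ≤ B0) (Z10 : 0 ≤ Z1) (p3 : V1 ≤ 2 * Z + 2 * (G * Λ) ^ 2 * V)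
    (p2 : Z1 ≤ 2 * B0 + 2 * (G * Λ) ^ 2 * A0) (p4 : B0 ≤ 2 * Z1 + 2 * (G * Λ) ^ 2 * A0)
    (f1 : c * Λ ^ 2 * Z ≤ 2 * H + 2 * N ^ 2 * V - ε * (κ1 * Z1))
    (f2 : k * V ≤ Z - ε * (κ2 * A0)) (hWd : W = Λ ^ 4 / τ * V + Λ ^ 2 / τ * V1)
    (htr : T = Λ ^ 3 * A0 + Λ * B0) :
    W ≤ (4 * (1 + 2 * G ^ 2) / c ^ 2 + 4 / c) * (2 + D * (2 + 2 * G ^ 2 + c)) * (H + T) ∧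
    (ε = 1 → e * Λ ≤ κ1 → e * Λ ≤ κ2 → W + T ≤
        (2 * (4 * (1 + 2 * G ^ 2) / c ^ 2 + 4 / c) + 2 * (2 / e + (2 + 4 * G ^ 2) / (c * e))) *
          H) := by
  have hτ0 : 0 < τ := by linarith
  set C1 := 4 * (1 + 2 * G ^ 2) / c ^ 2 + 4 / c with hC1
  have C10 : 0 ≤ C1 := by positivity
  have k0 : 0 ≤ k := by
    by_contra hneg
    have h1 : k * τ < 0 := mul_neg_of_neg_of_pos (not_le.1 hneg) hτ0
    have h2 : 0 < c * Λ ^ 2 := by positivity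
    linarith
  -- Add cΛ²/2 times the second estimate to the first. Half of the Z term pays for the source of the
  -- second factor, and `hNk` lets half of the V term absorb the residual 2N²V.
  have main : c * Λ ^ 2 / 2 * Z + c * k * Λ ^ 2 / 4 * V ≤
      2 * H - ε * (κ1 * Z1) + c * Λ ^ 2 / 2 * (-ε * (κ2 * A0)) := by
    have h1 := mul_le_mul_of_nonneg_left f2 (show 0 ≤ c * Λ ^ 2 / 2 by positivity)
    have h2 := mul_le_mul_of_nonneg_right hNk V0
    linarith
  have hW : W ≤ C1 * (c * Λ ^ 2 / 2 * Z + c * k * Λ ^ 2 / 4 * V) := by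
    have e1 : W ≤ (1 + 2 * G ^ 2) * (Λ ^ 2 * (Λ ^ 2 / τ)) * V + 2 * (Λ ^ 2 / τ) * Z := by
      have := mul_le_mul_of_nonneg_left p3 (show 0 ≤ Λ ^ 2 / τ by positivity)
      have e : W = Λ ^ 2 * (Λ ^ 2 / τ) * V + Λ ^ 2 / τ * V1 := by rw [hWd]; ring
      rw [e]; linarith
    have e2 : Λ ^ 2 / τ ≤ Λ ^ 2 := div_le_self (by positivity) hτ
    -- The lower bound k ≥ cΛ²/τ for the second factor is what fixes the weights Λ⁴/τ and Λ²/τ of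
    -- the interior energy.
    have e3 : Λ ^ 2 / τ ≤ k / c := by
      rw [div_le_div_iff₀ hτ0 hc]; linarith
    have e4 : C1 * (c * Λ ^ 2 / 2 * Z + c * k * Λ ^ 2 / 4 * V)
        = (1 + 2 * G ^ 2) * (Λ ^ 2 * (k / c)) * V + 2 * Λ ^ 2 * Z
          + (2 * (1 + 2 * G ^ 2) / c * Λ ^ 2 * Z + k * Λ ^ 2 * V) := by
      rw [hC1]; field_simp; ring
    rw [e4]
    have e5 : 0 ≤ 2 * (1 + 2 * G ^ 2) / c * Λ ^ 2 * Z + k * Λ ^ 2 * V := by positivity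
    have e6 : (1 + 2 * G ^ 2) * (Λ ^ 2 * (Λ ^ 2 / τ)) * V
        ≤ (1 + 2 * G ^ 2) * (Λ ^ 2 * (k / c)) * V := by gcongr
    have e7 : 2 * (Λ ^ 2 / τ) * Z ≤ 2 * Λ ^ 2 * Z := by gcongr
    linarith
  have hW' := hW.trans (mul_le_mul_of_nonneg_left main C10)
  constructor
  · have hε' : ∀ x : ℝ, -ε * x ≤ |x| := fun x ↦ by
      refine (le_abs_self _).trans ?_
      rw [abs_mul, abs_neg]
      exact mul_le_of_le_one_left (abs_nonneg x) hε
    have g1 : -ε * (κ1 * Z1) ≤ D * Λ * Z1 := by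
      refine (hε' _).trans ?_
      rw [abs_mul, abs_of_nonneg Z10]; gcongr
    have g2 : -ε * (κ2 * A0) ≤ D * Λ * A0 := by
      refine (hε' _).trans ?_
      rw [abs_mul, abs_of_nonneg A00]; gcongr
    have g3 : 2 * H - ε * (κ1 * Z1) + c * Λ ^ 2 / 2 * (-ε * (κ2 * A0)) ≤
        (2 + D * (2 + 2 * G ^ 2 + c)) * (H + T) := by
      have i1 := mul_le_mul_of_nonneg_left g2 (show 0 ≤ c * Λ ^ 2 / 2 by positivity)
      have i2 := mul_le_mul_of_nonneg_left p2 (show 0 ≤ D * Λ by positivity)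
      have i3 : 0 ≤ D * (2 + 2 * G ^ 2 + c) * H := by positivity
      have i4 : 0 ≤ T := by rw [htr]; positivity
      have i5 : D * Λ * (2 * B0 + 2 * (G * Λ) ^ 2 * A0) + c * Λ ^ 2 / 2 * (D * Λ * A0)
          ≤ D * (2 + 2 * G ^ 2 + c) * T := by
        have j1 : 0 ≤ D * (2 * G ^ 2 + c) * (Λ * B0) := by positivity
        have j2 : 0 ≤ D * (2 + c / 2) * (Λ ^ 3 * A0) := by positivity
        rw [htr]; linarith
      linarith
    rw [mul_assoc]
    exact hW'.trans (mul_le_mul_of_nonneg_left g3 C10)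
  -- On the right of the interface with both κ positive, the boundary terms have the favourable sign
  -- and move to the left, so the trace is bounded by the source alone.
  · intro hε hk1 hk2
    rw [hε] at main hW'
    have g1 : e * Λ * Z1 ≤ κ1 * Z1 := by gcongr
    have g2 : e * Λ * A0 ≤ κ2 * A0 := by gcongr
    have i1 := mul_le_mul_of_nonneg_left g2 (show 0 ≤ c * Λ ^ 2 / 2 by positivity)
    have i0 : 0 ≤ c * Λ ^ 2 / 2 * Z + c * k * Λ ^ 2 / 4 * V := by positivity
    have i2 : e * Λ * Z1 + c * Λ ^ 2 / 2 * (e * Λ * A0) ≤ 2 * H := by linarith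
    have i3 : 2 * H - 1 * (κ1 * Z1) + c * Λ ^ 2 / 2 * (-1 * (κ2 * A0)) ≤ 2 * H := by
      have : 0 ≤ e * Λ * Z1 + c * Λ ^ 2 / 2 * (e * Λ * A0) := by positivity
      linarith
    have i4 : T ≤ (2 / e + (2 + 4 * G ^ 2) / (c * e)) *
        (e * Λ * Z1 + c * Λ ^ 2 / 2 * (e * Λ * A0)) := by
      have j1 := mul_le_mul_of_nonneg_left p4 hΛ0.le
      have j2 : (2 / e + (2 + 4 * G ^ 2) / (c * e)) *
        (e * Λ * Z1 + c * Λ ^ 2 / 2 * (e * Λ * A0)) = 2 * Λ * Z1 + (1 + 2 * G ^ 2) * Λ ^ 3 * A0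
          + (c * Λ ^ 3 * A0 + (2 + 4 * G ^ 2) / c * Λ * Z1) := by
        field_simp; ring
      have j3 : 0 ≤ c * Λ ^ 3 * A0 + (2 + 4 * G ^ 2) / c * Λ * Z1 := by positivity
      rw [htr, j2]; linarith
    have i5 := i4.trans (mul_le_mul_of_nonneg_left i2 (by positivity))
    have i6 := hW'.trans (mul_le_mul_of_nonneg_left i3 C10)
    linarith

namespace Side

variable {ε a b K τ s X α β : ℝ} {t Q : ℝ → ℂ} {m : ℝ → ℝ} {v v1 v2 : ℝ → ℂ}

theorem cont_v (S : Side ε a b K τ s X α β t Q m v v1 v2) : Continuous v :=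
  continuous_iff_continuousAt.2 fun y ↦ (S.v_deriv y).continuousAt

theorem cont_v1 (S : Side ε a b K τ s X α β t Q m v v1 v2) : Continuous v1 :=
  continuous_iff_continuousAt.2 fun y ↦ (S.v1_deriv y).continuousAt

theorem continuous_of_lip {f : ℝ → ℂ} {L : ℝ} (h : ∀ y y', ‖f y - f y'‖ ≤ L * |y - y'|) :
    Continuous f := by
  have : LipschitzWith (Real.toNNReal L) f :=
    LipschitzWith.of_dist_le' fun x y ↦ by simpa [dist_eq_norm] using h x y
  exact this.continuous

theorem cont_t (S : Side ε a b K τ s X α β t Q m v v1 v2) : Continuous t :=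
  continuous_of_lip S.t_lip

theorem cont_Q (S : Side ε a b K τ s X α β t Q m v v1 v2) : Continuous Q :=
  continuous_of_lip S.Q_lip

theorem zero_mem (S : Side ε a b K τ s X α β t Q m v v1 v2) : (0 : ℝ) ∈ Icc a b := by
  rcases S.ends with ⟨-, h, -⟩ | ⟨-, h, -⟩
  · exact ⟨h.le, h ▸ S.hab⟩
  · exact ⟨h ▸ S.hab, h.ge⟩

/-- The Cauchy data vanish at the far end, so only the interface contributes; ε records whether it
is the left or the right endpoint. -/
theorem boundary (S : Side ε a b K τ s X α β t Q m v v1 v2) (f : ℝ → ℝ) (g : ℝ → ℂ) :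
    f b * ‖v1 b + g b * v b‖ ^ 2 - f a * ‖v1 a + g a * v a‖ ^ 2
      = -ε * (f 0 * ‖v1 0 + g 0 * v 0‖ ^ 2) := by
  rcases S.ends with ⟨h1, h, h2, h3⟩ | ⟨h1, h, h2, h3⟩
  · simp [h1, h, h2, h3]
  · simp [h1, h, h2, h3]

theorem boundary' (S : Side ε a b K τ s X α β t Q m v v1 v2) (f : ℝ → ℝ) :
    f b * ‖v b‖ ^ 2 - f a * ‖v a‖ ^ 2 = -ε * (f 0 * ‖v 0‖ ^ 2) := by
  rcases S.ends with ⟨h1, h, h2, h3⟩ | ⟨h1, h, h2, h3⟩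
  · simp [h1, h, h2]
  · simp [h1, h, h2]

theorem bulk_nonneg {Λ : ℝ} (hab : a ≤ b) (hτ : 0 < τ) : 0 ≤ bulk a b τ Λ v v1 := by
  have h1 : 0 ≤ ∫ y in a..b, ‖v y‖ ^ 2 := intervalIntegral.integral_nonneg hab (by intros; positivity)
  have h2 : 0 ≤ ∫ y in a..b, ‖v1 y‖ ^ 2 :=
    intervalIntegral.integral_nonneg hab (by intros; positivity)
  unfold bulk; positivity

/-- The two first order estimates for a given factorization, with boundary terms at `0`. -/
theorem factor (S : Side ε a b K τ s X α β t Q m v v1 v2) (hK : 1 ≤ K) (hτ : 0 < τ) (hX : 0 ≤ X)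
    {μ : ℝ → ℂ} {Lμ N c₁ c₂ : ℝ} (hLμ : 0 ≤ Lμ) (hμ : ∀ y y', ‖μ y - μ y'‖ ≤ Lμ * |y - y'|)
    (hN : ∀ y ∈ Icc a b, ‖Q y - μ y ^ 2‖ + K * (τ + X) + Lμ ≤ N)
    (h1 : ∀ y ∈ Icc a b, c₁ ≤ (τ * (α + β * y) + (t y).im + (μ y).re) ^ 2
      + (τ * β - K * (τ + X) - Lμ))
    (h2 : ∀ y ∈ Icc a b, c₂ ≤ (τ * (α + β * y) + (t y).im - (μ y).re) ^ 2
      + (τ * β - K * (τ + X) - Lμ)) :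
    (c₁ * (∫ y in a..b, ‖v1 y + (Complex.I * t y + μ y) * v y‖ ^ 2) ≤
      2 * (∫ y in a..b, ‖conjOp t Q v v1 v2 y‖ ^ 2) + 2 * N ^ 2 * (∫ y in a..b, ‖v y‖ ^ 2)
        - ε * ((τ * α + (t 0).im + (μ 0).re) * ‖v1 0 + (Complex.I * t 0 + μ 0) * v 0‖ ^ 2)) ∧
    c₂ * (∫ y in a..b, ‖v y‖ ^ 2) ≤
      (∫ y in a..b, ‖v1 y + (Complex.I * t y + μ y) * v y‖ ^ 2)
        - ε * ((τ * α + (t 0).im - (μ 0).re) * ‖v 0‖ ^ 2) := by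
  have h := second_order (v := v) (v1 := v1) (v2 := v2) (Q := Q) S.hab (Lt := K * (τ + X))
    (by positivity) hLμ S.t_lip hμ S.v_deriv S.v1_deriv S.v2_cont S.cont_Q hN h1 h2
  rw [S.boundary (fun y ↦ τ * (α + β * y) + (t y).im + (μ y).re)
      (fun y ↦ Complex.I * t y + μ y),
    S.boundary' (fun y ↦ τ * (α + β * y) + (t y).im - (μ y).re)] at h
  simpa only [mul_zero, add_zero, neg_mul, ← sub_eq_add_neg, conjOp] using h

/-- Combination of the estimates for the two factors. -/
theorem combine (S : Side ε a b K τ s X α β t Q m v v1 v2) (hK : 1 ≤ K) (hτ : 1 ≤ τ) (hX : 0 ≤ X)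
    {μ : ℝ → ℂ} {Lμ N c k G D e : ℝ} (hLμ : 0 ≤ Lμ) (hc : 0 < c) (hD : 0 ≤ D)
    (he : 0 < e) (hμ : ∀ y y', ‖μ y - μ y'‖ ≤ Lμ * |y - y'|)
    (hN : ∀ y ∈ Icc a b, ‖Q y - μ y ^ 2‖ + K * (τ + X) + Lμ ≤ N)
    (h1 : ∀ y ∈ Icc a b, c * (τ + X) ^ 2 ≤ (τ * (α + β * y) + (t y).im + (μ y).re) ^ 2
      + (τ * β - K * (τ + X) - Lμ))
    (h2 : ∀ y ∈ Icc a b, k ≤ (τ * (α + β * y) + (t y).im - (μ y).re) ^ 2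
      + (τ * β - K * (τ + X) - Lμ))
    (hNk : 8 * N ^ 2 ≤ c * (τ + X) ^ 2 * k) (hk : c * (τ + X) ^ 2 ≤ k * τ)
    (hGb : ∀ y, ‖Complex.I * t y + μ y‖ ≤ G * (τ + X))
    (hD1 : |τ * α + (t 0).im + (μ 0).re| ≤ D * (τ + X))
    (hD2 : |τ * α + (t 0).im - (μ 0).re| ≤ D * (τ + X)) :
    bulk a b τ (τ + X) v v1 ≤ (4 * (1 + 2 * G ^ 2) / c ^ 2 + 4 / c) *
      (2 + D * (2 + 2 * G ^ 2 + c)) *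
        ((∫ y in a..b, ‖conjOp t Q v v1 v2 y‖ ^ 2) + trace (τ + X) v v1) ∧
    (ε = 1 → e * (τ + X) ≤ τ * α + (t 0).im + (μ 0).re →
      e * (τ + X) ≤ τ * α + (t 0).im - (μ 0).re →
      bulk a b τ (τ + X) v v1 + trace (τ + X) v v1 ≤
        (2 * (4 * (1 + 2 * G ^ 2) / c ^ 2 + 4 / c) + 2 * (2 / e + (2 + 4 * G ^ 2) / (c * e))) *
          (∫ y in a..b, ‖conjOp t Q v v1 v2 y‖ ^ 2)) := by
  have hf := S.factor hK (by linarith) hX hLμ hμ hN h1 h2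
  have hτ0 : 0 < τ := by linarith
  set Λ := τ + X with hΛ
  have hΛ0 : 0 < Λ := by positivity
  set V := ∫ y in a..b, ‖v y‖ ^ 2 with hV
  set V1 := ∫ y in a..b, ‖v1 y‖ ^ 2 with hV1
  set Z := ∫ y in a..b, ‖v1 y + (Complex.I * t y + μ y) * v y‖ ^ 2 with hZ
  set H := ∫ y in a..b, ‖conjOp t Q v v1 v2 y‖ ^ 2 with hH
  have V0 : 0 ≤ V := intervalIntegral.integral_nonneg S.hab (by intros; positivity)
  have V10 : 0 ≤ V1 := intervalIntegral.integral_nonneg S.hab (by intros; positivity)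
  have Z0 : 0 ≤ Z := intervalIntegral.integral_nonneg S.hab (by intros; positivity)
  have H0 : 0 ≤ H := intervalIntegral.integral_nonneg S.hab (by intros; positivity)
  have cv := S.cont_v
  have cv1 := S.cont_v1
  have ct := S.cont_t
  have cμ := continuous_of_lip hμ
  have hb : ∀ y, ‖(Complex.I * t y + μ y) * v y‖ ≤ (G * Λ) * ‖v y‖ := fun y ↦ by
    rw [norm_mul]; exact mul_le_mul_of_nonneg_right (hGb y) (norm_nonneg _)
  have p1 : ∀ y, ‖v1 y‖ ^ 2 ≤ 2 * ‖v1 y + (Complex.I * t y + μ y) * v y‖ ^ 2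
      + 2 * (G * Λ) ^ 2 * ‖v y‖ ^ 2 := fun y ↦ by
    refine norm_sq_le_of_norm_le_add ?_
    have := norm_sub_le (v1 y + (Complex.I * t y + μ y) * v y) ((Complex.I * t y + μ y) * v y)
    rw [add_sub_cancel_right] at this
    linarith [hb y]
  have p2 : ‖v1 0 + (Complex.I * t 0 + μ 0) * v 0‖ ^ 2 ≤ 2 * ‖v1 0‖ ^ 2
      + 2 * (G * Λ) ^ 2 * ‖v 0‖ ^ 2 := by
    refine norm_sq_le_of_norm_le_add ?_
    exact (norm_add_le _ _).trans (add_le_add le_rfl (hb 0))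
  have p3 : V1 ≤ 2 * Z + 2 * (G * Λ) ^ 2 * V := by
    rw [hZ, hV, ← intervalIntegral.integral_const_mul (2 : ℝ),
      ← intervalIntegral.integral_const_mul (2 * (G * Λ) ^ 2),
      ← intervalIntegral.integral_add (Continuous.intervalIntegrable (by fun_prop) _ _)
        (Continuous.intervalIntegrable (by fun_prop) _ _)]
    exact intervalIntegral.integral_mono_on S.hab (Continuous.intervalIntegrable (by fun_prop) _ _)
      (Continuous.intervalIntegrable (by fun_prop) _ _) fun y _ ↦ p1 y
  have p4 := p1 0
  set A0 := ‖v 0‖ ^ 2 with hA0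
  set B0 := ‖v1 0‖ ^ 2 with hB0
  set Z1 := ‖v1 0 + (Complex.I * t 0 + μ 0) * v 0‖ ^ 2 with hZ1
  have A00 : 0 ≤ A0 := by positivity
  have B00 : 0 ≤ B0 := by positivity
  have Z10 : 0 ≤ Z1 := by positivity
  have hε : |ε| ≤ 1 := by rcases S.ends with ⟨h, -⟩ | ⟨h, -⟩ <;> simp [h]
  exact combine_arith hε hτ hΛ0 hc hD he hNk hk hD1 hD2 V0 Z0 H0 A00 B00 Z10 p3 p2 p4 hf.1 hf.2
    rfl rfl

end Side

end Carleman

end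

/-! ### Complex square roots and the low-frequency estimate. -/

noncomputable section

namespace Carleman

open MeasureTheory Set Filter Topology

/-- A square root whose real part is bounded below. -/
theorem exists_sqrt {Q : ℝ → ℂ} {r : ℝ} (hQ : ∀ y, r ^ 2 ≤ (Q y).re) :
    ∃ μ : ℝ → ℂ, ∀ y, μ y ^ 2 = Q y ∧ r ≤ (μ y).re := by
  refine ⟨fun y ↦ Q y ^ (2⁻¹ : ℂ), fun y ↦ ⟨?_, ?_⟩⟩
  · simp
  · simp only
    rw [Complex.cpow_inv_two_re]
    refine Real.le_sqrt_of_sq_le ?_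
    have := (le_abs_self _).trans (Complex.abs_re_le_norm (Q y))
    linarith [hQ y]

/-- Factor z² − w² = (z − w)(z + w) and use Re(z + w) ≥ r. This transfers to the root μ both the
Lipschitz bound of Q and its closeness to m². -/
theorem norm_sub_le_of_sq {r : ℝ} {z w : ℂ} (hr : 0 < r) (hz : r ≤ z.re) (hw : 0 ≤ w.re) :
    ‖z - w‖ ≤ ‖z ^ 2 - w ^ 2‖ / r := by
  rw [le_div_iff₀ hr, show z ^ 2 - w ^ 2 = (z - w) * (z + w) by ring, norm_mul]
  refine mul_le_mul_of_nonneg_left ?_ (norm_nonneg _)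
  have := (le_abs_self _).trans (Complex.abs_re_le_norm (z + w))
  rw [Complex.add_re] at this
  linarith

namespace Side

variable {ε a b K τ s X α β : ℝ} {t Q : ℝ → ℂ} {m : ℝ → ℝ} {v v1 v2 : ℝ → ℂ}

theorem norm_Q_le (S : Side ε a b K τ s X α β t Q m v v1 v2) (hK : 1 ≤ K) (hX : 0 ≤ X) (y : ℝ) :
    ‖Q y‖ ≤ K ^ 2 * X ^ 2 + K * s * (τ + X) ^ 2 := by
  have h1 := S.Q_near y
  have h2 := norm_add_le (Q y - (m y : ℂ) ^ 2) ((m y : ℂ) ^ 2)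
  rw [sub_add_cancel] at h2
  have h3 : 0 ≤ m y := by
    have := S.m_lower y
    by_contra hneg
    have : K * m y < 0 := mul_neg_of_pos_of_neg (by linarith) (not_le.1 hneg)
    linarith
  have h4 : ‖(m y : ℂ) ^ 2‖ ≤ K ^ 2 * X ^ 2 := by
    rw [norm_pow, Complex.norm_real, Real.norm_of_nonneg h3, ← mul_pow]
    exact pow_le_pow_left₀ h3 (S.m_upper y) 2
  linarith

/-- The estimates at low frequencies, where both factors are elliptic with the same sign. -/
theorem low {K α : ℝ} (hK : 1 ≤ K) (hα : 0 < α) :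
    ∃ c₀ s₀ τ₀ C : ℝ, 0 < c₀ ∧ 0 < s₀ ∧ 1 ≤ τ₀ ∧ 0 < C ∧
      ∀ {ε a b τ s X β : ℝ} {t Q : ℝ → ℂ} {m : ℝ → ℝ} {v v1 v2 : ℝ → ℂ},
        Side ε a b K τ s X α β t Q m v v1 v2 → τ₀ ≤ τ → 0 ≤ s → s ≤ s₀ → 0 ≤ X → X ≤ c₀ * τ →
        0 ≤ β →
        bulk a b τ (τ + X) v v1 ≤
          C * ((∫ y in a..b, ‖conjOp t Q v v1 v2 y‖ ^ 2) + trace (τ + X) v v1) ∧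
        (ε = 1 → bulk a b τ (τ + X) v v1 + trace (τ + X) v v1 ≤
          C * (∫ y in a..b, ‖conjOp t Q v v1 v2 y‖ ^ 2)) := by
  -- Since κ ≥ ατ/4, κ² ≥ 8cτ². Half of this dominates cΛ² ≤ 4cτ², and the other half absorbs KΛ ≤
  -- 2Kτ as soon as τ ≥ 64K/α².
  obtain ⟨c, hc⟩ : ∃ c, c = α ^ 2 / 128 := ⟨_, rfl⟩
  have hc0 : 0 < c := by rw [hc]; positivity
  have hK0 : 0 < K := by linarith
  set C1 := (4 * (1 + 2 * K ^ 2) / c ^ 2 + 4 / c) * (2 + (2 * α + K) * (2 + 2 * K ^ 2 + c))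
  set C2 := (2 * (4 * (1 + 2 * K ^ 2) / c ^ 2 + 4 / c) +
    2 * (2 / (α / 8) + (2 + 4 * K ^ 2) / (c * (α / 8))))
  have hC1 : 0 < C1 := by positivity
  have hC2 : 0 < C2 := by positivity
  -- The three denominators with 9 make each of K²X², KsΛ² and KΛ at most cΛ²/9, so the residual is
  -- at most cΛ²/3. The bound α/(4K) on s keeps |Im t| ≤ ατ/4.
  refine ⟨min 1 (c / (9 * K ^ 2)), min 1 (min (c / (9 * K)) (α / (4 * K))),
    max 1 (max (64 * K / α ^ 2) (9 * K / c)), C1 + C2, by positivity, by positivity,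
    le_max_left _ _, by positivity, ?_⟩
  intro ε a b τ s X β t Q m v v1 v2 S hτ hs0 hs hX hXτ hβ
  simp only [max_le_iff, le_min_iff] at hτ hs
  obtain ⟨hτ1, hτ2, hτ3⟩ := hτ
  obtain ⟨hs1, hs2, hs3⟩ := hs
  rw [div_le_iff₀ (by positivity)] at hτ2 hτ3
  rw [le_div_iff₀ (by positivity)] at hs2 hs3
  have hτ0 : 0 < τ := by linarith
  have hX1 : X ≤ τ := hXτ.trans (by
    have := mul_le_mul_of_nonneg_right (min_le_left 1 (c / (9 * K ^ 2))) hτ0.le; linarith)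
  have hX2 : 9 * K ^ 2 * X ≤ c * τ := by
    have h1 := min_le_right 1 (c / (9 * K ^ 2))
    have h2 : X ≤ c / (9 * K ^ 2) * τ := hXτ.trans (mul_le_mul_of_nonneg_right h1 hτ0.le)
    rw [div_mul_eq_mul_div, le_div_iff₀ (by positivity)] at h2
    linarith
  have him : ∀ y, |(t y).im| ≤ α / 4 * τ := fun y ↦ (S.t_im y).trans (by
    refine mul_le_mul_of_nonneg_right ?_ hτ0.le; linarith)
  have hκ : ∀ y ∈ Icc a b, α / 4 * τ ≤ τ * (α + β * y) + (t y).im := fun y hy ↦ by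
    have h1 := mul_le_mul_of_nonneg_left (S.range y hy).1 hτ0.le
    have h2 := (abs_le.1 (him y)).1
    linarith
  have hlow : ∀ y ∈ Icc a b, c * (τ + X) ^ 2 ≤ (τ * (α + β * y) + (t y).im) ^ 2
      + (τ * β - K * (τ + X) - 0) := fun y hy ↦ by
    have h1 := pow_le_pow_left₀ (by positivity) (hκ y hy) 2
    have h2 : c * (τ + X) ^ 2 ≤ c * (2 * τ) ^ 2 := by gcongr; linarith
    have h3 : K * (τ + X) ≤ K * (2 * τ) := by gcongr; linarith
    have h4 := mul_le_mul_of_nonneg_right hτ2 hτ0.le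
    have h5 : 0 ≤ τ * β := by positivity
    rw [hc] at h2 ⊢
    linarith
  -- With μ = 0 the two factors coincide and all of Q is treated as residual; 8(c/3)² ≤ c² makes it
  -- absorbable.
  have key := S.combine (N := c / 3 * (τ + X) ^ 2) (μ := fun _ ↦ 0) (Lμ := 0) (c := c)
    (k := c * (τ + X) ^ 2) (G := K) (D := 2 * α + K) (e := α / 8) hK hτ1 hX le_rfl hc0
    (by positivity) (by positivity) (fun _ _ ↦ by simp)
    (fun y hy ↦ ?_) (by simpa using hlow) (by simpa using hlow) ?_ ?_ ?_ ?_ ?_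
  · obtain ⟨k1, k2⟩ := key
    have hH : 0 ≤ ∫ y in a..b, ‖conjOp t Q v v1 v2 y‖ ^ 2 :=
      intervalIntegral.integral_nonneg S.hab (by intros; positivity)
    have htr : 0 ≤ trace (τ + X) v v1 := by unfold trace; positivity
    refine ⟨k1.trans (mul_le_mul_of_nonneg_right
      (show _ ≤ C1 + C2 from le_add_of_nonneg_right hC2.le) (by positivity)), fun hε ↦ ?_⟩
    have h0 := (abs_le.1 (him 0)).1
    refine (k2 hε ?_ ?_).trans (mul_le_mul_of_nonneg_right
      (show _ ≤ C1 + C2 from le_add_of_nonneg_left hC1.le) hH)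
    · simp only [Complex.zero_re]; linarith [mul_le_mul_of_nonneg_left hX1 hα.le, mul_pos hα hτ0]
    · simp only [Complex.zero_re]; linarith [mul_le_mul_of_nonneg_left hX1 hα.le, mul_pos hα hτ0]
  · have h1 := S.norm_Q_le hK hX y
    have h2 : 9 * (K ^ 2 * X ^ 2) ≤ c * (τ + X) ^ 2 := by
      have := mul_le_mul_of_nonneg_right hX2 hX
      have h3 : c * τ * X ≤ c * (τ + X) ^ 2 := by
        rw [mul_assoc]; gcongr; linarith [sq_nonneg τ, sq_nonneg X, mul_nonneg hτ0.le hX]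
      linarith
    have h3 : 9 * (K * s * (τ + X) ^ 2) ≤ c * (τ + X) ^ 2 := by
      rw [← mul_assoc]; gcongr; linarith
    have h4 : 9 * (K * (τ + X)) ≤ c * (τ + X) ^ 2 := by
      have h5 : 9 * K ≤ c * (τ + X) := by linarith [mul_nonneg hc0.le hX]
      have := mul_le_mul_of_nonneg_right h5 (show 0 ≤ τ + X by positivity)
      linarith
    simp only [ne_eq, OfNat.ofNat_ne_zero, not_false_eq_true, zero_pow, sub_zero]
    linarith
  · have : 0 ≤ (c * (τ + X) ^ 2) ^ 2 := by positivity
    linarith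
  · exact le_mul_of_one_le_right (by positivity) hτ1
  · intro y
    simpa using S.t_bd y
  all_goals
    have h0 := abs_le.1 (S.t_im 0)
    have h1 : K * s * τ ≤ K * (τ + X) := by
      rw [mul_assoc]; gcongr; linarith [mul_le_mul_of_nonneg_right hs1 hτ0.le]
    have h2 : 0 ≤ α * X := by positivity
    have h3 : 0 ≤ α * τ := by positivity
    rw [abs_le]
    simp only [Complex.zero_re]
    constructor <;> linarith

end Side

end Carleman

end

/-! ### High frequencies: convexity of the phase and control of the traces. -/

noncomputable section

namespace Carleman

open MeasureTheory Set Filter Topology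

namespace Side

/-- Lower bound for the symbol of the second factor, by convexity of the phase. -/
theorem convexity_bound {cp L E τ Λ κ p ψ β : ℝ} (hcp : 0 < cp) (hτ : 1 ≤ τ) (hΛ : τ ≤ Λ)
    (hL : 0 ≤ L) (hE : 0 ≤ E) (h8 : 8 * L ≤ cp ^ 2 * Λ) (hp : cp * Λ ≤ p) (hκ : κ = ψ - p)
    (hψ : 2 * ψ ≤ E * cp * τ) (hβ : L * E + E ^ 2 ≤ β) (hc1 : cp ≤ 1) :
    cp ^ 2 / 8 * Λ ^ 2 / τ ≤ κ ^ 2 + (τ * β - L * Λ) := by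
  have hτ0 : 0 < τ := by linarith
  have hΛ0 : 0 < Λ := by linarith
  rw [div_le_iff₀ hτ0]
  -- If |κ| is comparable to Λ, then κ² suffices. Otherwise ψ = κ + p ≥ cpΛ/2 forces Λ ≤ Eτ, and τβ
  -- ≥ LΛ + E²τ leaves E²τ ≥ Λ²/τ.
  by_cases h : cp / 2 * Λ ≤ |κ|
  · have h1 := pow_le_pow_left₀ (by positivity) h 2
    rw [sq_abs] at h1
    have h2 := mul_le_mul_of_nonneg_right h8 hΛ0.le
    have h3 : 0 ≤ τ * β := by
      have : 0 ≤ L * E + E ^ 2 := by positivity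
      exact mul_nonneg hτ0.le (this.trans hβ)
    have h4 : cp ^ 2 / 8 * Λ ^ 2 ≤ κ ^ 2 + (τ * β - L * Λ) := by linarith
    refine h4.trans (le_mul_of_one_le_right (le_trans (by positivity) h4) hτ)
  · have h1 := neg_le_of_abs_le (not_le.1 h).le
    have h2 : cp * Λ ≤ cp * (E * τ) := by linarith
    have h3 : Λ ≤ E * τ := le_of_mul_le_mul_left h2 hcp
    have h4 : τ * (L * E + E ^ 2) ≤ τ * β := mul_le_mul_of_nonneg_left hβ hτ0.le
    have h5 := mul_le_mul_of_nonneg_left h3 hL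
    have h6 : E ^ 2 * τ ≤ κ ^ 2 + (τ * β - L * Λ) := by linarith [sq_nonneg κ]
    have h7 := mul_le_mul_of_nonneg_right h6 hτ0.le
    have h8 := pow_le_pow_left₀ hΛ0.le h3 2
    have h9 : cp ^ 2 ≤ 1 := pow_le_one₀ hcp.le hc1
    have h10 := mul_le_mul_of_nonneg_right h9 (sq_nonneg Λ)
    have h11 := sq_nonneg Λ
    linarith

/-- The estimates at high frequencies, with the square root `μ` of `Q`. -/
theorem high {K α c₁ e : ℝ} (hK : 1 ≤ K) (hα : 0 < α) (hc₁ : 0 < c₁) (hc₁' : c₁ ≤ 1) (he : 0 < e)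
    (hecp : e ≤ c₁ / (2 * K)) :
    ∃ s₀ τ₀ β₀ C : ℝ, 0 < s₀ ∧ 1 ≤ τ₀ ∧ 0 < β₀ ∧ 0 < C ∧
      ∀ {ε a b τ s X β : ℝ} {t Q : ℝ → ℂ} {m : ℝ → ℝ} {v v1 v2 : ℝ → ℂ},
        Side ε a b K τ s X α β t Q m v v1 v2 → τ₀ ≤ τ → 0 ≤ s → s ≤ s₀ → 0 ≤ X →
        c₁ * (τ + X) ≤ X → β₀ ≤ β → ∃ μ : ℂ,
        c₁ / (2 * K) * (τ + X) ≤ μ.re ∧ ‖μ‖ ≤ 2 * K * (τ + X) ∧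
        ‖μ - m 0‖ ≤ K / (c₁ / (2 * K)) * s * (τ + X) ∧
        bulk a b τ (τ + X) v v1 ≤
          C * ((∫ y in a..b, ‖conjOp t Q v v1 v2 y‖ ^ 2) + trace (τ + X) v v1) ∧
        (ε = 1 → e * (τ + X) ≤ τ * α + (t 0).im - μ.re →
          bulk a b τ (τ + X) v v1 + trace (τ + X) v v1 ≤
          C * (∫ y in a..b, ‖conjOp t Q v v1 v2 y‖ ^ 2)) ∧
        (ε = 1 → (τ + X) * ‖v1 0 + (Complex.I * t 0 + μ) * v 0‖ ^ 2 ≤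
          C * ((∫ y in a..b, ‖conjOp t Q v v1 v2 y‖ ^ 2) + bulk a b τ (τ + X) v v1 / τ)) ∧
        (ε = -1 → τ * α + (t 0).im - μ.re ≤ -(e * (τ + X)) →
          (τ + X) * ‖v1 0 + (Complex.I * t 0 - μ) * v 0‖ ^ 2 ≤
          C * ((∫ y in a..b, ‖conjOp t Q v v1 v2 y‖ ^ 2) + bulk a b τ (τ + X) v v1 / τ)) := by
  have hK0 : 0 < K := by linarith
  -- The choice gives m ≥ X/K ≥ 2cpΛ. Hence m² ≥ 4cp²Λ², and a perturbation of at most 2cp²Λ² still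
  -- leaves Re Q ≥ (cpΛ)², so Re μ ≥ cpΛ.
  obtain ⟨cp, hcp⟩ : ∃ cp, cp = c₁ / (2 * K) := ⟨_, rfl⟩
  have hcp0 : 0 < cp := by rw [hcp]; positivity
  have hcpK : cp * (2 * K) = c₁ := by rw [hcp]; field_simp
  have hcp1 : cp ≤ 1 := by
    rw [hcp, div_le_one (by positivity)]; linarith
  rw [← hcp] at hecp ⊢
  obtain ⟨c, hc⟩ : ∃ c, c = cp ^ 2 / 8 := ⟨_, rfl⟩
  have hc0 : 0 < c := by rw [hc]; positivity
  -- LΛ is the sum of the Lipschitz constants of t and μ. E is chosen below so that 2(τ∂_yφ + Im t)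
  -- ≤ E·cp·τ, as the convexity bound requires.
  obtain ⟨L, hL⟩ : ∃ L, L = K + K / cp := ⟨_, rfl⟩
  have hL0 : 0 < L := by rw [hL]; positivity
  obtain ⟨E, hE⟩ : ∃ E, E = 2 * (2 * α + K) / cp := ⟨_, rfl⟩
  have hE0 : 0 < E := by rw [hE]; positivity
  have hEcp : E * cp = 2 * (2 * α + K) := by rw [hE]; field_simp
  set C1 := (4 * (1 + 2 * (3 * K) ^ 2) / c ^ 2 + 4 / c) *
    (2 + (2 * α + 3 * K) * (2 + 2 * (3 * K) ^ 2 + c)) with hC1d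
  set C2 := (2 * (4 * (1 + 2 * (3 * K) ^ 2) / c ^ 2 + 4 / c) +
    2 * (2 / e + (2 + 4 * (3 * K) ^ 2) / (c * e))) with hC2d
  set C3 := (2 + 2 * L ^ 2) / e with hC3d
  have hC1 : 0 < C1 := by positivity
  have hC2 : 0 < C2 := by positivity
  have hC3 : 0 < C3 := by positivity
  have hC1' : C1 ≤ C1 + C2 + C3 := by linarith only [hC2, hC3]
  have hC2' : C2 ≤ C1 + C2 + C3 := by linarith only [hC1, hC3]
  have hC3' : C3 ≤ C1 + C2 + C3 := by linarith only [hC1, hC2]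
  -- The bounds on s preserve Re Q ≥ (cpΛ)² and τ∂_yφ + Im t ≥ 0. Those on τ absorb the Lipschitz
  -- loss LΛ into κ² and the residual LΛ into the combined estimate; the bound on β comes from the
  -- convexity bound.
  refine ⟨min 1 (min (2 * cp ^ 2 / K) (α / (2 * K))), max 1 (max (8 * L / cp ^ 2)
    (8 * L ^ 2 / c ^ 2)), L * E + E ^ 2, C1 + C2 + C3, by positivity, le_max_left _ _,
    by positivity, by positivity, ?_⟩
  clear_value C1 C2 C3
  intro ε a b τ s X β t Q m v v1 v2 S hτ hs0 hs hX hXΛ hβ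
  simp only [max_le_iff, le_min_iff] at hτ hs
  obtain ⟨hτ1, hτ2, hτ3⟩ := hτ
  obtain ⟨hs1, hs2, hs3⟩ := hs
  rw [div_le_iff₀ (by positivity)] at hτ2 hτ3
  rw [le_div_iff₀ (by positivity)] at hs2 hs3
  have hτ0 : 0 < τ := by linarith
  obtain ⟨Λ, hΛ⟩ : ∃ Λ, Λ = τ + X := ⟨_, rfl⟩
  have hτΛ : τ ≤ Λ := by linarith
  have hΛ0 : 0 < Λ := by linarith
  have hΛ1 : 1 ≤ Λ := by linarith
  have hXΛ' : X ≤ Λ := by linarith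
  have hβ0 : 0 ≤ β := le_trans (by positivity) hβ
  rw [← hΛ] at hXΛ ⊢
  have hm : ∀ y, 2 * cp * Λ ≤ m y := fun y ↦ by
    have h1 := S.m_lower y
    have h2 : K * (2 * cp * Λ) ≤ K * m y := by
      rw [show K * (2 * cp * Λ) = cp * (2 * K) * Λ by ring, hcpK]; linarith
    exact le_of_mul_le_mul_left h2 hK0
  have hQre : ∀ y, (cp * Λ) ^ 2 ≤ (Q y).re := fun y ↦ by
    have h1 := (Complex.abs_re_le_norm _).trans (S.Q_near y)
    rw [← hΛ, Complex.sub_re, show ((m y : ℂ) ^ 2).re = m y ^ 2 by norm_cast] at h1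
    have h2 := (abs_le.1 h1).1
    have h3 := pow_le_pow_left₀ (by positivity) (hm y) 2
    have h4 := mul_le_mul_of_nonneg_right hs2 (sq_nonneg Λ)
    have h5 : 0 ≤ (cp * Λ) ^ 2 := sq_nonneg _
    linarith
  obtain ⟨μ, hμ⟩ := exists_sqrt hQre
  have hcpΛ : 0 < cp * Λ := by positivity
  have hμlip : ∀ y y', ‖μ y - μ y'‖ ≤ K / cp * Λ * |y - y'| := fun y y' ↦ by
    refine (norm_sub_le_of_sq hcpΛ (hμ y).2 (hcpΛ.le.trans (hμ y').2)).trans ?_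
    rw [(hμ y).1, (hμ y').1, div_le_iff₀ hcpΛ]
    refine (S.Q_lip y y').trans (le_of_eq ?_)
    rw [← hΛ]; field_simp
  have hμnear : ‖μ 0 - m 0‖ ≤ K / cp * s * Λ := by
    refine (norm_sub_le_of_sq hcpΛ (hμ 0).2 ?_).trans ?_
    · rw [Complex.ofReal_re]; exact le_trans (by positivity) (hm 0)
    · rw [(hμ 0).1, div_le_iff₀ hcpΛ]
      refine (S.Q_near 0).trans (le_of_eq ?_)
      rw [← hΛ]; field_simp
  have hμb : ∀ y, ‖μ y‖ ≤ 2 * K * Λ := fun y ↦ by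
    have h1 := S.norm_Q_le hK hX y
    rw [← (hμ y).1, norm_pow, ← hΛ] at h1
    refine le_of_sq_le_sq ?_ (by positivity)
    have h2 : X ^ 2 ≤ Λ ^ 2 := pow_le_pow_left₀ hX hXΛ' 2
    have h3 : K ^ 2 * X ^ 2 ≤ K ^ 2 * Λ ^ 2 := by gcongr
    have h4 : K * s * Λ ^ 2 ≤ K * K * Λ ^ 2 := by gcongr; linarith
    have h5 : 0 ≤ K ^ 2 * Λ ^ 2 := by positivity
    linarith
  have hsτ : K * s * τ ≤ α / 2 * τ := by
    refine mul_le_mul_of_nonneg_right ?_ hτ0.le; linarith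
  have hsK : K * s * τ ≤ K * τ := by
    refine mul_le_mul_of_nonneg_right ?_ hτ0.le
    exact mul_le_of_le_one_right hK0.le hs1
  have hψ0 : ∀ y ∈ Icc a b, 0 ≤ τ * (α + β * y) + (t y).im := fun y hy ↦ by
    have h1 := mul_le_mul_of_nonneg_left (S.range y hy).1 hτ0.le
    have h2 := (abs_le.1 ((S.t_im y).trans hsτ)).1
    linarith
  have hψ1 : ∀ y ∈ Icc a b, τ * (α + β * y) + (t y).im ≤ (2 * α + K) * τ := fun y hy ↦ by
    have h1 := mul_le_mul_of_nonneg_left (S.range y hy).2 hτ0.le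
    have h2 := (abs_le.1 ((S.t_im y).trans hsK)).2
    linarith
  have hL8 : 8 * L ≤ cp ^ 2 * Λ := by
    have := mul_le_mul_of_nonneg_left hτΛ (sq_nonneg cp); linarith
  have hLΛ : ∀ w : ℝ, w - K * Λ - K / cp * Λ = w - L * Λ := fun w ↦ by rw [hL]; ring
  have hk1 : ∀ y ∈ Icc a b, c * Λ ^ 2 ≤ (τ * (α + β * y) + (t y).im + (μ y).re) ^ 2
      + (τ * β - K * Λ - K / cp * Λ) := fun y hy ↦ by
    have h1 : cp * Λ ≤ τ * (α + β * y) + (t y).im + (μ y).re := by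
      linarith [hψ0 y hy, (hμ y).2]
    have h2 := pow_le_pow_left₀ hcpΛ.le h1 2
    have h3 := mul_le_mul_of_nonneg_right hL8 hΛ0.le
    have h4 : 0 ≤ τ * β := by positivity
    have h5 : 0 ≤ cp ^ 2 * Λ ^ 2 := by positivity
    rw [hLΛ, hc]
    linarith
  have hk2 : ∀ y ∈ Icc a b, c * Λ ^ 2 / τ ≤ (τ * (α + β * y) + (t y).im - (μ y).re) ^ 2
      + (τ * β - K * Λ - K / cp * Λ) := fun y hy ↦ by
    rw [hLΛ, hc]
    refine convexity_bound hcp0 hτ1 hτΛ hL0.le hE0.le hL8 (hμ y).2 rfl ?_ hβ hcp1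
    rw [hEcp]
    linarith [hψ1 y hy]
  have hN : ∀ y ∈ Icc a b, ‖Q y - μ y ^ 2‖ + K * (τ + X) + K / cp * Λ ≤ L * Λ := fun y _ ↦ by
    rw [(hμ y).1, sub_self, norm_zero, ← hΛ, hL]
    exact le_of_eq (by ring)
  have h0 := S.zero_mem
  have hκ0 := hψ0 0 h0
  have hκ1 := hψ1 0 h0
  rw [mul_zero, add_zero] at hκ0 hκ1
  have hμre := (abs_le.1 ((Complex.abs_re_le_norm (μ 0)).trans (hμb 0)))
  have hτΛ' : (2 * α + K) * τ ≤ (2 * α + K) * Λ := by gcongr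
  have hLμ : 0 ≤ K / cp * Λ := by positivity
  -- Here Q = μ² exactly, so only derivatives enter the residual, and the second factor contributes
  -- the convexity bound cΛ²/τ.
  have key := S.combine (N := L * Λ) (μ := μ) (Lμ := K / cp * Λ) (c := c)
    (k := c * Λ ^ 2 / τ) (G := 3 * K) (D := 2 * α + 3 * K) (e := e) hK hτ1 hX hLμ hc0
    (by positivity) he hμlip hN (by rw [← hΛ]; exact hk1) (by rw [← hΛ]; exact hk2) ?_ ?_ ?_ ?_ ?_
  rotate_left
  · rw [← hΛ, mul_div_assoc', le_div_iff₀ hτ0]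
    have h2 : 8 * L ^ 2 * τ ≤ c ^ 2 * Λ * Λ := by
      have := mul_le_mul (hτ3.trans (mul_le_mul_of_nonneg_right hτΛ (sq_nonneg c))) hτΛ hτ0.le
        (by positivity)
      linarith
    have := mul_le_mul_of_nonneg_right h2 (sq_nonneg Λ)
    linarith
  · rw [← hΛ, div_mul_cancel₀ _ hτ0.ne']
  · intro y
    have h1 := norm_add_le (Complex.I * t y) (μ y)
    rw [norm_mul, Complex.norm_I, one_mul] at h1
    have h2 := S.t_bd y
    rw [← hΛ] at h2 ⊢
    linarith [hμb y]
  · rw [← hΛ, abs_le]; constructor <;> linarith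
  · rw [← hΛ, abs_le]; constructor <;> linarith
  rw [← hΛ] at key
  obtain ⟨i1, i2⟩ := key
  have hH : 0 ≤ ∫ y in a..b, ‖conjOp t Q v v1 v2 y‖ ^ 2 :=
    intervalIntegral.integral_nonneg S.hab (by intros; positivity)
  have hV : 0 ≤ ∫ y in a..b, ‖v y‖ ^ 2 :=
    intervalIntegral.integral_nonneg S.hab (by intros; positivity)
  have hV1 : 0 ≤ ∫ y in a..b, ‖v1 y‖ ^ 2 :=
    intervalIntegral.integral_nonneg S.hab (by intros; positivity)
  have htr : 0 ≤ trace Λ v v1 := by unfold trace; positivity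
  have hbulk : 0 ≤ bulk a b τ Λ v v1 := bulk_nonneg S.hab hτ0
  -- Because Λ⁴/τ ≥ τΛ², the squared residual is only 1/τ of the interior energy. This gain later
  -- permits absorption.
  have hVW : Λ ^ 2 * (∫ y in a..b, ‖v y‖ ^ 2) ≤ bulk a b τ Λ v v1 / τ := by
    rw [le_div_iff₀ hτ0]
    have h1 : Λ ^ 2 * τ ≤ Λ ^ 4 / τ := by
      rw [le_div_iff₀ hτ0]
      have := pow_le_pow_left₀ hτ0.le hτΛ 2
      have := mul_le_mul_of_nonneg_left this (sq_nonneg Λ)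
      linarith
    have h2 := mul_le_mul_of_nonneg_right h1 hV
    have h3 : 0 ≤ Λ ^ 2 / τ * ∫ y in a..b, ‖v1 y‖ ^ 2 := by positivity
    unfold bulk
    linarith
  have htrace : ∀ z : ℝ, e * Λ * z ≤ 2 * (∫ y in a..b, ‖conjOp t Q v v1 v2 y‖ ^ 2)
      + 2 * (L * Λ) ^ 2 * (∫ y in a..b, ‖v y‖ ^ 2) →
      Λ * z ≤ (C1 + C2 + C3) *
        ((∫ y in a..b, ‖conjOp t Q v v1 v2 y‖ ^ 2) + bulk a b τ Λ v v1 / τ) := fun z hz ↦ by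
    have hW : 0 ≤ bulk a b τ Λ v v1 / τ := by positivity
    refine le_trans ?_ (mul_le_mul_of_nonneg_right hC3' (by positivity))
    rw [hC3d, div_mul_eq_mul_div, le_div_iff₀ he]
    have h1 := mul_le_mul_of_nonneg_left hVW (show 0 ≤ 2 * L ^ 2 by positivity)
    have h2 : 0 ≤ L ^ 2 * ∫ y in a..b, ‖conjOp t Q v v1 v2 y‖ ^ 2 := by positivity
    linarith
  refine ⟨μ 0, (hμ 0).2, hμb 0, hμnear, ?_, ?_, ?_, ?_⟩
  · exact i1.trans (mul_le_mul_of_nonneg_right (hC1d ▸ hC1') (by positivity))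
  · intro hε h2
    refine (i2 hε ?_ h2).trans (mul_le_mul_of_nonneg_right (hC2d ▸ hC2') hH)
    have := mul_le_mul_of_nonneg_right hecp hΛ0.le
    linarith [(hμ 0).2]
  -- Drop the interior term of the + factor: at the left endpoint its boundary term has the good
  -- sign, since κ ≥ eΛ there.
  · intro hε
    refine htrace _ ?_
    have hf := (S.factor hK hτ0 hX hLμ hμlip hN (by rw [← hΛ]; exact hk1)
      (by rw [← hΛ]; exact hk2)).1
    rw [hε] at hf
    have h1 : 0 ≤ c * Λ ^ 2 * ∫ y in a..b, ‖v1 y + (Complex.I * t y + μ y) * v y‖ ^ 2 :=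
      mul_nonneg (by positivity)
        (intervalIntegral.integral_nonneg S.hab (by intros; positivity))
    have h2 : e * Λ * ‖v1 0 + (Complex.I * t 0 + μ 0) * v 0‖ ^ 2 ≤
        (τ * α + (t 0).im + (μ 0).re) * ‖v1 0 + (Complex.I * t 0 + μ 0) * v 0‖ ^ 2 := by
      refine mul_le_mul_of_nonneg_right ?_ (by positivity)
      have := mul_le_mul_of_nonneg_right hecp hΛ0.le
      linarith [(hμ 0).2]
    linarith
  -- Replacing μ by −μ reverses the order of the factors. The quantity v1 + (it − μ)v then satisfies
  -- the equation whose κ is negative at 0, which is the good sign at a right endpoint.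
  · intro hε hneg
    refine htrace _ ?_
    have hf := (S.factor (μ := fun y ↦ -μ y) (N := L * Λ) (c₁ := c * Λ ^ 2 / τ)
      (c₂ := c * Λ ^ 2) hK hτ0 hX hLμ
      (fun y y' ↦ by rw [← neg_sub', norm_neg]; exact hμlip y y')
      (fun y hy ↦ by rw [neg_sq]; exact hN y hy)
      (fun y hy ↦ by rw [← hΛ, Complex.neg_re, ← sub_eq_add_neg]; exact hk2 y hy)
      (fun y hy ↦ by rw [← hΛ, Complex.neg_re, sub_neg_eq_add]; exact hk1 y hy)).1
    rw [hε] at hf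
    simp only [Complex.neg_re, ← sub_eq_add_neg] at hf
    have h1 : 0 ≤ c * Λ ^ 2 / τ * ∫ y in a..b, ‖v1 y + (Complex.I * t y - μ y) * v y‖ ^ 2 :=
      mul_nonneg (by positivity)
        (intervalIntegral.integral_nonneg S.hab (by intros; positivity))
    have h2 := mul_le_mul_of_nonneg_right hneg
      (sq_nonneg ‖v1 0 + (Complex.I * t 0 - μ 0) * v 0‖)
    linarith

end Side

end Carleman

end

/-! ### Transmission across the interface. -/

noncomputable section

namespace Carleman

open MeasureTheory Set Filter Topology

theorem add_four_sq_le (a b c d : ℝ) :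
    (a + b + c + d) ^ 2 ≤ 4 * (a ^ 2 + b ^ 2 + c ^ 2 + d ^ 2) := by
  linarith [sq_nonneg (a - b), sq_nonneg (a - c), sq_nonneg (a - d), sq_nonneg (b - c),
    sq_nonneg (b - d), sq_nonneg (c - d)]

/-- The size of the jumps across the interface. -/
def jump (Λ : ℝ) (ϑ₀ ϑ₁ : ℂ) : ℝ := Λ ^ 3 * ‖ϑ₀‖ ^ 2 + Λ * ‖ϑ₁‖ ^ 2

/-- The transmission conditions transfer Cauchy data from one side to the other. -/
theorem trace_transfer {K Λ ap am : ℝ} {vp v1p vm v1m tp tm ϑ₀ ϑ₁ : ℂ} (hK : 1 ≤ K) (hΛ : 0 < Λ)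
    (hap : |ap| ≤ K) (ham : 1 ≤ K * am) (htp : ‖tp‖ ≤ K * Λ) (htm : ‖tm‖ ≤ K * Λ)
    (h0 : ϑ₀ = vp - vm)
    (h1 : ϑ₁ = ap * (v1p + Complex.I * tp * vp) - am * (v1m + Complex.I * tm * vm)) :
    Λ ^ 3 * ‖vm‖ ^ 2 + Λ * ‖v1m‖ ^ 2 ≤
      (2 + 16 * K ^ 6) * (Λ ^ 3 * ‖vp‖ ^ 2 + Λ * ‖v1p‖ ^ 2 + jump Λ ϑ₀ ϑ₁) := by
  have hK0 : 0 < K := by linarith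
  have ham0 : 0 < am := by
    by_contra hneg
    have : K * am ≤ 0 := mul_nonpos_of_nonneg_of_nonpos hK0.le (not_lt.1 hneg)
    linarith
  have hami : am⁻¹ ≤ K := by rw [inv_le_iff_one_le_mul₀ ham0]; linarith
  have hvm : vm = vp - ϑ₀ := by rw [h0]; ring
  have hvmn : ‖vm‖ ≤ ‖vp‖ + ‖ϑ₀‖ := hvm ▸ norm_sub_le _ _
  have hv1m : v1m = (am : ℂ)⁻¹ * (ap * (v1p + Complex.I * tp * vp) - ϑ₁)
      - Complex.I * tm * vm := by
    have : (am : ℂ) ≠ 0 := by exact_mod_cast ham0.ne'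
    rw [h1]; field_simp; ring
  have hb : ‖v1m‖ ≤ K ^ 2 * ‖v1p‖ + 2 * K ^ 3 * Λ * ‖vp‖ + K * ‖ϑ₁‖ + K * Λ * ‖ϑ₀‖ := by
    have e1 : ‖Complex.I * tp * vp‖ ≤ K * Λ * ‖vp‖ := by
      rw [norm_mul, norm_mul, Complex.norm_I, one_mul]; gcongr
    have e2 : ‖Complex.I * tm * vm‖ ≤ K * Λ * (‖vp‖ + ‖ϑ₀‖) := by
      rw [norm_mul, norm_mul, Complex.norm_I, one_mul]; gcongr
    have e3 : ‖(ap : ℂ) * (v1p + Complex.I * tp * vp)‖ ≤ K * (‖v1p‖ + K * Λ * ‖vp‖) := by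
      rw [norm_mul, Complex.norm_real]
      exact mul_le_mul hap ((norm_add_le _ _).trans (add_le_add le_rfl e1)) (norm_nonneg _) hK0.le
    have e4 : ‖(am : ℂ)⁻¹ * (ap * (v1p + Complex.I * tp * vp) - ϑ₁)‖ ≤
        K * (K * (‖v1p‖ + K * Λ * ‖vp‖) + ‖ϑ₁‖) := by
      rw [norm_mul, norm_inv, Complex.norm_real, Real.norm_of_nonneg ham0.le]
      exact mul_le_mul hami ((norm_sub_le _ _).trans (add_le_add e3 le_rfl)) (norm_nonneg _) hK0.le
    have e5 : ‖v1m‖ ≤ K * (K * (‖v1p‖ + K * Λ * ‖vp‖) + ‖ϑ₁‖) + K * Λ * (‖vp‖ + ‖ϑ₀‖) := by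
      rw [hv1m]; exact (norm_sub_le _ _).trans (add_le_add e4 e2)
    have e6 : K * Λ * ‖vp‖ ≤ K ^ 3 * Λ * ‖vp‖ := by
      gcongr; exact le_self_pow₀ hK (by norm_num)
    linarith
  have hb2 := (pow_le_pow_left₀ (norm_nonneg _) hb 2).trans (add_four_sq_le _ _ _ _)
  have hc2 := (pow_le_pow_left₀ (norm_nonneg _) hvmn 2).trans (add_sq_le (a := ‖vp‖) (b := ‖ϑ₀‖))
  have p4 : K ^ 4 ≤ 4 * K ^ 6 := by
    have : K ^ 4 ≤ K ^ 6 := pow_le_pow_right₀ hK (by norm_num)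
    have : 0 ≤ K ^ 6 := by positivity
    linarith
  have p2 : K ^ 2 ≤ 4 * K ^ 6 := by
    have : K ^ 2 ≤ K ^ 6 := pow_le_pow_right₀ hK (by norm_num)
    have : 0 ≤ K ^ 6 := by positivity
    linarith
  have q1 := mul_le_mul_of_nonneg_left hb2 hΛ.le
  have q2 := mul_le_mul_of_nonneg_left hc2 (show 0 ≤ Λ ^ 3 by positivity)
  have r1 := mul_le_mul_of_nonneg_right p4 (show 0 ≤ Λ * ‖v1p‖ ^ 2 by positivity)
  have r2 := mul_le_mul_of_nonneg_right p2 (show 0 ≤ Λ * ‖ϑ₁‖ ^ 2 by positivity)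
  have r3 := mul_le_mul_of_nonneg_right p2 (show 0 ≤ Λ ^ 3 * ‖ϑ₀‖ ^ 2 by positivity)
  have r4 : 0 ≤ Λ * ‖v1p‖ ^ 2 := by positivity
  have r5 : 0 ≤ Λ * ‖ϑ₁‖ ^ 2 := by positivity
  unfold jump
  linarith

/-- Ellipticity of the transmission problem in the regime where both factors are of opposite
type. -/
theorem trace_elliptic {K Λ cp ap am : ℝ} {vp v1p vm v1m tp tm μp μm ϑ₀ ϑ₁ : ℂ} (hK : 1 ≤ K)
    (hΛ : 0 < Λ) (hcp : 0 < cp) (hap : |ap| ≤ K) (ham : |am| ≤ K) (hap' : 1 ≤ K * ap)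
    (ham' : 1 ≤ K * am) (htp : ‖tp‖ ≤ K * Λ) (hμp : ‖μp‖ ≤ 2 * K * Λ) (hμm : ‖μm‖ ≤ 2 * K * Λ)
    (hμp' : cp * Λ ≤ μp.re) (hμm' : cp * Λ ≤ μm.re) (h0 : ϑ₀ = vp - vm)
    (h1 : ϑ₁ = ap * (v1p + Complex.I * tp * vp) - am * (v1m + Complex.I * tm * vm)) :
    Λ ^ 3 * ‖vp‖ ^ 2 + Λ * ‖v1p‖ ^ 2 ≤ (2 + (1 + 18 * K ^ 2) * ((K / (2 * cp)) ^ 2 * (16 * K ^ 4))) *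
      (Λ * ‖v1p + (Complex.I * tp + μp) * vp‖ ^ 2 + Λ * ‖v1m + (Complex.I * tm - μm) * vm‖ ^ 2
        + jump Λ ϑ₀ ϑ₁) := by
  have hK0 : 0 < K := by linarith
  set zp := v1p + (Complex.I * tp + μp) * vp with hzp
  set zm := v1m + (Complex.I * tm - μm) * vm with hzm
  -- Eliminating v1p, v1m and vm leaves one scalar equation for vp. Its coefficient cannot vanish,
  -- because both summands have real part at least cpΛ/K.
  have hid : (ap * μp + am * μm) * vp = ap * zp - am * zm - ϑ₁ + am * μm * ϑ₀ := by
    rw [h0, h1, hzp, hzm]; ring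
  have hre : 2 * cp / K * Λ ≤ ‖(ap * μp + am * μm : ℂ)‖ := by
    refine le_trans ?_ ((le_abs_self _).trans (Complex.abs_re_le_norm _))
    rw [Complex.add_re, Complex.re_ofReal_mul, Complex.re_ofReal_mul]
    have hc : 0 < cp * Λ := by positivity
    have e1 : cp * Λ / K ≤ ap * μp.re := by
      rw [div_le_iff₀ hK0]
      have := mul_le_mul hap' hμp' hc.le (by linarith)
      linarith
    have e2 : cp * Λ / K ≤ am * μm.re := by
      rw [div_le_iff₀ hK0]
      have := mul_le_mul ham' hμm' hc.le (by linarith)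
      linarith
    have e3 : 2 * cp / K * Λ = cp * Λ / K + cp * Λ / K := by ring
    linarith
  have hnum : ‖ap * zp - am * zm - ϑ₁ + am * μm * ϑ₀‖ ≤
      K * ‖zp‖ + K * ‖zm‖ + ‖ϑ₁‖ + 2 * K ^ 2 * Λ * ‖ϑ₀‖ := by
    have e1 : ‖(ap : ℂ) * zp‖ ≤ K * ‖zp‖ := by
      rw [norm_mul, Complex.norm_real]; gcongr; exact hap
    have e2 : ‖(am : ℂ) * zm‖ ≤ K * ‖zm‖ := by
      rw [norm_mul, Complex.norm_real]; gcongr; exact ham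
    have e3 : ‖(am : ℂ) * μm * ϑ₀‖ ≤ 2 * K ^ 2 * Λ * ‖ϑ₀‖ := by
      rw [norm_mul, norm_mul, Complex.norm_real]
      have := mul_le_mul ham hμm (norm_nonneg _) hK0.le
      exact (mul_le_mul_of_nonneg_right this (norm_nonneg ϑ₀)).trans (le_of_eq (by ring))
    exact (norm_add_le _ _).trans (add_le_add ((norm_sub_le _ _).trans
      (add_le_add ((norm_sub_le _ _).trans (add_le_add e1 e2)) le_rfl)) e3)
  have hvp : Λ * ‖vp‖ ≤ K / (2 * cp) *
      (K * ‖zp‖ + K * ‖zm‖ + ‖ϑ₁‖ + 2 * K ^ 2 * Λ * ‖ϑ₀‖) := by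
    have e1 := mul_le_mul_of_nonneg_right hre (norm_nonneg vp)
    rw [← norm_mul, hid] at e1
    have e2 := mul_le_mul_of_nonneg_left (e1.trans hnum) (show 0 ≤ K / (2 * cp) by positivity)
    refine le_trans (le_of_eq ?_) e2
    field_simp
  have hvp2 := pow_le_pow_left₀ (by positivity) hvp 2
  rw [mul_pow (K / (2 * cp))] at hvp2
  have hvp3 := hvp2.trans (mul_le_mul_of_nonneg_left (add_four_sq_le _ _ _ _) (sq_nonneg _))
  obtain ⟨B, hB⟩ : ∃ B, B = (K / (2 * cp)) ^ 2 := ⟨_, rfl⟩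
  rw [← hB] at hvp3 ⊢
  have hB0 : 0 ≤ B := hB ▸ sq_nonneg _
  have k1 : (1 : ℝ) ≤ 4 * K ^ 4 := by
    have := one_le_pow₀ (n := 4) hK; linarith
  have k2 : K ^ 2 ≤ 4 * K ^ 4 := by
    have : K ^ 2 ≤ K ^ 4 := pow_le_pow_right₀ hK (by norm_num)
    have : 0 ≤ K ^ 4 := by positivity
    linarith
  obtain ⟨S, hS⟩ : ∃ S, S = Λ * ‖zp‖ ^ 2 + Λ * ‖zm‖ ^ 2 + jump Λ ϑ₀ ϑ₁ := ⟨_, rfl⟩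
  have hSp : Λ * ‖zp‖ ^ 2 ≤ S := by
    have : 0 ≤ Λ * ‖zm‖ ^ 2 + jump Λ ϑ₀ ϑ₁ := by unfold jump; positivity
    linarith
  rw [← hS]
  have hA : Λ ^ 3 * ‖vp‖ ^ 2 ≤ B * (16 * K ^ 4) * S := by
    have e1 := mul_le_mul_of_nonneg_left hvp3 hΛ.le
    have e2 := mul_le_mul_of_nonneg_right k2 (show 0 ≤ B * (Λ * ‖zp‖ ^ 2) by positivity)
    have e3 := mul_le_mul_of_nonneg_right k2 (show 0 ≤ B * (Λ * ‖zm‖ ^ 2) by positivity)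
    have e4 := mul_le_mul_of_nonneg_right k1 (show 0 ≤ B * (Λ * ‖ϑ₁‖ ^ 2) by positivity)
    rw [hS]; unfold jump
    linarith
  have hv1 : ‖v1p‖ ≤ ‖zp‖ + 3 * K * Λ * ‖vp‖ := by
    have e1 : v1p = zp - (Complex.I * tp + μp) * vp := by rw [hzp]; ring
    have e2 : ‖(Complex.I * tp + μp) * vp‖ ≤ 3 * K * Λ * ‖vp‖ := by
      rw [norm_mul]
      refine mul_le_mul_of_nonneg_right ((norm_add_le _ _).trans ?_) (norm_nonneg _)
      rw [norm_mul, Complex.norm_I, one_mul]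
      linarith
    rw [e1]
    exact (norm_sub_le _ _).trans (add_le_add le_rfl e2)
  have hv2 := mul_le_mul_of_nonneg_left (norm_sq_le_of_norm_le_add hv1) hΛ.le
  have hA2 := mul_le_mul_of_nonneg_left hA (show 0 ≤ 1 + 18 * K ^ 2 by positivity)
  linarith

/-- The bounds form a loop: interior energy by source and trace, trace by Zp, Zm and the jumps, and
Zp, Zm by source and interior energy divided by τ. The factor 1/τ closes the loop for large τ. -/
theorem absorb {C CA CB τ Wp Wm Tp Tm Hp Hm J Zp Zm : ℝ} (hC : 0 < C) (hCA : 0 < CA) (hCB : 0 < CB)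
    (hτ : 0 < τ) (hτ2 : 2 * (1 + C) * ((1 + CA) * CB * (C + 1) + CA) ≤ τ)
    (hWp : 0 ≤ Wp) (hWm : 0 ≤ Wm) (hHp : 0 ≤ Hp) (hHm : 0 ≤ Hm) (hJ : 0 ≤ J)
    (h1 : Wp ≤ C * (Hp + Tp)) (h2 : Wm ≤ C * (Hm + Tm)) (h3 : Zp ≤ C * (Hp + Wp / τ))
    (h4 : Zm ≤ C * (Hm + Wm / τ)) (h5 : Tp ≤ CB * (Zp + Zm + J)) (h6 : Tm ≤ CA * (Tp + J)) :
    Wp + Wm + Tp + Tm ≤ 2 * (1 + C) * (1 + ((1 + CA) * CB * (C + 1) + CA)) * (Hp + Hm + J) := by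
  obtain ⟨D, hD⟩ : ∃ D, D = (1 + CA) * CB * (C + 1) + CA := ⟨_, rfl⟩
  have hD0 : 0 < D := by rw [hD]; positivity
  rw [← hD] at hτ2 ⊢
  obtain ⟨S, hS⟩ : ∃ S, S = Hp + Hm + J := ⟨_, rfl⟩
  obtain ⟨W, hW⟩ : ∃ W, W = Wp + Wm := ⟨_, rfl⟩
  have hW0 : 0 ≤ W := by linarith
  have hS0 : 0 ≤ S := by linarith
  have hT : Tp + Tm ≤ D * (S + W / τ) := by
    have e0 : 0 ≤ W / τ := by positivity
    have e1 : Zp + Zm + J ≤ (C + 1) * (S + W / τ) := by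
      have : Wp / τ + Wm / τ = W / τ := by rw [hW]; ring
      have : 0 ≤ C * J := by positivity
      have : C * (S + W / τ) = C * (Hp + Wp / τ) + C * (Hm + Wm / τ) + C * J := by
        rw [hS, hW]; ring
      linarith
    have e2 := h5.trans (mul_le_mul_of_nonneg_left e1 hCB.le)
    have e3 := mul_le_mul_of_nonneg_left e2 (show 0 ≤ 1 + CA by positivity)
    have e4 : CA * J ≤ CA * (S + W / τ) := by
      refine mul_le_mul_of_nonneg_left ?_ hCA.le; linarith
    rw [hD]
    linarith
  have hWb : W ≤ C * (S + D * (S + W / τ)) := by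
    have := mul_le_mul_of_nonneg_left hT hC.le
    have : 0 ≤ C * J := by positivity
    rw [hW] at *
    rw [hS] at *
    linarith
  have hsm : (1 + C) * D * (W / τ) ≤ W / 2 := by
    rw [mul_div_assoc', div_le_iff₀ hτ]
    have := mul_le_mul_of_nonneg_right hτ2 hW0
    linarith
  have hfin : W + (Tp + Tm) ≤ (1 + C) * (1 + D) * S + W / 2 := by
    have : 0 ≤ S := hS0
    linarith
  have hWT : W ≤ 2 * ((C + C * D) * S) := by
    have e : C * (S + D * (S + W / τ)) = (C + C * D) * S + C * D * (W / τ) := by ring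
    have e' : 0 ≤ D * (W / τ) := by positivity
    linarith
  have : 0 ≤ (1 + D) * S := by positivity
  rw [← hS]
  linarith

/-- The one-dimensional transmission estimate. -/
theorem transmission {K αp αm ℓ : ℝ} (hK : 1 ≤ K) (hαp : 0 < αp) (hαm : 0 < αm)
    (hℓ : ℓ < αp / αm) :
    ∃ s₀ τ₀ β₀ C : ℝ, 0 < s₀ ∧ 1 ≤ τ₀ ∧ 0 < β₀ ∧ 0 < C ∧
      ∀ {a b τ s X β ap am : ℝ} {tp tm Qp Qm : ℝ → ℂ} {mp mm : ℝ → ℝ}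
        {vp v1p v2p vm v1m v2m : ℝ → ℂ},
        Side 1 0 b K τ s X αp β tp Qp mp vp v1p v2p →
        Side (-1) a 0 K τ s X αm β tm Qm mm vm v1m v2m →
        τ₀ ≤ τ → 0 ≤ s → s ≤ s₀ → 0 ≤ X → β₀ ≤ β →
        |ap| ≤ K → |am| ≤ K → 1 ≤ K * ap → 1 ≤ K * am → mp 0 ≤ ℓ * mm 0 →
        bulk 0 b τ (τ + X) vp v1p + bulk a 0 τ (τ + X) vm v1m + trace (τ + X) vp v1p
          + trace (τ + X) vm v1m ≤
        C * ((∫ y in (0 : ℝ)..b, ‖conjOp tp Qp vp v1p v2p y‖ ^ 2)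
          + (∫ y in a..0, ‖conjOp tm Qm vm v1m v2m y‖ ^ 2)
          + jump (τ + X) (vp 0 - vm 0) (ap * (v1p 0 + Complex.I * tp 0 * vp 0)
            - am * (v1m 0 + Complex.I * tm 0 * vm 0))) := by
  have hK0 : 0 < K := by linarith
  obtain ⟨c₀p, s₀p, τ₀p, Cp, hc₀p, hs₀p, hτ₀p, hCp, lowp⟩ := Side.low hK hαp
  obtain ⟨c₀m, s₀m, τ₀m, Cm, hc₀m, hs₀m, hτ₀m, hCm, lowm⟩ := Side.low hK hαm
  obtain ⟨c₀, hc₀⟩ : ∃ c, c = min c₀p c₀m := ⟨_, rfl⟩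
  have hc₀0 : 0 < c₀ := by rw [hc₀]; positivity
  -- With this value X ≥ c₀τ is the same as X ≥ c₁(τ + X), so the low and high regimes cover all
  -- frequencies.
  obtain ⟨c₁, hc₁⟩ : ∃ c, c = c₀ / (1 + c₀) := ⟨_, rfl⟩
  have hc₁0 : 0 < c₁ := by rw [hc₁]; positivity
  have hc₁1 : c₁ ≤ 1 := by rw [hc₁, div_le_one (by positivity)]; linarith
  obtain ⟨cp, hcp⟩ : ∃ cp, cp = c₁ / (2 * K) := ⟨_, rfl⟩
  have hcp0 : 0 < cp := by rw [hcp]; positivity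
  obtain ⟨ρ, hρ⟩ : ∃ ρ, ρ = αm / αp := ⟨_, rfl⟩
  have hρ0 : 0 < ρ := by rw [hρ]; positivity
  have hρα : ρ * αp = αm := by rw [hρ]; field_simp
  obtain ⟨ω, hω⟩ : ∃ ω, ω = 1 - ℓ * ρ := ⟨_, rfl⟩
  have hω0 : 0 < ω := by
    rw [hω, hρ, sub_pos, mul_div_assoc', div_lt_one hαp]
    rwa [lt_div_iff₀ hαm] at hℓ
  obtain ⟨R, hR⟩ : ∃ R, R = K / cp + K := ⟨_, rfl⟩
  have hR0 : 0 < R := by rw [hR]; positivity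
  -- The threshold e spends at most half of the gap ω·mm(0), after multiplication by ρ + 1; the
  -- smallness of s, through R, spends at most the other half.
  obtain ⟨e, he⟩ : ∃ e, e = min cp (ω * c₁ / (2 * K * (ρ + 1))) := ⟨_, rfl⟩
  have he0 : 0 < e := by rw [he]; positivity
  have hecp : e ≤ cp := he ▸ min_le_left _ _
  have heω : e * (2 * K * (ρ + 1)) ≤ ω * c₁ := by
    rw [← le_div_iff₀ (by positivity), he]; exact min_le_right _ _
  obtain ⟨s₁p, τ₁p, β₁p, C₁p, hs₁p, hτ₁p, hβ₁p, hC₁p, highp⟩ :=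
    Side.high hK hαp hc₁0 hc₁1 he0 (hcp ▸ hecp)
  obtain ⟨s₁m, τ₁m, β₁m, C₁m, hs₁m, hτ₁m, hβ₁m, hC₁m, highm⟩ :=
    Side.high hK hαm hc₁0 hc₁1 he0 (hcp ▸ hecp)
  rw [← hcp] at highp highm
  obtain ⟨C, hC⟩ : ∃ C, C = Cp + Cm + C₁p + C₁m := ⟨_, rfl⟩
  have hC0 : 0 < C := by rw [hC]; positivity
  obtain ⟨CA, hCA⟩ : ∃ C, C = 2 + 16 * K ^ 6 := ⟨_, rfl⟩
  have hCA0 : 0 < CA := by rw [hCA]; positivity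
  obtain ⟨CB, hCB⟩ : ∃ C, C = 2 + (1 + 18 * K ^ 2) * ((K / (2 * cp)) ^ 2 * (16 * K ^ 4)) := ⟨_, rfl⟩
  have hCB0 : 0 < CB := by rw [hCB]; positivity
  refine ⟨min (min (min s₀p s₀m) (min s₁p s₁m)) (ω * c₁ / (2 * K * (ρ + 1) * R)),
    max (max (max τ₀p τ₀m) (max τ₁p τ₁m)) (2 * (1 + C) * ((1 + CA) * CB * (C + 1) + CA)),
    max β₁p β₁m,
    2 * (1 + C) * (1 + ((1 + CA) * CB * (C + 1) + CA)) + (1 + C) * (1 + C) * (1 + CA),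
    by positivity, ?_, by positivity, by positivity, ?_⟩
  · exact hτ₀p.trans ((le_max_left _ _).trans ((le_max_left _ _).trans (le_max_left _ _)))
  intro a b τ s X β ap am tp tm Qp Qm mp mm vp v1p v2p vm v1m v2m Sp Sm hτ hs0 hs hX hβ hap ham
    hap' ham' hm
  simp only [max_le_iff, le_min_iff] at hτ hs hβ
  obtain ⟨⟨⟨hτ1, hτ2⟩, hτ3, hτ4⟩, hτ5⟩ := hτ
  obtain ⟨⟨⟨hs1, hs2⟩, hs3, hs4⟩, hs5⟩ := hs
  rw [le_div_iff₀ (by positivity)] at hs5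
  obtain ⟨hβ1, hβ2⟩ := hβ
  have hτ0 : 0 < τ := by linarith
  have hβ0 : 0 ≤ β := by linarith
  obtain ⟨Λ, hΛ⟩ : ∃ Λ, Λ = τ + X := ⟨_, rfl⟩
  have hΛ0 : 0 < Λ := by linarith
  have hτΛ : τ ≤ Λ := by linarith
  have htp := Sp.t_bd 0
  have htm := Sm.t_bd 0
  have hWp : 0 ≤ bulk 0 b τ (τ + X) vp v1p := Side.bulk_nonneg Sp.hab hτ0
  have hWm : 0 ≤ bulk a 0 τ (τ + X) vm v1m := Side.bulk_nonneg Sm.hab hτ0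
  have hHp : 0 ≤ ∫ y in (0 : ℝ)..b, ‖conjOp tp Qp vp v1p v2p y‖ ^ 2 :=
    intervalIntegral.integral_nonneg Sp.hab (by intros; positivity)
  have hHm : 0 ≤ ∫ y in a..0, ‖conjOp tm Qm vm v1m v2m y‖ ^ 2 :=
    intervalIntegral.integral_nonneg Sm.hab (by intros; positivity)
  have hTp : 0 ≤ trace (τ + X) vp v1p := by unfold trace; positivity
  have hTm : 0 ≤ trace (τ + X) vm v1m := by unfold trace; positivity
  have transfer := trace_transfer (v1p := v1p 0) (v1m := v1m 0) hK (hΛ ▸ hΛ0) hap ham' htp htm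
    (rfl : vp 0 - vm 0 = _) rfl
  have elliptic := fun (μp μm : ℂ) h1 h2 h3 h4 ↦ trace_elliptic (v1p := v1p 0) (v1m := v1m 0)
    (tm := tm 0) (μp := μp) (μm := μm) hK (hΛ ▸ hΛ0) hcp0 hap ham hap' ham' htp h1 h2 h3 h4
    (rfl : vp 0 - vm 0 = _) rfl
  rw [← hCA] at transfer
  rw [← hCB] at elliptic
  have hJ : 0 ≤ jump (τ + X) (vp 0 - vm 0) (ap * (v1p 0 + Complex.I * tp 0 * vp 0)
            - am * (v1m 0 + Complex.I * tm 0 * vm 0)) := by unfold jump; positivity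
  change trace (τ + X) vm v1m ≤ CA * (trace (τ + X) vp v1p + _) at transfer
  set J := jump (τ + X) (vp 0 - vm 0) (ap * (v1p 0 + Complex.I * tp 0 * vp 0)
            - am * (v1m 0 + Complex.I * tm 0 * vm 0))
  set Hp := ∫ y in (0 : ℝ)..b, ‖conjOp tp Qp vp v1p v2p y‖ ^ 2
  set Hm := ∫ y in a..0, ‖conjOp tm Qm vm v1m v2m y‖ ^ 2
  have direct : bulk 0 b τ (τ + X) vp v1p + trace (τ + X) vp v1p ≤ C * Hp →
      bulk a 0 τ (τ + X) vm v1m ≤ C * (Hm + trace (τ + X) vm v1m) →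
      bulk 0 b τ (τ + X) vp v1p + bulk a 0 τ (τ + X) vm v1m + trace (τ + X) vp v1p
          + trace (τ + X) vm v1m ≤
      (2 * (1 + C) * (1 + ((1 + CA) * CB * (C + 1) + CA)) + (1 + C) * (1 + C) * (1 + CA)) *
        (Hp + Hm + J) := fun h1 h2 ↦ by
    have e1 : trace (τ + X) vp v1p ≤ C * Hp := by linarith
    have e2 := transfer.trans (mul_le_mul_of_nonneg_left (add_le_add_left e1 J) hCA0.le)
    have e3 := mul_le_mul_of_nonneg_left e2 (show 0 ≤ 1 + C by positivity)
    have e4 : C * Hp + C * Hm + (1 + C) * (CA * (C * Hp + J)) ≤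
        (1 + C) * (1 + C) * (1 + CA) * (Hp + Hm + J) := by
      have i1 : 0 ≤ CA * Hp := by positivity
      have i2 : 0 ≤ C * CA * Hp := by positivity
      have i3 : 0 ≤ (1 + C) * (1 + C) * (1 + CA) * Hm - C * Hm := by
        have : (1 + C) * (1 + C) * (1 + CA) * Hm - C * Hm
          = (1 + C + C ^ 2 + (1 + C) * (1 + C) * CA) * Hm := by ring
        rw [this]; positivity
      have i4 : 0 ≤ (1 + C) * (1 + C) * (1 + CA) * J - (1 + C) * CA * J := by
        have : (1 + C) * (1 + C) * (1 + CA) * J - (1 + C) * CA * J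
          = ((1 + C) * (1 + C) + (1 + C) * C * CA) * J := by ring
        rw [this]; positivity
      have i5 : 0 ≤ (1 + C) * (1 + C) * (1 + CA) * Hp - C * Hp - (1 + C) * CA * C * Hp := by
        have : (1 + C) * (1 + C) * (1 + CA) * Hp - C * Hp - (1 + C) * CA * C * Hp
          = (1 + C + C ^ 2 + (1 + C) * CA) * Hp := by ring
        rw [this]; positivity
      linarith
    have e5 : 0 ≤ 2 * (1 + C) * (1 + ((1 + CA) * CB * (C + 1) + CA)) * (Hp + Hm + J) := by
      positivity
    linarith
  rcases le_total X (c₀ * τ) with hlow | hhigh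
  · refine direct ?_ ?_
    · exact ((lowp Sp hτ1 hs0 hs1 hX (hlow.trans (mul_le_mul_of_nonneg_right
        (hc₀ ▸ min_le_left _ _) hτ0.le)) hβ0).2 rfl).trans
        (mul_le_mul_of_nonneg_right (by linarith) hHp)
    · exact ((lowm Sm hτ2 hs0 hs2 hX (hlow.trans (mul_le_mul_of_nonneg_right
        (hc₀ ▸ min_le_right _ _) hτ0.le)) hβ0).1).trans
        (mul_le_mul_of_nonneg_right (by linarith) (by positivity))
  have hXΛ : c₁ * (τ + X) ≤ X := by
    rw [hc₁, div_mul_eq_mul_div, div_le_iff₀ (by positivity)]; linarith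
  obtain ⟨μp, p1, p2, p3, p4, p5, p6, -⟩ := highp Sp hτ3 hs0 hs3 hX hXΛ hβ1
  obtain ⟨μm, m1, m2, m3, m4, -, -, m7⟩ := highm Sm hτ4 hs0 hs4 hX hXΛ hβ2
  have hC₁p' : C₁p ≤ C := by linarith
  have hC₁m' : C₁m ≤ C := by linarith
  -- Either the − factor is clearly positive on the plus side, which then controls its own Cauchy
  -- data, or it is clearly negative on the minus side.
  rcases le_or_gt (e * (τ + X)) (τ * αp + (tp 0).im - μp.re) with hcase | hcase
  · refine direct ?_ ?_
    · exact (p5 rfl hcase).trans (mul_le_mul_of_nonneg_right hC₁p' hHp)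
    · exact m4.trans (mul_le_mul_of_nonneg_right hC₁m' (by positivity))
  have hneg : τ * αm + (tm 0).im - μm.re ≤ -(e * (τ + X)) := by
    rw [← hΛ] at *
    have a1 := (abs_le.1 ((Complex.abs_re_le_norm _).trans p3)).2
    have a2 := (abs_le.1 ((Complex.abs_re_le_norm _).trans m3)).1
    rw [Complex.sub_re, Complex.ofReal_re] at a1 a2
    have a3 := (abs_le.1 (Sp.t_im 0)).1
    have a4 := (abs_le.1 (Sm.t_im 0)).2
    have a5 : K * s * τ ≤ K * s * Λ := by gcongr
    have a6 : K / cp * s * Λ + K * s * Λ = R * s * Λ := by rw [hR]; ring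
    have a7 : τ * αp ≤ ℓ * mm 0 + (e + R * s) * Λ := by linarith
    have a8 := mul_le_mul_of_nonneg_left a7 hρ0.le
    rw [show ρ * (τ * αp) = τ * (ρ * αp) by ring, hρα] at a8
    have a9 : c₁ * Λ ≤ K * mm 0 := hXΛ.trans (Sm.m_lower 0)
    have a10 : (ρ + 1) * (e + R * s) * Λ ≤ ω * mm 0 := by
      have b1 := mul_le_mul_of_nonneg_left a9 hω0.le
      have b2 : (e * (2 * K * (ρ + 1)) + s * (2 * K * (ρ + 1) * R)) * Λ ≤ 2 * (ω * c₁) * Λ := by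
        gcongr; linarith
      refine le_of_mul_le_mul_left ?_ hK0
      linarith
    have a11 : τ * αm ≤ mm 0 - ω * mm 0 + ρ * ((e + R * s) * Λ) := by
      rw [hω]; linarith
    linarith
  have ell := elliptic μp μm p2 m2 p1 m1
  have fin := absorb (C := C) (CA := CA) (CB := CB) hC0 hCA0 hCB0 hτ0 hτ5 hWp hWm hHp hHm hJ
    (p4.trans (mul_le_mul_of_nonneg_right hC₁p' (by positivity)))
    (m4.trans (mul_le_mul_of_nonneg_right hC₁m' (by positivity)))
    ((p6 rfl).trans (mul_le_mul_of_nonneg_right hC₁p' (by positivity)))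
    ((m7 rfl hneg).trans (mul_le_mul_of_nonneg_right hC₁m' (by positivity))) ell transfer
  refine fin.trans (mul_le_mul_of_nonneg_right ?_ (by positivity))
  have : 0 ≤ (1 + C) * (1 + C) * (1 + CA) := by positivity
  linarith

end Carleman

end

/-! ### Lower-order terms and second normal derivatives. -/

noncomputable section

namespace Carleman

open MeasureTheory Set Filter Topology

/-- The interior energy density of order at most two. -/
def dens (τ Λ : ℝ) (v v1 v2 : ℂ) : ℝ := (Λ ^ 4 * ‖v‖ ^ 2 + Λ ^ 2 * ‖v1‖ ^ 2 + ‖v2‖ ^ 2) / τ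

theorem dens_nonneg {τ Λ : ℝ} (hτ : 0 < τ) (v v1 v2 : ℂ) : 0 ≤ dens τ Λ v v1 v2 := by
  unfold dens; positivity

theorem add_three_sq_le (a b c : ℝ) : (a + b + c) ^ 2 ≤ 3 * (a ^ 2 + b ^ 2 + c ^ 2) := by
  linarith [sq_nonneg (a - b), sq_nonneg (a - c), sq_nonneg (b - c)]

namespace Side

variable {ε a b K τ s X α β : ℝ} {t Q : ℝ → ℂ} {m : ℝ → ℝ} {v v1 v2 : ℝ → ℂ}

theorem cont_conjOp (S : Side ε a b K τ s X α β t Q m v v1 v2) :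
    Continuous (conjOp t Q v v1 v2) := by
  have := S.cont_v
  have := S.cont_v1
  have := S.cont_t
  have := S.cont_Q
  have := S.v2_cont
  unfold conjOp
  fun_prop

/-- Passing to the divergence-form source G costs first-order terms in v. Since Λ²/τ ≥ τ, their
energy is at most the interior energy divided by τ. -/
theorem integral_conjOp_le (S : Side ε a b K τ s X α β t Q m v v1 v2) (hτ : 1 ≤ τ) (hX : 0 ≤ X)
    {G : ℝ → ℂ} (hG : ∀ᵐ y, y ∈ Icc a b → ‖conjOp t Q v v1 v2 y‖ ≤
      K * (‖G y‖ + ‖v1 y‖ + (τ + X) * ‖v y‖))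
    (hGi : IntervalIntegrable (fun y ↦ ‖G y‖ ^ 2) volume a b) :
    ∫ y in a..b, ‖conjOp t Q v v1 v2 y‖ ^ 2 ≤
      3 * K ^ 2 * ((∫ y in a..b, ‖G y‖ ^ 2) + bulk a b τ (τ + X) v v1 / τ) := by
  have hτ0 : 0 < τ := by linarith
  obtain ⟨Λ, hΛ⟩ : ∃ Λ, Λ = τ + X := ⟨_, rfl⟩
  have hτΛ : τ ≤ Λ := by linarith
  have hΛ0 : 0 < Λ := by linarith
  rw [← hΛ] at hG ⊢
  have cv := S.cont_v
  have cv1 := S.cont_v1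
  have cc := S.cont_conjOp
  have i1 : IntervalIntegrable (fun y ↦ ‖v1 y‖ ^ 2 + Λ ^ 2 * ‖v y‖ ^ 2) volume a b :=
    Continuous.intervalIntegrable (by fun_prop) _ _
  have h1 : ∫ y in a..b, ‖conjOp t Q v v1 v2 y‖ ^ 2 ≤
      ∫ y in a..b, 3 * K ^ 2 * (‖G y‖ ^ 2 + (‖v1 y‖ ^ 2 + Λ ^ 2 * ‖v y‖ ^ 2)) := by
    refine intervalIntegral.integral_mono_ae_restrict S.hab
      (Continuous.intervalIntegrable (by fun_prop) _ _) ((hGi.add i1).const_mul _) ?_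
    rw [EventuallyLE, ae_restrict_iff' measurableSet_Icc]
    filter_upwards [hG] with y hy hyI
    have h2 := pow_le_pow_left₀ (norm_nonneg _) (hy hyI) 2
    rw [mul_pow] at h2
    have h3 := mul_le_mul_of_nonneg_left (add_three_sq_le ‖G y‖ ‖v1 y‖ (Λ * ‖v y‖)) (sq_nonneg K)
    linarith
  refine h1.trans ?_
  rw [intervalIntegral.integral_const_mul, intervalIntegral.integral_add hGi i1,
    intervalIntegral.integral_add (Continuous.intervalIntegrable (by fun_prop) _ _)
      (Continuous.intervalIntegrable (by fun_prop) _ _), intervalIntegral.integral_const_mul]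
  refine mul_le_mul_of_nonneg_left (add_le_add le_rfl ?_) (by positivity)
  have hV : 0 ≤ ∫ y in a..b, ‖v y‖ ^ 2 :=
    intervalIntegral.integral_nonneg S.hab (by intros; positivity)
  have hV1 : 0 ≤ ∫ y in a..b, ‖v1 y‖ ^ 2 :=
    intervalIntegral.integral_nonneg S.hab (by intros; positivity)
  rw [le_div_iff₀ hτ0]
  have hsq : τ ^ 2 ≤ Λ ^ 2 := pow_le_pow_left₀ hτ0.le hτΛ 2
  have e1 : τ ≤ Λ ^ 2 / τ := by rw [le_div_iff₀ hτ0]; linarith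
  have e2 : Λ ^ 2 * τ ≤ Λ ^ 4 / τ := by
    rw [le_div_iff₀ hτ0]
    have := mul_le_mul_of_nonneg_left hsq (sq_nonneg Λ)
    linarith
  have e3 := mul_le_mul_of_nonneg_right e1 hV1
  have e4 := mul_le_mul_of_nonneg_right e2 hV
  unfold bulk
  linarith

/-- The equation gives v2 = Pv − 2itv1 + (t² + Q)v with |t| ≤ KΛ and |Q| ≤ 2K²Λ², so no separate
estimate of the second derivative is needed. -/
theorem integral_dens_le (S : Side ε a b K τ s X α β t Q m v v1 v2) (hK : 1 ≤ K) (hτ : 1 ≤ τ)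
    (hs1 : s ≤ 1) (hX : 0 ≤ X) :
    ∫ y in a..b, dens τ (τ + X) (v y) (v1 y) (v2 y) ≤
      (1 + 27 * K ^ 4) * bulk a b τ (τ + X) v v1 + 3 * ∫ y in a..b, ‖conjOp t Q v v1 v2 y‖ ^ 2 := by
  have hτ0 : 0 < τ := by linarith
  obtain ⟨Λ, hΛ⟩ : ∃ Λ, Λ = τ + X := ⟨_, rfl⟩
  have hτΛ : τ ≤ Λ := by linarith
  have hΛ0 : 0 < Λ := by linarith
  have cv := S.cont_v
  have cv1 := S.cont_v1
  have cv2 := S.v2_cont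
  have cc := S.cont_conjOp
  have hp : ∀ y, dens τ Λ (v y) (v1 y) (v2 y) ≤ (1 + 27 * K ^ 4) * (Λ ^ 4 / τ) * ‖v y‖ ^ 2
      + (1 + 27 * K ^ 4) * (Λ ^ 2 / τ) * ‖v1 y‖ ^ 2 + 3 * ‖conjOp t Q v v1 v2 y‖ ^ 2 := fun y ↦ by
    have e0 : v2 y = conjOp t Q v v1 v2 y - 2 * Complex.I * t y * v1 y
        + (t y ^ 2 + Q y) * v y := by unfold conjOp; ring
    have ht := S.t_bd y
    have hQ := S.norm_Q_le hK hX y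
    rw [← hΛ] at ht hQ
    have e1 : ‖2 * Complex.I * t y * v1 y‖ ≤ 2 * K * Λ * ‖v1 y‖ := by
      rw [norm_mul, norm_mul, norm_mul, Complex.norm_I, Complex.norm_ofNat]
      refine mul_le_mul_of_nonneg_right ?_ (norm_nonneg _)
      linarith
    have hXΛ : X ^ 2 ≤ Λ ^ 2 := pow_le_pow_left₀ hX (by linarith) 2
    have e2 : ‖(t y ^ 2 + Q y) * v y‖ ≤ 3 * K ^ 2 * Λ ^ 2 * ‖v y‖ := by
      rw [norm_mul]
      refine mul_le_mul_of_nonneg_right ((norm_add_le _ _).trans ?_) (norm_nonneg _)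
      rw [norm_pow]
      have f1 := pow_le_pow_left₀ (norm_nonneg _) ht 2
      have f2 : K ^ 2 * X ^ 2 ≤ K ^ 2 * Λ ^ 2 := by gcongr
      have f3 : K * s * Λ ^ 2 ≤ K ^ 2 * Λ ^ 2 := by
        rw [sq K]; gcongr; linarith
      linarith
    have e3 : ‖v2 y‖ ≤ ‖conjOp t Q v v1 v2 y‖ + 2 * K * Λ * ‖v1 y‖ + 3 * K ^ 2 * Λ ^ 2 * ‖v y‖ := by
      rw [e0]
      exact (norm_add_le _ _).trans (add_le_add ((norm_sub_le _ _).trans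
        (add_le_add le_rfl e1)) e2)
    have e4 := (pow_le_pow_left₀ (norm_nonneg _) e3 2).trans (add_three_sq_le _ _ _)
    have e5 : ‖conjOp t Q v v1 v2 y‖ ^ 2 / τ ≤ ‖conjOp t Q v v1 v2 y‖ ^ 2 :=
      div_le_self (by positivity) hτ
    have e6 : 12 * K ^ 2 ≤ 27 * K ^ 4 := by
      have : K ^ 2 ≤ K ^ 4 := pow_le_pow_right₀ hK (by norm_num)
      have : 0 ≤ K ^ 4 := by positivity
      linarith
    have e7 := mul_le_mul_of_nonneg_right e6 (show 0 ≤ Λ ^ 2 / τ * ‖v1 y‖ ^ 2 by positivity)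
    have e8 := div_le_div_of_nonneg_right e4 hτ0.le
    have e9 : dens τ Λ (v y) (v1 y) (v2 y) = Λ ^ 4 / τ * ‖v y‖ ^ 2 + Λ ^ 2 / τ * ‖v1 y‖ ^ 2
        + ‖v2 y‖ ^ 2 / τ := by unfold dens; ring
    have e10 : 3 * (‖conjOp t Q v v1 v2 y‖ ^ 2 + (2 * K * Λ * ‖v1 y‖) ^ 2
        + (3 * K ^ 2 * Λ ^ 2 * ‖v y‖) ^ 2) / τ = 3 * (‖conjOp t Q v v1 v2 y‖ ^ 2 / τ)
        + 12 * K ^ 2 * (Λ ^ 2 / τ * ‖v1 y‖ ^ 2) + 27 * K ^ 4 * (Λ ^ 4 / τ * ‖v y‖ ^ 2) := by ring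
    rw [e9]
    linarith
  rw [← hΛ]
  have hd : Continuous fun y ↦ dens τ Λ (v y) (v1 y) (v2 y) := by unfold dens; fun_prop
  refine (intervalIntegral.integral_mono_on S.hab (hd.intervalIntegrable _ _)
    (Continuous.intervalIntegrable (by fun_prop) _ _) fun y _ ↦ hp y).trans (le_of_eq ?_)
  rw [intervalIntegral.integral_add (Continuous.intervalIntegrable (by fun_prop) _ _)
    (Continuous.intervalIntegrable (by fun_prop) _ _),
    intervalIntegral.integral_add (Continuous.intervalIntegrable (by fun_prop) _ _)
    (Continuous.intervalIntegrable (by fun_prop) _ _), intervalIntegral.integral_const_mul,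
    intervalIntegral.integral_const_mul, intervalIntegral.integral_const_mul]
  unfold bulk
  ring

end Side

/-- For τ ≥ 6K²C the first-order part of the source costs at most half of the interior energy and
goes to the left; the second derivative is added afterwards. -/
theorem absorb_lower {C K τ W T H Hc J D : ℝ} (hC : 0 < C) (hτ : 0 < τ)
    (hτ2 : 6 * K ^ 2 * C ≤ τ) (hW0 : 0 ≤ W) (hT0 : 0 ≤ T) (hH0 : 0 ≤ H) (hJ0 : 0 ≤ J)
    (h1 : W + T ≤ C * (Hc + J)) (h2 : Hc ≤ 3 * K ^ 2 * (H + W / τ))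
    (h3 : D ≤ (1 + 27 * K ^ 4) * W + 3 * Hc) :
    D + T ≤ (1 + (1 + 27 * K ^ 4) + 3 / C) * (2 * C * (3 * K ^ 2 + 1)) * (H + J)
      + 9 * K ^ 2 * (H + J) := by
  have e1 : C * (3 * K ^ 2 * (W / τ)) ≤ W / 2 := by
    rw [mul_div_assoc', mul_div_assoc', div_le_iff₀ hτ]
    have := mul_le_mul_of_nonneg_right hτ2 hW0
    linarith
  have e2 := mul_le_mul_of_nonneg_left h2 hC.le
  have e3 : W + T ≤ 2 * C * (3 * K ^ 2 + 1) * (H + J) := by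
    have : 0 ≤ C * H := by positivity
    have : 0 ≤ C * K ^ 2 * J := by positivity
    linarith
  have e4 : 3 * Hc ≤ 9 * K ^ 2 * (H + J) + 3 / C * W := by
    have : 0 ≤ K ^ 2 * J := by positivity
    have e5 : K ^ 2 * (W / τ) ≤ W / (6 * C) := by
      rw [mul_div_assoc', div_le_div_iff₀ hτ (by positivity)]
      have := mul_le_mul_of_nonneg_right hτ2 hW0
      linarith
    have e6 : 3 / C * W = 18 * (W / (6 * C)) := by field_simp; ring
    have : 0 ≤ W / (6 * C) := by positivity
    linarith
  have e5 : 0 ≤ (1 + 27 * K ^ 4) + 3 / C := by positivity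
  have e6 := mul_le_mul_of_nonneg_left e3 (show 0 ≤ 1 + (1 + 27 * K ^ 4) + 3 / C by positivity)
  have e7 : 0 ≤ (1 + 27 * K ^ 4 + 3 / C) * T := by positivity
  linarith

/-- The one-dimensional transmission estimate, with lower order terms and second derivatives. -/
theorem transmission_lower {K αp αm ℓ : ℝ} (hK : 1 ≤ K) (hαp : 0 < αp) (hαm : 0 < αm)
    (hℓ : ℓ < αp / αm) :
    ∃ s₀ τ₀ β₀ C : ℝ, 0 < s₀ ∧ s₀ < 1 ∧ 1 ≤ τ₀ ∧ 0 < β₀ ∧ 0 < C ∧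
      ∀ {a b τ s X β ap am : ℝ} {tp tm Qp Qm : ℝ → ℂ} {mp mm : ℝ → ℝ}
        {vp v1p v2p vm v1m v2m Gp Gm : ℝ → ℂ},
        Side 1 0 b K τ s X αp β tp Qp mp vp v1p v2p →
        Side (-1) a 0 K τ s X αm β tm Qm mm vm v1m v2m →
        τ₀ ≤ τ → 0 ≤ s → s ≤ s₀ → 0 ≤ X → β₀ ≤ β →
        |ap| ≤ K → |am| ≤ K → 1 ≤ K * ap → 1 ≤ K * am → mp 0 ≤ ℓ * mm 0 →
        (∀ᵐ y, y ∈ Icc 0 b → ‖conjOp tp Qp vp v1p v2p y‖ ≤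
          K * (‖Gp y‖ + ‖v1p y‖ + (τ + X) * ‖vp y‖)) →
        (∀ᵐ y, y ∈ Icc a 0 → ‖conjOp tm Qm vm v1m v2m y‖ ≤
          K * (‖Gm y‖ + ‖v1m y‖ + (τ + X) * ‖vm y‖)) →
        AEStronglyMeasurable Gp volume → AEStronglyMeasurable Gm volume →
        (∫⁻ y in Ioc 0 b, ENNReal.ofReal (dens τ (τ + X) (vp y) (v1p y) (v2p y)))
          + (∫⁻ y in Ioc a 0, ENNReal.ofReal (dens τ (τ + X) (vm y) (v1m y) (v2m y)))
          + ENNReal.ofReal (trace (τ + X) vp v1p) + ENNReal.ofReal (trace (τ + X) vm v1m) ≤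
        ENNReal.ofReal C * ((∫⁻ y in Ioc 0 b, ‖Gp y‖ₑ ^ 2) + (∫⁻ y in Ioc a 0, ‖Gm y‖ₑ ^ 2)
          + ENNReal.ofReal (jump (τ + X) (vp 0 - vm 0) (ap * (v1p 0 + Complex.I * tp 0 * vp 0)
            - am * (v1m 0 + Complex.I * tm 0 * vm 0)))) := by
  obtain ⟨s₀, τ₀, β₀, C, hs₀, hτ₀, hβ₀, hC, main⟩ := transmission hK hαp hαm hℓ
  refine ⟨min s₀ (1 / 2), max τ₀ (6 * K ^ 2 * C), β₀,
    (1 + (1 + 27 * K ^ 4) + 3 / C) * (2 * C * (3 * K ^ 2 + 1)) + 9 * K ^ 2, by positivity,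
    (min_le_right _ _).trans_lt (by norm_num), hτ₀.trans (le_max_left _ _), hβ₀, by positivity, ?_⟩
  intro a b τ s X β ap am tp tm Qp Qm mp mm vp v1p v2p vm v1m v2m Gp Gm Sp Sm hτ hs0 hs hX hβ hap
    ham hap' ham' hm hGp hGm hGpm hGmm
  simp only [max_le_iff, le_min_iff] at hτ hs
  obtain ⟨hτ1, hτ2⟩ := hτ
  obtain ⟨hs1, hs2⟩ := hs
  have hτ0 : 0 < τ := by linarith
  have conv : ∀ {a b : ℝ} {G : ℝ → ℂ}, AEStronglyMeasurable G volume → a ≤ b →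
      (∫⁻ y in Ioc a b, ‖G y‖ₑ ^ 2) ≠ ⊤ →
      IntervalIntegrable (fun y ↦ ‖G y‖ ^ 2) volume a b ∧
        ∫⁻ y in Ioc a b, ‖G y‖ₑ ^ 2 = ENNReal.ofReal (∫ y in a..b, ‖G y‖ ^ 2) := by
    intro a b G hG hab hfin
    have e : ∀ y, ‖G y‖ₑ ^ 2 = ENNReal.ofReal (‖G y‖ ^ 2) := fun y ↦ by
      rw [ENNReal.ofReal_pow (norm_nonneg _), ofReal_norm]
    have hi : IntegrableOn (fun y ↦ ‖G y‖ ^ 2) (Ioc a b) volume := by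
      refine ⟨(hG.norm.pow 2).restrict, ?_⟩
      rw [hasFiniteIntegral_iff_ofReal (Eventually.of_forall fun y ↦ by positivity)]
      simp_rw [← e]
      exact hfin.lt_top
    refine ⟨(intervalIntegrable_iff_integrableOn_Ioc_of_le hab).2 hi, ?_⟩
    rw [intervalIntegral.integral_of_le hab,
      ofReal_integral_eq_lintegral_ofReal hi (Eventually.of_forall fun y ↦ by positivity)]
    simp_rw [e]
  -- No integrability of the source is assumed: if its energy is infinite the right-hand side is ⊤.
  -- Otherwise all terms are real integrals.
  by_cases hfp : (∫⁻ y in Ioc 0 b, ‖Gp y‖ₑ ^ 2) = ⊤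
  · rw [hfp, top_add, top_add, ENNReal.mul_top]
    · exact le_top
    · exact (ENNReal.ofReal_pos.2 (by positivity)).ne'
  by_cases hfm : (∫⁻ y in Ioc a 0, ‖Gm y‖ₑ ^ 2) = ⊤
  · rw [hfm, add_top, top_add, ENNReal.mul_top]
    · exact le_top
    · exact (ENNReal.ofReal_pos.2 (by positivity)).ne'
  obtain ⟨ip, ep⟩ := conv hGpm Sp.hab hfp
  obtain ⟨im, em⟩ := conv hGmm Sm.hab hfm
  have convd : ∀ {ε a b α : ℝ} {t Q : ℝ → ℂ} {m : ℝ → ℝ} {v v1 v2 : ℝ → ℂ},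
      Side ε a b K τ s X α β t Q m v v1 v2 →
      ∫⁻ y in Ioc a b, ENNReal.ofReal (dens τ (τ + X) (v y) (v1 y) (v2 y)) =
        ENNReal.ofReal (∫ y in a..b, dens τ (τ + X) (v y) (v1 y) (v2 y)) := by
    intro ε a b α t Q m v v1 v2 S
    have cv := S.cont_v
    have cv1 := S.cont_v1
    have cv2 := S.v2_cont
    have hd : Continuous fun y ↦ dens τ (τ + X) (v y) (v1 y) (v2 y) := by unfold dens; fun_prop
    rw [intervalIntegral.integral_of_le S.hab, ofReal_integral_eq_lintegral_ofReal
      ((intervalIntegrable_iff_integrableOn_Ioc_of_le S.hab).1 (hd.intervalIntegrable _ _))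
      (Eventually.of_forall fun y ↦ dens_nonneg hτ0 _ _ _)]
  have hTp : 0 ≤ trace (τ + X) vp v1p := by unfold trace; positivity
  have hTm : 0 ≤ trace (τ + X) vm v1m := by unfold trace; positivity
  have hDp : 0 ≤ ∫ y in (0 : ℝ)..b, dens τ (τ + X) (vp y) (v1p y) (v2p y) :=
    intervalIntegral.integral_nonneg Sp.hab fun y _ ↦ dens_nonneg hτ0 _ _ _
  have hDm : 0 ≤ ∫ y in a..0, dens τ (τ + X) (vm y) (v1m y) (v2m y) :=
    intervalIntegral.integral_nonneg Sm.hab fun y _ ↦ dens_nonneg hτ0 _ _ _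
  have hHp : 0 ≤ ∫ y in (0 : ℝ)..b, ‖Gp y‖ ^ 2 :=
    intervalIntegral.integral_nonneg Sp.hab (by intros; positivity)
  have hHm : 0 ≤ ∫ y in a..0, ‖Gm y‖ ^ 2 :=
    intervalIntegral.integral_nonneg Sm.hab (by intros; positivity)
  have hJ : 0 ≤ jump (τ + X) (vp 0 - vm 0) (ap * (v1p 0 + Complex.I * tp 0 * vp 0)
            - am * (v1m 0 + Complex.I * tm 0 * vm 0)) := by unfold jump; positivity
  rw [convd Sp, convd Sm, ep, em, ← ENNReal.ofReal_add hDp hDm,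
    ← ENNReal.ofReal_add (add_nonneg hDp hDm) hTp,
    ← ENNReal.ofReal_add (add_nonneg (add_nonneg hDp hDm) hTp) hTm,
    ← ENNReal.ofReal_add hHp hHm, ← ENNReal.ofReal_add (add_nonneg hHp hHm) hJ,
    ← ENNReal.ofReal_mul (by positivity)]
  refine ENNReal.ofReal_le_ofReal ?_
  have m1 := main Sp Sm hτ1 hs0 hs1 hX hβ hap ham hap' ham' hm
  have m2 := Sp.integral_conjOp_le (hτ₀.trans hτ1) hX hGp ip
  have m3 := Sm.integral_conjOp_le (hτ₀.trans hτ1) hX hGm im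
  have m4 := Sp.integral_dens_le hK (hτ₀.trans hτ1) (by linarith) hX
  have m5 := Sm.integral_dens_le hK (hτ₀.trans hτ1) (by linarith) hX
  have hWp : 0 ≤ bulk 0 b τ (τ + X) vp v1p := Side.bulk_nonneg Sp.hab hτ0
  have hWm : 0 ≤ bulk a 0 τ (τ + X) vm v1m := Side.bulk_nonneg Sm.hab hτ0
  have fin := absorb_lower (W := bulk 0 b τ (τ + X) vp v1p + bulk a 0 τ (τ + X) vm v1m)
    (T := trace (τ + X) vp v1p + trace (τ + X) vm v1m)
    (H := (∫ y in (0 : ℝ)..b, ‖Gp y‖ ^ 2) + ∫ y in a..0, ‖Gm y‖ ^ 2)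
    (Hc := (∫ y in (0 : ℝ)..b, ‖conjOp tp Qp vp v1p v2p y‖ ^ 2)
      + ∫ y in a..0, ‖conjOp tm Qm vm v1m v2m y‖ ^ 2)
    (D := (∫ y in (0 : ℝ)..b, dens τ (τ + X) (vp y) (v1p y) (v2p y))
      + ∫ y in a..0, dens τ (τ + X) (vm y) (v1m y) (v2m y)) hC hτ0 hτ2
    (add_nonneg hWp hWm) (add_nonneg hTp hTm) (add_nonneg hHp hHm) hJ (by linarith)
    (by rw [add_div]; linarith) (by linarith)
  linarith

end Carleman

end

/-! ### Coefficients and symbols: ellipticity, Lipschitz bounds, perturbation in s. -/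

noncomputable section

namespace Carleman

open MeasureTheory Set Filter Topology

/-- Functions bounded by `B` and Lipschitz with constant `B`. -/
def BddLip (B : ℝ) (f : ℝ → ℝ) : Prop := (∀ y, |f y| ≤ B) ∧ ∀ y y', |f y - f y'| ≤ B * |y - y'|

theorem BddLip.nonneg {B : ℝ} {f : ℝ → ℝ} (h : BddLip B f) : 0 ≤ B := (abs_nonneg _).trans (h.1 0)

theorem BddLip.mono {B B' : ℝ} {f : ℝ → ℝ} (h : BddLip B f) (hB : B ≤ B') : BddLip B' f :=
  ⟨fun y ↦ (h.1 y).trans hB, fun y y' ↦ (h.2 y y').trans (by gcongr)⟩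

theorem BddLip.mul {B B' : ℝ} {f g : ℝ → ℝ} (hf : BddLip B f) (hg : BddLip B' g) :
    BddLip (2 * (B * B')) (fun y ↦ f y * g y) := by
  have hB := hf.nonneg
  have hB' := hg.nonneg
  refine ⟨fun y ↦ ?_, fun y y' ↦ ?_⟩
  · rw [abs_mul]
    have := mul_le_mul (hf.1 y) (hg.1 y) (abs_nonneg _) hB
    have : 0 ≤ B * B' := by positivity
    linarith
  · rw [show f y * g y - f y' * g y' = f y * (g y - g y') + (f y - f y') * g y' by ring]
    refine (abs_add_le _ _).trans ?_
    rw [abs_mul, abs_mul]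
    have h1 := mul_le_mul (hf.1 y) (hg.2 y y') (abs_nonneg _) hB
    have h2 := mul_le_mul (hf.2 y y') (hg.1 y') (abs_nonneg _) (by positivity)
    linarith

theorem BddLip.sub {B B' : ℝ} {f g : ℝ → ℝ} (hf : BddLip B f) (hg : BddLip B' g) :
    BddLip (B + B') (fun y ↦ f y - g y) := by
  refine ⟨fun y ↦ (abs_sub _ _).trans (add_le_add (hf.1 y) (hg.1 y)), fun y y' ↦ ?_⟩
  rw [show f y - g y - (f y' - g y') = (f y - f y') - (g y - g y') by ring, add_mul]
  exact (abs_sub _ _).trans (add_le_add (hf.2 y y') (hg.2 y y'))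

theorem BddLip.inv {c M : ℝ} {f : ℝ → ℝ} (hc : 0 < c) (hM : 0 ≤ M) (hf : ∀ y, c ≤ f y)
    (hl : ∀ y y', |f y - f y'| ≤ M * |y - y'|) : BddLip (c⁻¹ + M * (c⁻¹ * c⁻¹)) (fun y ↦ (f y)⁻¹) := by
  have hb : ∀ y, |(f y)⁻¹| ≤ c⁻¹ := fun y ↦ by
    rw [abs_of_pos (inv_pos.2 (hc.trans_le (hf y)))]
    exact inv_anti₀ hc (hf y)
  refine ⟨fun y ↦ (hb y).trans (by have : 0 ≤ M * (c⁻¹ * c⁻¹) := by positivity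
                                   linarith), fun y y' ↦ ?_⟩
  have h1 : f y ≠ 0 := (hc.trans_le (hf y)).ne'
  have h2 : f y' ≠ 0 := (hc.trans_le (hf y')).ne'
  rw [show (f y)⁻¹ - (f y')⁻¹ = -(f y - f y') * ((f y)⁻¹ * (f y')⁻¹) by field_simp; ring, abs_mul,
    abs_neg, abs_mul]
  have h3 := mul_le_mul (hl y y') (mul_le_mul (hb y) (hb y') (abs_nonneg _) (by positivity))
    (by positivity) (by positivity)
  have : 0 ≤ c⁻¹ * |y - y'| := by positivity
  linarith

variable {d : ℕ}

/-- The coefficient `a_nn`. -/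
def ann (A : Coeff d) (y : ℝ) : ℝ := A y (Fin.last d) (Fin.last d)

/-- The coefficients `a_nj / a_nn`. -/
def tco (A : Coeff d) (j : Fin d) (y : ℝ) : ℝ := A y (Fin.last d) j.castSucc / ann A y

/-- The coefficients `b_jk / a_nn`. -/
def bco (A : Coeff d) (j k : Fin d) (y : ℝ) : ℝ :=
  (A y j.castSucc k.castSucc - A y (Fin.last d) j.castSucc * A y (Fin.last d) k.castSucc / ann A y)
    / ann A y

namespace Admissible

variable {lam0 M0 : ℝ} {A : Coeff d}

theorem quad_two (A : Coeff d) (y c : ℝ) (i j : Fin (d + 1)) :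
    (Pi.single i 1 + Pi.single j c : Fin (d + 1) → ℝ) ⬝ᵥ
      (A y).mulVec (Pi.single i 1 + Pi.single j c) =
      A y i i + c * A y i j + c * A y j i + c ^ 2 * A y j j := by
  simp [Matrix.mulVec_add, add_dotProduct, dotProduct_add]
  ring

theorem diag_lower (h : Admissible lam0 M0 A) (y : ℝ) (i : Fin (d + 1)) : lam0 ≤ A y i i := by
  simpa using h.lower y (Pi.single i 1)

theorem diag_upper (h : Admissible lam0 M0 A) (y : ℝ) (i : Fin (d + 1)) : A y i i ≤ lam0⁻¹ := by
  simpa using h.upper y (Pi.single i 1)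

/-- Nonnegativity of the form at e_i ± e_j gives 2|a_ij| ≤ a_ii + a_jj. -/
theorem abs_entry_le (h : Admissible lam0 M0 A) (hlam : 0 < lam0) (y : ℝ) (i j : Fin (d + 1)) :
    |A y i j| ≤ lam0⁻¹ := by
  have hs : A y j i = A y i j := by
    conv_lhs => rw [← (h.symm y)]
    rfl
  have h1 : ∀ c : ℝ, 0 ≤ A y i i + c * A y i j + c * A y j i + c ^ 2 * A y j j := fun c ↦ by
    rw [← quad_two]
    refine le_trans (mul_nonneg hlam.le ?_) (h.lower y _)
    exact Finset.sum_nonneg fun k _ ↦ mul_self_nonneg _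
  have h2 := h1 1
  have h3 := h1 (-1)
  have h4 := h.diag_upper y i
  have h5 := h.diag_upper y j
  rw [hs] at h2 h3
  rw [abs_le]
  constructor <;> linarith

/-- Completing the square in the normal component c: `formB` is the Schur complement, that is, the
minimum of the full form over c. Both ellipticity bounds for `formB` are read off from this. -/
theorem quad_split (h : Admissible lam0 M0 A) (hlam : 0 < lam0) (y c : ℝ) (ξ : Tan d) :
    (Fin.snoc ξ c : Fin (d + 1) → ℝ) ⬝ᵥ (A y).mulVec (Fin.snoc ξ c : Fin (d + 1) → ℝ) =
      formB A ξ y + ann A y * (c + (∑ j, A y (Fin.last d) j.castSucc * ξ j) / ann A y) ^ 2 := by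
  have ha : ann A y ≠ 0 := (hlam.trans_le (h.diag_lower y _)).ne'
  have hs : ∀ i j, A y j i = A y i j := fun i j ↦ by
    conv_lhs => rw [← (h.symm y)]
    rfl
  obtain ⟨T, hT⟩ : ∃ T, T = ∑ j, A y (Fin.last d) j.castSucc * ξ j := ⟨_, rfl⟩
  have hB : formB A ξ y = (∑ j : Fin d, ∑ k : Fin d, A y j.castSucc k.castSucc * ξ j * ξ k)
      - T ^ 2 / ann A y := by
    rw [sq, hT, Finset.sum_mul_sum, Finset.sum_div, ← Finset.sum_sub_distrib]
    refine Finset.sum_congr rfl fun j _ ↦ ?_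
    rw [Finset.sum_div, ← Finset.sum_sub_distrib]
    refine Finset.sum_congr rfl fun k _ ↦ ?_
    unfold ann
    ring
  have hL : (Fin.snoc ξ c : Fin (d + 1) → ℝ) ⬝ᵥ (A y).mulVec (Fin.snoc ξ c : Fin (d + 1) → ℝ) =
      (∑ j : Fin d, ∑ k : Fin d, A y j.castSucc k.castSucc * ξ j * ξ k) + 2 * c * T
        + c ^ 2 * ann A y := by
    simp only [dotProduct, Matrix.mulVec, Fin.sum_univ_castSucc, Fin.snoc_castSucc, Fin.snoc_last]
    have e1 : ∑ j : Fin d, ξ j * (∑ k : Fin d, A y j.castSucc k.castSucc * ξ k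
        + A y j.castSucc (Fin.last d) * c) =
        (∑ j : Fin d, ∑ k : Fin d, A y j.castSucc k.castSucc * ξ j * ξ k) + c * T := by
      rw [hT, Finset.mul_sum, ← Finset.sum_add_distrib]
      refine Finset.sum_congr rfl fun j _ ↦ ?_
      rw [mul_add, Finset.mul_sum, hs (Fin.last d) j.castSucc]
      congr 1
      · exact Finset.sum_congr rfl fun k _ ↦ by ring
      · ring
    rw [e1, ← hT]
    unfold ann
    ring
  rw [hL, hB, ← hT]
  field_simp
  ring

theorem snoc_dot (c : ℝ) (ξ : Tan d) :
    (Fin.snoc ξ c : Fin (d + 1) → ℝ) ⬝ᵥ (Fin.snoc ξ c : Fin (d + 1) → ℝ) = ‖ξ‖ ^ 2 + c ^ 2 := by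
  have e : ‖ξ‖ ^ 2 = ∑ j, ξ j * ξ j := by
    rw [EuclideanSpace.norm_sq_eq]
    exact Finset.sum_congr rfl fun j _ ↦ by rw [Real.norm_eq_abs, sq_abs, sq]
  simp only [e, dotProduct, Fin.sum_univ_castSucc, Fin.snoc_castSucc, Fin.snoc_last, sq c]

/-- Evaluate the full form at the minimizing normal component, where the square vanishes. -/
theorem formB_lower (h : Admissible lam0 M0 A) (hlam : 0 < lam0) (y : ℝ) (ξ : Tan d) :
    lam0 * ‖ξ‖ ^ 2 ≤ formB A ξ y := by
  have h1 := h.lower y (Fin.snoc ξ (-((∑ j, A y (Fin.last d) j.castSucc * ξ j) / ann A y)) :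
    Fin (d + 1) → ℝ)
  rw [h.quad_split hlam, snoc_dot, neg_add_cancel] at h1
  have : 0 ≤ lam0 * (-((∑ j, A y (Fin.last d) j.castSucc * ξ j) / ann A y)) ^ 2 := by positivity
  linarith

theorem formB_upper (h : Admissible lam0 M0 A) (hlam : 0 < lam0) (y : ℝ) (ξ : Tan d) :
    formB A ξ y ≤ lam0⁻¹ * ‖ξ‖ ^ 2 := by
  have h1 := h.upper y (Fin.snoc ξ 0 : Fin (d + 1) → ℝ)
  rw [h.quad_split hlam, snoc_dot] at h1
  have ha : 0 < ann A y := hlam.trans_le (h.diag_lower y _)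
  have : 0 ≤ ann A y * (0 + (∑ j, A y (Fin.last d) j.castSucc * ξ j) / ann A y) ^ 2 := by positivity
  linarith

theorem symbolM_lower (h : Admissible lam0 M0 A) (hlam : 0 < lam0) (y : ℝ) (ξ : Tan d) :
    lam0 * ‖ξ‖ ≤ symbolM A ξ y := by
  refine Real.le_sqrt_of_sq_le ?_
  rw [le_div_iff₀ (hlam.trans_le (h.diag_lower y _))]
  have h1 := h.formB_lower hlam y ξ
  have h2 := mul_le_mul_of_nonneg_left (h.diag_upper y (Fin.last d)) (sq_nonneg (lam0 * ‖ξ‖))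
  refine h2.trans (le_trans (le_of_eq ?_) h1)
  field_simp

theorem symbolM_upper (h : Admissible lam0 M0 A) (hlam : 0 < lam0) (y : ℝ) (ξ : Tan d) :
    symbolM A ξ y ≤ lam0⁻¹ * ‖ξ‖ := by
  refine Real.sqrt_le_iff.2 ⟨by positivity, ?_⟩
  rw [div_le_iff₀ (hlam.trans_le (h.diag_lower y _))]
  have h1 := h.formB_upper hlam y ξ
  have h2 := mul_le_mul_of_nonneg_left (h.diag_lower y (Fin.last d)) (sq_nonneg (lam0⁻¹ * ‖ξ‖))
  refine h1.trans (le_trans (le_of_eq ?_) h2)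
  field_simp

theorem symbolM_sq (h : Admissible lam0 M0 A) (hlam : 0 < lam0) (y : ℝ) (ξ : Tan d) :
    symbolM A ξ y ^ 2 = ∑ j, ∑ k, bco A j k y * ξ j * ξ k := by
  unfold symbolM
  rw [Real.sq_sqrt]
  · unfold formB bco ann
    rw [Finset.sum_div]
    refine Finset.sum_congr rfl fun j _ ↦ ?_
    rw [Finset.sum_div]
    refine Finset.sum_congr rfl fun k _ ↦ ?_
    ring
  · exact div_nonneg (le_trans (by positivity) (h.formB_lower hlam y ξ))
      (hlam.le.trans (h.diag_lower y _))

theorem ratio_le {Ap Am : Coeff d} (hp : Admissible lam0 M0 Ap) (hm : Admissible lam0 M0 Am)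
    (hlam : 0 < lam0) (ξ : Tan d) (hξ : ξ ≠ 0) :
    symbolM Ap ξ 0 / symbolM Am ξ 0 ≤ (lam0 ^ 2)⁻¹ := by
  have hn : 0 < ‖ξ‖ := norm_pos_iff.2 hξ
  have h1 := hp.symbolM_upper hlam 0 ξ
  have h2 := hm.symbolM_lower hlam 0 ξ
  rw [div_le_iff₀ (lt_of_lt_of_le (by positivity) h2)]
  have h3 := mul_le_mul_of_nonneg_left h2 (show 0 ≤ (lam0 ^ 2)⁻¹ by positivity)
  refine h1.trans (le_trans (le_of_eq ?_) h3)
  field_simp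

theorem ratioL_le {Ap Am : Coeff d} (hp : Admissible lam0 M0 Ap) (hm : Admissible lam0 M0 Am)
    (hlam : 0 < lam0) : ratioL Ap Am ≤ (lam0 ^ 2)⁻¹ :=
  Real.iSup_le (fun ξ ↦ ratio_le hp hm hlam ξ.1 ξ.2) (by positivity)

theorem symbolM_le_of_ratioL {Ap Am : Coeff d} (hp : Admissible lam0 M0 Ap)
    (hm : Admissible lam0 M0 Am) (hlam : 0 < lam0) {ℓ : ℝ} (hℓ : ratioL Ap Am ≤ ℓ) (ξ : Tan d) :
    symbolM Ap ξ 0 ≤ ℓ * symbolM Am ξ 0 := by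
  by_cases hξ : ξ = 0
  · have e : ∀ {A : Coeff d}, symbolM A (0 : Tan d) 0 = 0 := fun {A} ↦ by
      simp [symbolM, formB]
    rw [hξ, e, e, mul_zero]
  -- A real supremum of an unbounded family is 0 by convention, so the bound on `ratioL` says
  -- something about a single ξ only after the ratios are known to be bounded.
  · have hbdd : BddAbove (range fun ξ : {ξ : Tan d // ξ ≠ 0} ↦
        symbolM Ap ξ.1 0 / symbolM Am ξ.1 0) := by
      refine ⟨(lam0 ^ 2)⁻¹, ?_⟩
      rintro _ ⟨ξ, rfl⟩
      exact ratio_le hp hm hlam ξ.1 ξ.2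
    have h1 := (le_ciSup hbdd ⟨ξ, hξ⟩).trans hℓ
    have h2 := hm.symbolM_lower hlam 0 ξ
    have hn : 0 < ‖ξ‖ := norm_pos_iff.2 hξ
    exact (div_le_iff₀ (lt_of_lt_of_le (by positivity) h2)).1 h1

/-- The normalized coefficients are rational in the entries, with denominators powers of a_nn ≥ λ₀.
One B thus serves all admissible matrices, which makes the final constants uniform. -/
theorem exists_bddLip (d : ℕ) {lam0 M0 : ℝ} (hlam : 0 < lam0) (hM : 0 < M0) :
    ∃ B, lam0⁻¹ ≤ B ∧ M0 ≤ B ∧ ∀ A : Coeff d, Admissible lam0 M0 A →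
      (∀ j, BddLip B (tco A j)) ∧ ∀ j k, BddLip B (bco A j k) := by
  obtain ⟨B0, hB0⟩ : ∃ B, B = lam0⁻¹ + M0 := ⟨_, rfl⟩
  obtain ⟨Bi, hBi⟩ : ∃ B, B = lam0⁻¹ + M0 * (lam0⁻¹ * lam0⁻¹) := ⟨_, rfl⟩
  have hB00 : 0 < B0 := by rw [hB0]; positivity
  have hBi0 : 0 < Bi := by rw [hBi]; positivity
  obtain ⟨Bb, hBb⟩ : ∃ B, B = 2 * ((B0 + 2 * (2 * (B0 * B0) * Bi)) * Bi) := ⟨_, rfl⟩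
  have hBb0 : 0 < Bb := by rw [hBb]; positivity
  refine ⟨B0 + 2 * (B0 * Bi) + Bb, ?_, ?_, fun A h ↦ ?_⟩
  · have : 0 < 2 * (B0 * Bi) := by positivity
    linarith
  · have : 0 < 2 * (B0 * Bi) := by positivity
    have : 0 < lam0⁻¹ := by positivity
    linarith
  have hA : ∀ i j, BddLip B0 (fun y ↦ A y i j) := fun i j ↦ by
    have : 0 < lam0⁻¹ := by positivity
    refine ⟨fun y ↦ (h.abs_entry_le hlam y i j).trans (by linarith), fun y y' ↦ ?_⟩
    exact (h.lipschitz y' y i j).trans (mul_le_mul_of_nonneg_right (by linarith) (abs_nonneg _))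
  have hi : BddLip Bi (fun y ↦ (ann A y)⁻¹) := by
    rw [hBi]
    exact BddLip.inv hlam hM.le (fun y ↦ h.diag_lower y _) (fun y y' ↦ h.lipschitz y' y _ _)
  have ht : ∀ j, BddLip (2 * (B0 * Bi)) (tco A j) := fun j ↦ (hA _ _).mul hi
  have hb : ∀ j k, BddLip Bb (bco A j k) := fun j k ↦ by
    rw [hBb]
    exact ((hA _ _).sub (((hA _ _).mul (hA _ _)).mul hi)).mul hi
  have : 0 < 2 * (B0 * Bi) := by positivity
  exact ⟨fun j ↦ (ht j).mono (by linarith), fun j k ↦ (hb j k).mono (by linarith)⟩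

end Admissible

/-- The complex frequency `ξ + i τ s γ`. -/
def cfreq (τ s : ℝ) (γ X : Tan d) (j : Fin d) : ℂ := (X j : ℂ) + Complex.I * (τ * s * γ j : ℝ)

/-- The symbol `∑ a_nj ζ_j / a_nn`. -/
def tsym (A : Coeff d) (ζ : Fin d → ℂ) (y : ℝ) : ℂ := ∑ j, (tco A j y : ℂ) * ζ j

/-- The symbol `∑ b_jk ζ_j ζ_k / a_nn`. -/
def qsym (A : Coeff d) (ζ : Fin d → ℂ) (y : ℝ) : ℂ := ∑ j, ∑ k, (bco A j k y : ℂ) * (ζ j * ζ k)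

/-- The Schur complement identity at a complex frequency: it writes the full tangential form as t²
plus the reduced form that μ has to square to. -/
theorem tsym_sq_add_qsym (A : Coeff d) (ζ : Fin d → ℂ) (y : ℝ) (ha : ann A y ≠ 0) :
    ann A y * (tsym A ζ y ^ 2 + qsym A ζ y) =
      ∑ j : Fin d, ∑ k : Fin d, (A y j.castSucc k.castSucc : ℂ) * (ζ j * ζ k) := by
  have ha' : (ann A y : ℂ) ≠ 0 := by exact_mod_cast ha
  unfold tsym qsym
  rw [sq, Finset.sum_mul_sum, ← Finset.sum_add_distrib, Finset.mul_sum]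
  refine Finset.sum_congr rfl fun j _ ↦ ?_
  rw [← Finset.sum_add_distrib, Finset.mul_sum]
  refine Finset.sum_congr rfl fun k _ ↦ ?_
  unfold tco bco
  push_cast
  field_simp
  ring

theorem norm_sum_le_card {n : ℕ} {f : Fin n → ℂ} {B : ℝ} (h : ∀ j, ‖f j‖ ≤ B) :
    ‖∑ j, f j‖ ≤ n * B := by
  refine (norm_sum_le_of_le _ fun j _ ↦ h j).trans (le_of_eq ?_)
  simp

section bounds

variable {τ s : ℝ} {γ X : Tan d}

theorem norm_cfreq_le (hτ : 0 ≤ τ) (hs : 0 ≤ s) (hs1 : s ≤ 1) (hγ : ‖γ‖ ≤ 1) (j : Fin d) :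
    ‖cfreq τ s γ X j‖ ≤ τ + ‖X‖ := by
  unfold cfreq
  refine (norm_add_le _ _).trans ?_
  rw [norm_mul, Complex.norm_I, one_mul, Complex.norm_real, Complex.norm_real, norm_mul,
    Real.norm_of_nonneg (mul_nonneg hτ hs)]
  have h1 := PiLp.norm_apply_le X j
  have h2 := (PiLp.norm_apply_le γ j).trans hγ
  have h3 : τ * s * ‖γ j‖ ≤ τ * 1 * 1 := by gcongr
  linarith

/-- Expanding the product leaves cross terms of size 2sτ‖X‖ and a term s²τ² ≤ sτ². -/
theorem norm_cfreq_mul_sub_le (hτ : 0 ≤ τ) (hs : 0 ≤ s) (hs1 : s ≤ 1) (hγ : ‖γ‖ ≤ 1)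
    (j k : Fin d) : ‖cfreq τ s γ X j * cfreq τ s γ X k - X j * X k‖ ≤ s * (τ + ‖X‖) ^ 2 := by
  unfold cfreq
  have e : ((X j : ℂ) + Complex.I * (τ * s * γ j : ℝ)) * ((X k : ℂ) + Complex.I * (τ * s * γ k : ℝ))
      - X j * X k = Complex.I * (X j * (τ * s * γ k) + X k * (τ * s * γ j) : ℝ)
        - ((τ * s * γ j) * (τ * s * γ k) : ℝ) := by
    push_cast
    linear_combination (τ * s * γ j) * (τ * s * γ k) * Complex.I_sq
  rw [e]
  refine (norm_sub_le _ _).trans ?_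
  rw [norm_mul, Complex.norm_I, one_mul, Complex.norm_real, Complex.norm_real]
  have g : ∀ j, |τ * s * γ j| ≤ τ * s := fun j ↦ by
    rw [abs_mul, abs_of_nonneg (mul_nonneg hτ hs)]
    exact mul_le_of_le_one_right (mul_nonneg hτ hs) ((PiLp.norm_apply_le γ j).trans hγ)
  have x : ∀ j, |X j| ≤ ‖X‖ := fun j ↦ PiLp.norm_apply_le X j
  have h1 : ‖X j * (τ * s * γ k) + X k * (τ * s * γ j)‖ ≤ ‖X‖ * (τ * s) + ‖X‖ * (τ * s) := by
    refine (norm_add_le _ _).trans ?_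
    rw [norm_mul (X j), norm_mul (X k)]
    exact add_le_add (mul_le_mul (x j) (g k) (abs_nonneg _) (norm_nonneg _))
      (mul_le_mul (x k) (g j) (abs_nonneg _) (norm_nonneg _))
  have h2 : ‖τ * s * γ j * (τ * s * γ k)‖ ≤ τ * s * (τ * s) := by
    rw [norm_mul (τ * s * γ j)]
    exact mul_le_mul (g j) (g k) (abs_nonneg _) (mul_nonneg hτ hs)
  have h3 : τ * s * (τ * s) ≤ τ * s * (τ * 1) := by gcongr
  have h4 : 0 ≤ s * ‖X‖ ^ 2 := by positivity
  linarith

variable {A : Coeff d} {B : ℝ}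

theorem norm_tsym_le (ht : ∀ j, BddLip B (tco A j)) {ζ : Fin d → ℂ} {Λ : ℝ}
    (hζ : ∀ j, ‖ζ j‖ ≤ Λ) (y : ℝ) : ‖tsym A ζ y‖ ≤ d * (B * Λ) :=
  norm_sum_le_card fun j ↦ by
    rw [norm_mul, Complex.norm_real]
    exact mul_le_mul ((ht j).1 y) (hζ j) (norm_nonneg _) (ht j).nonneg

theorem norm_tsym_sub_le (ht : ∀ j, BddLip B (tco A j)) {ζ : Fin d → ℂ} {Λ : ℝ}
    (hζ : ∀ j, ‖ζ j‖ ≤ Λ) (y y' : ℝ) :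
    ‖tsym A ζ y - tsym A ζ y'‖ ≤ d * (B * |y - y'| * Λ) := by
  unfold tsym
  rw [← Finset.sum_sub_distrib]
  refine norm_sum_le_card fun j ↦ ?_
  rw [← sub_mul, norm_mul, ← Complex.ofReal_sub, Complex.norm_real]
  exact mul_le_mul ((ht j).2 y y') (hζ j) (norm_nonneg _)
    (mul_nonneg (ht j).nonneg (abs_nonneg _))

theorem norm_qsym_sub_le (hb : ∀ j k, BddLip B (bco A j k)) {ζ : Fin d → ℂ} {Λ : ℝ}
    (hΛ : 0 ≤ Λ) (hζ : ∀ j, ‖ζ j‖ ≤ Λ) (y y' : ℝ) :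
    ‖qsym A ζ y - qsym A ζ y'‖ ≤ d * (d * (B * |y - y'| * (Λ * Λ))) := by
  unfold qsym
  rw [← Finset.sum_sub_distrib]
  refine norm_sum_le_card fun j ↦ ?_
  rw [← Finset.sum_sub_distrib]
  refine norm_sum_le_card fun k ↦ ?_
  rw [← sub_mul, norm_mul, ← Complex.ofReal_sub, Complex.norm_real, norm_mul]
  exact mul_le_mul ((hb j k).2 y y') (mul_le_mul (hζ j) (hζ k) (norm_nonneg _) hΛ)
    (by positivity) (mul_nonneg (hb j k).nonneg (abs_nonneg _))

/-- The coefficients are real, so the imaginary part comes only from the shift iτsγ and is small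
with s. -/
theorem abs_tsym_im_le (ht : ∀ j, BddLip B (tco A j)) (hτ : 0 ≤ τ) (hs : 0 ≤ s) (hγ : ‖γ‖ ≤ 1)
    (y : ℝ) : |(tsym A (cfreq τ s γ X) y).im| ≤ d * (B * (τ * s)) := by
  unfold tsym
  rw [Complex.im_sum]
  have : ∀ j, |((tco A j y : ℂ) * cfreq τ s γ X j).im| ≤ B * (τ * s) := fun j ↦ by
    rw [Complex.im_ofReal_mul]
    have e : (cfreq τ s γ X j).im = τ * s * γ j := by simp [cfreq]
    rw [e, abs_mul, abs_mul, abs_of_nonneg (mul_nonneg hτ hs)]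
    exact mul_le_mul ((ht j).1 y) (mul_le_of_le_one_right (mul_nonneg hτ hs)
      ((PiLp.norm_apply_le γ j).trans hγ)) (mul_nonneg (mul_nonneg hτ hs) (abs_nonneg _))
      (ht j).nonneg
  refine (Finset.abs_sum_le_sum_abs _ _).trans ((Finset.sum_le_sum fun j _ ↦ this j).trans ?_)
  simp

/-- At the real frequency X the reduced form is exactly m²; the complex shift costs a factor s. This
keeps Q near the positive axis. -/
theorem norm_qsym_near {lam0 M0 : ℝ} (h : Admissible lam0 M0 A) (hlam : 0 < lam0)
    (hb : ∀ j k, BddLip B (bco A j k)) (hτ : 0 ≤ τ) (hs : 0 ≤ s) (hs1 : s ≤ 1) (hγ : ‖γ‖ ≤ 1)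
    (y : ℝ) : ‖qsym A (cfreq τ s γ X) y - (symbolM A X y : ℂ) ^ 2‖ ≤
      d * (d * (B * (s * (τ + ‖X‖) ^ 2))) := by
  rw [← Complex.ofReal_pow, h.symbolM_sq hlam]
  push_cast
  unfold qsym
  rw [← Finset.sum_sub_distrib]
  refine norm_sum_le_card fun j ↦ ?_
  rw [← Finset.sum_sub_distrib]
  refine norm_sum_le_card fun k ↦ ?_
  rw [mul_assoc, ← mul_sub, norm_mul, Complex.norm_real]
  exact mul_le_mul ((hb j k).1 y) (norm_cfreq_mul_sub_le hτ hs hs1 hγ j k) (norm_nonneg _)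
    (hb j k).nonneg

end bounds

end Carleman

end

/-! ### The tangential Fourier transform of test functions. -/

noncomputable section

namespace Carleman

open MeasureTheory Set Filter Topology FourierTransform

variable {d : ℕ}

/-- Smooth functions with compact support. -/
structure Test {E : Type*} [NormedAddCommGroup E] [NormedSpace ℝ E] (f : E → ℂ) : Prop where
  smooth : ContDiff ℝ (⊤ : ℕ∞) f
  supp : HasCompactSupport f

theorem Test.slice {W : Spc d → ℂ} (hW : Test W) (y : ℝ) : Test (fun x : Tan d ↦ W (x, y)) := by
  refine ⟨hW.smooth.comp (contDiff_id.prodMk contDiff_const), ?_⟩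
  refine HasCompactSupport.of_support_subset_isCompact (hW.supp.isCompact.image continuous_fst) ?_
  intro x hx
  exact ⟨(x, y), subset_tsupport _ hx, rfl⟩

theorem pd_eq_fderiv {W : Spc d → ℂ} (hW : ContDiff ℝ (⊤ : ℕ∞) W) (i : Fin (d + 1)) :
    pd i W = fun p ↦ fderiv ℝ W p (basisVec i) :=
  funext fun p ↦ (hW.differentiable (by simp) p).lineDeriv_eq_fderiv

theorem contDiff_pd {W : Spc d → ℂ} (hW : ContDiff ℝ (⊤ : ℕ∞) W) (i : Fin (d + 1)) :
    ContDiff ℝ (⊤ : ℕ∞) (pd i W) := by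
  rw [pd_eq_fderiv hW]
  exact (hW.fderiv_right (by simp)).clm_apply contDiff_const

theorem Test.pd {W : Spc d → ℂ} (hW : Test W) (i : Fin (d + 1)) : Test (pd i W) := by
  refine ⟨contDiff_pd hW.smooth i, ?_⟩
  rw [pd_eq_fderiv hW.smooth]
  exact hW.supp.fderiv_apply ℝ _

theorem basisVec_last : basisVec (Fin.last d) = ((0, 1) : Spc d) := by
  simp [basisVec]

theorem basisVec_castSucc (j : Fin d) :
    basisVec j.castSucc = ((EuclideanSpace.single j (1 : ℝ), 0) : Spc d) := by
  simp [basisVec]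

theorem hasDerivAt_normal {W : Spc d → ℂ} (hW : ContDiff ℝ (⊤ : ℕ∞) W) (x : Tan d) (y : ℝ) :
    HasDerivAt (fun y ↦ W (x, y)) (Carleman.pd (Fin.last d) W (x, y)) y := by
  have h1 : HasFDerivAt W (fderiv ℝ W (x, y)) (x, y) :=
    (hW.differentiable (by simp) _).hasFDerivAt
  have h2 : HasDerivAt (fun y : ℝ ↦ ((x, y) : Spc d)) (0, 1) y :=
    (hasDerivAt_const y x).prodMk (hasDerivAt_id y)
  rw [pd_eq_fderiv hW, basisVec_last]
  exact h1.comp_hasDerivAt y h2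

theorem pd_castSucc_eq_tpd (W : Spc d → ℂ) (j : Fin d) (x : Tan d) (y : ℝ) :
    Carleman.pd j.castSucc W (x, y) = tpd j (fun x ↦ W (x, y)) x := by
  unfold Carleman.pd tpd
  rw [basisVec_castSucc]
  simp [lineDeriv]

/-- The Fourier transform in the tangential variables. -/
def fou (W : Spc d → ℂ) (ξ : Tan d) (y : ℝ) : ℂ := 𝓕 (fun x : Tan d ↦ W (x, y)) ξ

theorem fourier_tpd {g : Tan d → ℂ} (hg : Test g) (j : Fin d) (ξ : Tan d) :
    𝓕 (tpd j g) ξ = 2 * Real.pi * Complex.I * ξ j * 𝓕 g ξ := by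
  have h := congrArg (fun F : SchwartzMap (Tan d) ℂ ↦ F ξ) (SchwartzMap.fourier_lineDerivOp_eq
    (hg.supp.toSchwartzMap hg.smooth) (EuclideanSpace.single j (1 : ℝ)))
  have ht : (fun x : Tan d ↦ inner ℝ x (EuclideanSpace.single j (1 : ℝ))).HasTemperateGrowth :=
    ((innerSL ℝ).flip (EuclideanSpace.single j (1 : ℝ))).hasTemperateGrowth
  simp only [SchwartzMap.fourier_coe, smul_apply,
    SchwartzMap.smulLeftCLM_apply_apply ht] at h
  have e1 : ⇑(LineDeriv.lineDerivOp (EuclideanSpace.single j (1 : ℝ))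
      (hg.supp.toSchwartzMap hg.smooth)) = tpd j g := by
    funext x; rw [SchwartzMap.lineDerivOp_apply]; rfl
  rw [e1] at h
  rw [h]
  have e2 : ⇑(hg.supp.toSchwartzMap hg.smooth) = g := rfl
  rw [e2, EuclideanSpace.inner_single_right]
  simp
  ring

theorem Test.integrable {g : Tan d → ℂ} (hg : Test g) : Integrable g :=
  hg.smooth.continuous.integrable_of_hasCompactSupport hg.supp

/-- Plancherel's identity for test functions. -/
theorem plancherel {g : Tan d → ℂ} (hg : Test g) :
    ∫⁻ ξ, ‖𝓕 g ξ‖ₑ ^ 2 = ∫⁻ x, ‖g x‖ₑ ^ 2 := by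
  have h := SchwartzMap.integral_norm_sq_fourier (hg.supp.toSchwartzMap hg.smooth)
  have e : ∀ z : ℂ, ‖z‖ₑ ^ 2 = ENNReal.ofReal (‖z‖ ^ 2) := fun z ↦ by
    rw [ENNReal.ofReal_pow (norm_nonneg _), ofReal_norm]
  have hi : ∀ f : SchwartzMap (Tan d) ℂ, Integrable (fun x ↦ ‖f x‖ ^ 2) := fun f ↦ by
    have := (f.memLp 2 volume).integrable_norm_pow (by norm_num)
    simpa using this
  have h1 := ofReal_integral_eq_lintegral_ofReal (hi (𝓕 (hg.supp.toSchwartzMap hg.smooth)))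
    (Eventually.of_forall fun y ↦ by positivity)
  have h2 := ofReal_integral_eq_lintegral_ofReal (hi (hg.supp.toSchwartzMap hg.smooth))
    (Eventually.of_forall fun y ↦ by positivity)
  rw [h, h2] at h1
  simp_rw [e]
  exact h1.symm

theorem Test.exists_ball {W : Spc d → ℂ} (hW : Test W) :
    ∃ R : ℝ, ∀ x y, W (x, y) ≠ 0 → x ∈ Metric.closedBall (0 : Tan d) R := by
  obtain ⟨R, hR⟩ := (hW.supp.isCompact.image continuous_fst).isBounded.subset_closedBall
    (0 : Tan d)
  exact ⟨R, fun x y h ↦ hR ⟨(x, y), subset_tsupport _ h, rfl⟩⟩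

/-- Integrating over one ball valid for all y makes continuity in (ξ, y) and differentiation under
the integral statements about compact domains. -/
theorem fou_eq_setIntegral {W : Spc d → ℂ} {R : ℝ}
    (hR : ∀ x y, W (x, y) ≠ 0 → x ∈ Metric.closedBall (0 : Tan d) R) (ξ : Tan d) (y : ℝ) :
    fou W ξ y = ∫ x in Metric.closedBall (0 : Tan d) R,
      Complex.exp (((-2 * Real.pi * inner ℝ x ξ : ℝ) : ℂ) * Complex.I) * W (x, y) := by
  unfold fou
  rw [Real.fourier_eq']
  simp only [smul_eq_mul]
  refine (setIntegral_eq_integral_of_forall_compl_eq_zero fun x hx ↦ ?_).symm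
  rw [mul_eq_zero]
  right
  by_contra h
  exact hx (hR x y h)

theorem continuous_fou {W : Spc d → ℂ} (hW : Test W) :
    Continuous (fun q : Tan d × ℝ ↦ fou W q.1 q.2) := by
  obtain ⟨R, hR⟩ := hW.exists_ball
  simp_rw [fou_eq_setIntegral hR]
  refine continuous_parametric_integral_of_continuous (f := fun (q : Tan d × ℝ) (x : Tan d) ↦
    Complex.exp (((-2 * Real.pi * inner ℝ x q.1 : ℝ) : ℂ) * Complex.I) * W (x, q.2)) ?_
    (isCompact_closedBall _ _)
  have := hW.smooth.continuous
  unfold Function.uncurry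
  fun_prop

theorem hasDerivAt_fou {W : Spc d → ℂ} (hW : Test W) (ξ : Tan d) (y : ℝ) :
    HasDerivAt (fou W ξ) (fou (pd (Fin.last d) W) ξ y) y := by
  obtain ⟨R, hR⟩ := hW.exists_ball
  obtain ⟨R', hR'⟩ := (hW.pd (Fin.last d)).exists_ball
  have hm : ∀ x y, W (x, y) ≠ 0 → x ∈ Metric.closedBall (0 : Tan d) (max R R') := fun x y h ↦
    Metric.closedBall_subset_closedBall (le_max_left _ _) (hR x y h)
  have hm' : ∀ x y, pd (Fin.last d) W (x, y) ≠ 0 → x ∈ Metric.closedBall (0 : Tan d) (max R R') :=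
    fun x y h ↦ Metric.closedBall_subset_closedBall (le_max_right _ _) (hR' x y h)
  have cW := hW.smooth.continuous
  have cW' := (hW.pd (Fin.last d)).smooth.continuous
  obtain ⟨C, hC⟩ := (hW.pd (Fin.last d)).supp.exists_bound_of_continuous cW'
  rw [show fou W ξ = fun y ↦ fou W ξ y from rfl]
  simp_rw [fou_eq_setIntegral hm, fou_eq_setIntegral hm']
  have key := hasDerivAt_integral_of_dominated_loc_of_deriv_le
    (μ := volume.restrict (Metric.closedBall (0 : Tan d) (max R R'))) (x₀ := y) (s := univ)
    (F := fun y x ↦ Complex.exp (((-2 * Real.pi * inner ℝ x ξ : ℝ) : ℂ) * Complex.I) * W (x, y))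
    (F' := fun y x ↦ Complex.exp (((-2 * Real.pi * inner ℝ x ξ : ℝ) : ℂ) * Complex.I) *
      pd (Fin.last d) W (x, y)) (bound := fun _ ↦ C) univ_mem
    (Eventually.of_forall fun y ↦ Continuous.aestronglyMeasurable (by fun_prop))
    ?_ (Continuous.aestronglyMeasurable (by fun_prop)) ?_ ?_ ?_
  · exact key.2
  · exact ContinuousOn.integrableOn_compact (isCompact_closedBall _ _)
      (Continuous.continuousOn (by fun_prop))
  · refine Eventually.of_forall fun x y _ ↦ ?_
    rw [norm_mul, Complex.norm_exp_ofReal_mul_I, one_mul]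
    exact hC _
  · exact integrableOn_const (isCompact_closedBall _ _).measure_lt_top.ne
  · exact Eventually.of_forall fun x y _ ↦ (hasDerivAt_normal hW.smooth x y).const_mul _

theorem fou_pd_castSucc {W : Spc d → ℂ} (hW : Test W) (j : Fin d) (ξ : Tan d) (y : ℝ) :
    fou (pd j.castSucc W) ξ y = 2 * Real.pi * Complex.I * ξ j * fou W ξ y := by
  unfold fou
  rw [← fourier_tpd (hW.slice y), show (fun x ↦ pd j.castSucc W (x, y)) =
    tpd j (fun x ↦ W (x, y)) from funext fun x ↦ pd_castSucc_eq_tpd W j x y]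

theorem fou_plancherel {W : Spc d → ℂ} (hW : Test W) (y : ℝ) :
    ∫⁻ ξ, ‖fou W ξ y‖ₑ ^ 2 = ∫⁻ x, ‖W (x, y)‖ₑ ^ 2 := plancherel (hW.slice y)

end Carleman

end

/-! ### The seminorm of order 1/2 as a Fourier multiplier. -/

noncomputable section

namespace Carleman

open MeasureTheory Set Filter Topology FourierTransform

variable {d : ℕ}

/-- The integrand of the multiplier of the seminorm of order `1/2`. -/
def halfKer (X h : Tan d) : ENNReal :=
  ENNReal.ofReal (‖1 - Complex.exp ((inner ℝ h X : ℝ) * Complex.I)‖ ^ 2 / ‖h‖ ^ (d + 1))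

/-- The Fourier multiplier of the seminorm of order `1/2`. -/
def halfMul (X : Tan d) : ENNReal := ∫⁻ h, halfKer X h

theorem measurable_halfKer_smul :
    Measurable (fun p : Tan d × Tan d ↦ halfKer ((2 * Real.pi) • p.2) p.1) := by
  unfold halfKer
  fun_prop

theorem measurable_halfKer_right (X : Tan d) : Measurable (fun h ↦ halfKer X h) := by
  unfold halfKer
  fun_prop

theorem halfKer_isometry (R : Tan d ≃ₗᵢ[ℝ] Tan d) (X h : Tan d) :
    halfKer (R X) (R h) = halfKer X h := by
  simp [halfKer]

/-- The reflection in the hyperplane orthogonal to X − Y exchanges X and Y and preserves both the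
measure and the kernel. -/
theorem halfMul_eq_of_norm_eq {X Y : Tan d} (h : ‖X‖ = ‖Y‖) : halfMul X = halfMul Y := by
  set R : Tan d ≃ₗᵢ[ℝ] Tan d := (ℝ ∙ (X - Y))ᗮ.reflection with hR
  have hRX : R X = Y := Submodule.reflection_sub h
  unfold halfMul
  rw [← hRX]
  have e := R.measurePreserving.lintegral_comp (measurable_halfKer_right (R X))
  rw [← e]
  simp_rw [halfKer_isometry]

/-- In the substitution h ↦ rh the kernel contributes r^{d+1} and the volume r^{-d}, so one power of
r remains. -/
theorem halfMul_smul {r : ℝ} (hr : 0 < r) (X : Tan d) :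
    halfMul (r • X) = ENNReal.ofReal r * halfMul X := by
  have h1 : ∀ h, halfKer (r • X) h = ENNReal.ofReal (r ^ (d + 1)) * halfKer X (r • h) := fun h ↦ by
    unfold halfKer
    rw [← ENNReal.ofReal_mul (by positivity)]
    congr 1
    rw [inner_smul_left, inner_smul_right, norm_smul, Real.norm_of_nonneg hr.le, mul_pow]
    simp only [conj_trivial]
    by_cases hh : ‖h‖ = 0
    · rw [hh, zero_pow (by simp)]; simp
    · field_simp
  have h2 : ∫⁻ h, halfKer X (r • h) = ENNReal.ofReal ((r ^ d)⁻¹) * halfMul X := by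
    have h3 := lintegral_map (μ := (volume : Measure (Tan d))) (measurable_halfKer_right X)
      (measurable_const_smul r)
    rw [Measure.map_addHaar_smul _ hr.ne', lintegral_smul_measure] at h3
    rw [← h3, finrank_euclideanSpace_fin, abs_of_pos (by positivity)]
    rfl
  unfold halfMul at *
  simp_rw [h1]
  rw [lintegral_const_mul' _ _ ENNReal.ofReal_ne_top, h2,
    ← mul_assoc, ← ENNReal.ofReal_mul (by positivity)]
  congr 2
  field_simp
  ring

/-- From |1 − e^{iθ}|² ≤ min(θ², 4), polar coordinates reduce convergence to that of the integral of
min(r², 4)/r² ≤ 5/(1 + r²). -/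
theorem halfMul_lt_top (hd : 1 ≤ d) {X : Tan d} (hX : ‖X‖ ≤ 1) : halfMul X < ⊤ := by
  have : Nontrivial (Tan d) := by
    have : Nonempty (Fin d) := ⟨⟨0, hd⟩⟩
    infer_instance
  obtain ⟨f, hf⟩ : ∃ f : ℝ → ℝ, f = fun r ↦ min (r ^ 2) 4 / r ^ (d + 1) := ⟨_, rfl⟩
  have hi : Integrable (fun h : Tan d ↦ f ‖h‖) := by
    rw [integrable_fun_norm_addHaar]
    have hb : IntegrableOn (fun y : ℝ ↦ 5 * (1 + y ^ 2)⁻¹) (Ioi 0) :=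
      (integrable_inv_one_add_sq.const_mul 5).integrableOn
    refine Integrable.mono' hb ?_ ?_
    · rw [hf]
      exact (Measurable.aestronglyMeasurable (by fun_prop))
    · rw [ae_restrict_iff' measurableSet_Ioi]
      refine Eventually.of_forall fun y hy ↦ ?_
      have hy : 0 < y := hy
      rw [finrank_euclideanSpace_fin, hf]
      obtain ⟨e, rfl⟩ : ∃ e, d = e + 1 := ⟨d - 1, by omega⟩
      have h0 : 0 ≤ min (y ^ 2) 4 := le_min (by positivity) (by norm_num)
      simp only [add_tsub_cancel_right, smul_eq_mul]
      rw [Real.norm_of_nonneg (by positivity)]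
      have e1 : y ^ e * (min (y ^ 2) 4 / y ^ (e + 1 + 1)) = min (y ^ 2) 4 / y ^ 2 := by
        field_simp
        ring
      rw [e1, ← div_eq_mul_inv, div_le_div_iff₀ (by positivity) (by positivity)]
      nlinarith [min_le_left (y ^ 2) 4, min_le_right (y ^ 2) 4, sq_nonneg y]
  refine lt_of_le_of_lt (lintegral_mono fun h ↦ ?_)
    ((hasFiniteIntegral_iff_ofReal (Eventually.of_forall fun h ↦ ?_)).1 hi.2)
  · unfold halfKer
    refine ENNReal.ofReal_le_ofReal ?_
    rw [hf]
    refine div_le_div_of_nonneg_right (le_min ?_ ?_) (by positivity)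
    · refine pow_le_pow_left₀ (norm_nonneg _) ?_ 2
      have h1 := Real.norm_exp_I_mul_ofReal_sub_one_le (x := inner ℝ h X)
      rw [norm_sub_rev, mul_comm]
      refine h1.trans ((norm_inner_le_norm h X).trans ?_)
      exact mul_le_of_le_one_right (norm_nonneg _) hX
    · have h1 : ‖1 - Complex.exp ((inner ℝ h X : ℝ) * Complex.I)‖ ≤ 2 := by
        refine (norm_sub_le _ _).trans ?_
        rw [Complex.norm_exp_ofReal_mul_I, norm_one]
        norm_num
      exact (pow_le_pow_left₀ (norm_nonneg _) h1 2).trans (by norm_num)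
  · rw [hf]
    simp only [Pi.zero_apply]
    have : 0 ≤ min (‖h‖ ^ 2) 4 := le_min (by positivity) (by norm_num)
    positivity

/-- Were the integral zero, continuity would give e^{ih·X} = 1 for every h; at h = πX/‖X‖² the value
is −1. -/
theorem halfMul_pos {X : Tan d} (hX : X ≠ 0) : halfMul X ≠ 0 := by
  intro h
  unfold halfMul at h
  rw [lintegral_eq_zero_iff (measurable_halfKer_right X)] at h
  have h1 : (fun h : Tan d ↦ 1 - Complex.exp ((inner ℝ h X : ℝ) * Complex.I)) =ᵐ[volume]
      fun _ ↦ 0 := by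
    filter_upwards [h] with k hk
    by_cases hk0 : k = 0
    · simp [hk0]
    · simp only [halfKer, Pi.zero_apply, ENNReal.ofReal_eq_zero] at hk
      have hp : 0 < ‖k‖ ^ (d + 1) := by positivity
      rw [div_le_iff₀ hp, zero_mul] at hk
      have := le_antisymm hk (sq_nonneg _)
      exact norm_eq_zero.1 (pow_eq_zero_iff (two_ne_zero) |>.1 this)
  rw [Continuous.ae_eq_iff_eq volume (by fun_prop) continuous_const] at h1
  have h2 := congrFun h1 ((Real.pi / ‖X‖ ^ 2) • X)
  have hn : ‖X‖ ≠ 0 := norm_ne_zero_iff.2 hX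
  rw [inner_smul_left, real_inner_self_eq_norm_sq] at h2
  simp only [conj_trivial] at h2
  rw [div_mul_cancel₀ _ (by positivity), Complex.exp_pi_mul_I] at h2
  norm_num at h2

/-- The multiplier of the seminorm of order `1/2` is a multiple of the norm. -/
theorem exists_halfMul_eq (hd : 1 ≤ d) :
    ∃ c : ℝ, 0 < c ∧ ∀ X : Tan d, halfMul X = ENNReal.ofReal (c * ‖X‖) := by
  obtain ⟨e, he⟩ : ∃ e : Tan d, ‖e‖ = 1 :=
    ⟨EuclideanSpace.single ⟨0, hd⟩ 1, by simp⟩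
  have he0 : e ≠ 0 := by rintro rfl; simp at he
  have hfin := (halfMul_lt_top hd he.le).ne
  refine ⟨(halfMul e).toReal, ENNReal.toReal_pos (halfMul_pos he0) hfin, fun X ↦ ?_⟩
  by_cases hX : X = 0
  · simp [hX, halfMul, halfKer]
  · have hn : 0 < ‖X‖ := norm_pos_iff.2 hX
    rw [halfMul_eq_of_norm_eq (Y := ‖X‖ • e) (by rw [norm_smul, he]; simp), halfMul_smul hn,
      ENNReal.ofReal_mul ENNReal.toReal_nonneg, ENNReal.ofReal_toReal hfin, mul_comm]

theorem Test.continuous_fourier {g : Tan d → ℂ} (hg : Test g) : Continuous (𝓕 g) :=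
  (𝓕 (hg.supp.toSchwartzMap hg.smooth)).continuous

theorem Test.translate {g : Tan d → ℂ} (hg : Test g) (h : Tan d) :
    Test (fun x ↦ g x - g (x + h)) := by
  have h1 : Test (fun x ↦ g (x + h)) :=
    ⟨hg.smooth.comp (contDiff_id.add contDiff_const),
      hg.supp.comp_homeomorph (Homeomorph.addRight h)⟩
  exact ⟨hg.smooth.sub h1.smooth, hg.supp.sub h1.supp⟩

theorem fourier_translate {g : Tan d → ℂ} (hg : Test g) (h ξ : Tan d) :
    𝓕 (fun x ↦ g x - g (x + h)) ξ =
      (1 - Complex.exp ((inner ℝ h ((2 * Real.pi) • ξ) : ℝ) * Complex.I)) * 𝓕 g ξ := by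
  have h1 : Integrable (fun x ↦ g (x + h)) := hg.integrable.comp_add_right h
  have h2 : 𝓕 (fun x ↦ g (x + h)) ξ =
      Complex.exp ((inner ℝ h ((2 * Real.pi) • ξ) : ℝ) * Complex.I) * 𝓕 g ξ := by
    have := congrFun (VectorFourier.fourierIntegral_comp_add_right Real.fourierChar
      (volume : Measure (Tan d)) (innerₗ (Tan d)) g h) ξ
    refine Eq.trans this ?_
    rw [Circle.smul_def, Real.fourierChar_apply, inner_smul_right]
    rfl
  rw [sub_mul, one_mul, ← h2, Real.fourier_eq, Real.fourier_eq, Real.fourier_eq,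
    ← integral_sub]
  · simp_rw [smul_sub]
  · exact (Real.fourierIntegral_convergent_iff ξ).2 hg.integrable
  · exact (Real.fourierIntegral_convergent_iff ξ).2 h1

/-- Substitute x' = x + h, exchange the integrals by Tonelli, and apply Plancherel in x to each
difference g − g(· + h). -/
theorem halfSq_eq_lintegral {g : Tan d → ℂ} (hg : Test g) :
    halfSq g = ∫⁻ ξ, ‖𝓕 g ξ‖ₑ ^ 2 * halfMul ((2 * Real.pi) • ξ) := by
  have cg := hg.smooth.continuous
  have h1 : halfSq g = ∫⁻ h : Tan d, ∫⁻ x : Tan d,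
      ENNReal.ofReal (‖g x - g (x + h)‖ ^ 2 / ‖h‖ ^ (d + 1)) := by
    unfold halfSq
    refine Eq.trans ?_ (lintegral_lintegral_swap
      (Measurable.aemeasurable (by unfold Function.uncurry; fun_prop)))
    refine lintegral_congr fun x ↦ ?_
    refine (lintegral_add_left_eq_self (μ := (volume : Measure (Tan d))) (fun x' ↦
      ENNReal.ofReal (‖g x - g x'‖ ^ 2 / ‖x - x'‖ ^ (d + 1))) x).symm.trans ?_
    refine lintegral_congr fun h ↦ ?_
    rw [sub_add_cancel_left, norm_neg]
  have h2 : ∀ h : Tan d, ∫⁻ x : Tan d, ENNReal.ofReal (‖g x - g (x + h)‖ ^ 2 / ‖h‖ ^ (d + 1)) =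
      ∫⁻ ξ, ‖𝓕 g ξ‖ₑ ^ 2 * halfKer ((2 * Real.pi) • ξ) h := fun h ↦ by
    have e : ∀ z : ℂ, ‖z‖ₑ ^ 2 = ENNReal.ofReal (‖z‖ ^ 2) := fun z ↦ by
      rw [ENNReal.ofReal_pow (norm_nonneg _), ofReal_norm]
    have e1 : ∀ x, ENNReal.ofReal (‖g x - g (x + h)‖ ^ 2 / ‖h‖ ^ (d + 1)) =
        ENNReal.ofReal ((‖h‖ ^ (d + 1))⁻¹) * ‖g x - g (x + h)‖ₑ ^ 2 := fun x ↦ by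
      rw [e, ← ENNReal.ofReal_mul (by positivity), div_eq_inv_mul]
    simp_rw [e1]
    have cF := hg.continuous_fourier
    rw [lintegral_const_mul' _ _ ENNReal.ofReal_ne_top, ← plancherel (hg.translate h),
      ← lintegral_const_mul' _ _ ENNReal.ofReal_ne_top]
    refine lintegral_congr fun ξ ↦ ?_
    rw [fourier_translate hg, enorm_mul, mul_pow, e (1 - _)]
    unfold halfKer
    rw [div_eq_mul_inv, ENNReal.ofReal_mul (sq_nonneg _)]
    ring
  rw [h1]
  simp_rw [h2]
  have cF := hg.continuous_fourier
  rw [lintegral_lintegral_swap]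
  · refine lintegral_congr fun ξ ↦ ?_
    rw [lintegral_const_mul _ (measurable_halfKer_right _)]
    rfl
  · refine Measurable.aemeasurable ?_
    unfold Function.uncurry
    refine Measurable.mul ((cF.enorm.measurable.pow_const 2).comp measurable_snd) ?_
    exact measurable_halfKer_smul

/-- The seminorm of order `1/2` in Fourier variables. -/
theorem exists_halfSq_eq (hd : 1 ≤ d) :
    ∃ c : ℝ, 0 < c ∧ ∀ g : Tan d → ℂ, Test g →
      halfSq g = ENNReal.ofReal c * ∫⁻ ξ, ENNReal.ofReal (2 * Real.pi * ‖ξ‖) * ‖𝓕 g ξ‖ₑ ^ 2 := by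
  obtain ⟨c, hc, h⟩ := exists_halfMul_eq hd
  refine ⟨c, hc, fun g hg ↦ ?_⟩
  have cF := hg.continuous_fourier
  rw [halfSq_eq_lintegral hg, ← lintegral_const_mul' _ _ ENNReal.ofReal_ne_top]
  refine lintegral_congr fun ξ ↦ ?_
  rw [h, norm_smul, Real.norm_of_nonneg (by positivity), ENNReal.ofReal_mul hc.le]
  ring

end Carleman

end

/-! ### Reduction to functions with compact support. -/

noncomputable section

namespace Carleman

open MeasureTheory Set Filter Topology FourierTransform

variable {d : ℕ}

/-- Multiply by a bump function equal to 1 near K; off K, inside Ω, w already vanishes locally.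
Agreement as germs is demanded so that all derivatives agree too, whatever w does outside Ω. -/
theorem exists_cutoff {w : Spc d → ℂ} (hw : ContDiff ℝ (⊤ : ℕ∞) w) {Ω K : Set (Spc d)}
    (hΩ : IsOpen Ω) (hK : IsCompact K) (h0 : ∀ p ∈ Ω, p ∉ K → w p = 0) :
    ∃ W : Spc d → ℂ, Test W ∧ ∀ p ∈ Ω, W =ᶠ[𝓝 p] w := by
  obtain ⟨R, hR0, hR⟩ := hK.isBounded.subset_ball_lt 0 (0 : Spc d)
  obtain ⟨f, hf⟩ : ∃ f : ContDiffBump (0 : Spc d), f.rIn = R :=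
    ⟨⟨R, R + 1, hR0, by linarith⟩, rfl⟩
  refine ⟨fun p ↦ f p • w p, ⟨f.contDiff.smul hw, ?_⟩, fun p hp ↦ ?_⟩
  · exact f.hasCompactSupport.smul_right
  · by_cases hpK : p ∈ K
    · filter_upwards [f.eventuallyEq_one_of_mem_ball (hf ▸ hR hpK)] with q hq
      rw [hq]
      simp
    · filter_upwards [hΩ.mem_nhds hp, hK.isClosed.isOpen_compl.mem_nhds hpK] with q hq hqK
      rw [h0 q hq hqK, smul_zero]

section Agreement

variable {Ω : Set (Spc d)} {W w : Spc d → ℂ}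

theorem eventuallyEq_pd (h : ∀ p ∈ Ω, W =ᶠ[𝓝 p] w) (i : Fin (d + 1)) :
    ∀ p ∈ Ω, pd i W =ᶠ[𝓝 p] pd i w := fun p hp ↦ by
  filter_upwards [(h p hp).eventuallyEq_nhds] with q hq
  exact hq.lineDeriv_eq

theorem eqOn_closure (h : ∀ p ∈ Ω, W =ᶠ[𝓝 p] w) (hW : Continuous W) (hw : Continuous w) :
    EqOn W w (closure Ω) :=
  EqOn.closure (fun p hp ↦ (h p hp).eq_of_nhds) hW hw

theorem sqD_eqOn (k : ℕ) (h : ∀ p ∈ Ω, W =ᶠ[𝓝 p] w) : EqOn (sqD k W) (sqD k w) Ω := by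
  induction k generalizing W w with
  | zero => intro p hp; simp [sqD, (h p hp).eq_of_nhds]
  | succ k ih =>
    intro p hp
    exact Finset.sum_congr rfl fun i _ ↦ ih (eventuallyEq_pd h i) hp

/-- Traces are taken on y = 0, outside the open half space; there the agreement follows by
continuity of the derivatives. -/
theorem sqD_eqOn_closure (k : ℕ) (h : ∀ p ∈ Ω, W =ᶠ[𝓝 p] w) (hW : ContDiff ℝ (⊤ : ℕ∞) W)
    (hw : ContDiff ℝ (⊤ : ℕ∞) w) : EqOn (sqD k W) (sqD k w) (closure Ω) := by
  induction k generalizing W w with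
  | zero => intro p hp; simp [sqD, eqOn_closure h hW.continuous hw.continuous hp]
  | succ k ih =>
    intro p hp
    exact Finset.sum_congr rfl fun i _ ↦
      ih (eventuallyEq_pd h i) (contDiff_pd hW i) (contDiff_pd hw i) hp

theorem contDiff_phase (α β s : ℝ) (γ : Tan d) : ContDiff ℝ (⊤ : ℕ∞) (phase α β s γ) := by
  unfold phase
  have h1 : ContDiff ℝ (⊤ : ℕ∞) (fun p : Spc d ↦ inner ℝ γ p.1) :=
    contDiff_const.inner ℝ contDiff_fst
  have h2 : ContDiff ℝ (⊤ : ℕ∞) (fun p : Spc d ↦ p.2) := contDiff_snd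
  exact ((contDiff_const.mul h2).add ((contDiff_const.mul (h2.pow 2)).div_const 2)).add
    (contDiff_const.mul h1)

theorem contDiff_weight (τ α β s : ℝ) (γ : Tan d) :
    ContDiff ℝ (⊤ : ℕ∞) (fun p : Spc d ↦ Real.exp (τ * phase α β s γ p)) :=
  (contDiff_const.mul (contDiff_phase α β s γ)).exp

theorem lhsSide_congr (τ α β s : ℝ) (γ : Tan d) (hΩ : MeasurableSet Ω)
    (hc : ∀ x : Tan d, ((x, 0) : Spc d) ∈ closure Ω) (h : ∀ p ∈ Ω, W =ᶠ[𝓝 p] w)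
    (hW : ContDiff ℝ (⊤ : ℕ∞) W) (hw : ContDiff ℝ (⊤ : ℕ∞) w) :
    lhsSide τ Ω (phase α β s γ) W = lhsSide τ Ω (phase α β s γ) w := by
  have hE := contDiff_weight τ α β s γ
  have hg : ∀ p ∈ Ω, (fun q ↦ Real.exp (τ * phase α β s γ q) • W q) =ᶠ[𝓝 p]
      fun q ↦ Real.exp (τ * phase α β s γ q) • w q := fun p hp ↦ by
    filter_upwards [h p hp] with q hq
    rw [hq]
  have h1 : ∀ k, ∫⁻ p in Ω, sqD k W p * ENNReal.ofReal (Real.exp (2 * τ * phase α β s γ p)) =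
      ∫⁻ p in Ω, sqD k w p * ENNReal.ofReal (Real.exp (2 * τ * phase α β s γ p)) := fun k ↦
    setLIntegral_congr_fun hΩ fun p hp ↦ by
      rw [sqD_eqOn k h hp]
  have h2 : ∀ k x, sqD k W (x, 0) = sqD k w (x, 0) := fun k x ↦
    sqD_eqOn_closure k h hW hw (hc x)
  have h3 : ∀ x, W (x, 0) = w (x, 0) := fun x ↦
    eqOn_closure h hW.continuous hw.continuous (hc x)
  have h4 : ∀ i x, pd i (fun q ↦ Real.exp (τ * phase α β s γ q) • W q) (x, 0) =
      pd i (fun q ↦ Real.exp (τ * phase α β s γ q) • w q) (x, 0) := fun i x ↦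
    eqOn_closure (eventuallyEq_pd hg i) (contDiff_pd (hE.smul hW) i).continuous
      (contDiff_pd (hE.smul hw) i).continuous (hc x)
  unfold lhsSide
  simp_rw [h1, h2, h3, h4]

theorem divGrad_eqOn (A : Coeff d) (h : ∀ p ∈ Ω, W =ᶠ[𝓝 p] w) :
    EqOn (divGrad A W) (divGrad A w) Ω := fun p hp ↦ by
  unfold divGrad
  refine Finset.sum_congr rfl fun i _ ↦ ?_
  refine EventuallyEq.lineDeriv_eq ?_
  have : ∀ᶠ q in 𝓝 p, ∀ j, pd j W q = pd j w q :=
    eventually_all.2 fun j ↦ eventuallyEq_pd h j p hp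
  filter_upwards [this] with q hq
  simp_rw [hq]

theorem conormal_congr (A : Coeff d) (hc : ∀ x : Tan d, ((x, 0) : Spc d) ∈ closure Ω)
    (h : ∀ p ∈ Ω, W =ᶠ[𝓝 p] w) (hW : ContDiff ℝ (⊤ : ℕ∞) W) (hw : ContDiff ℝ (⊤ : ℕ∞) w)
    (x : Tan d) : conormal A W x = conormal A w x := by
  have h4 : ∀ i, pd i W (x, 0) = pd i w (x, 0) := fun i ↦
    eqOn_closure (eventuallyEq_pd h i) (contDiff_pd hW i).continuous
      (contDiff_pd hw i).continuous (hc x)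
  unfold conormal
  simp_rw [h4]

end Agreement

theorem mem_closure_pos (x : Tan d) (y : ℝ) (hy : 0 ≤ y) :
    ((x, y) : Spc d) ∈ closure {p : Spc d | 0 < p.2} := by
  have : {p : Spc d | 0 < p.2} = univ ×ˢ Ioi 0 := by ext; simp
  rw [this, closure_prod_eq, closure_Ioi]
  simpa using hy

theorem mem_closure_neg (x : Tan d) (y : ℝ) (hy : y ≤ 0) :
    ((x, y) : Spc d) ∈ closure {p : Spc d | p.2 < 0} := by
  have : {p : Spc d | p.2 < 0} = univ ×ˢ Iio 0 := by ext; simp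
  rw [this, closure_prod_eq, closure_Iio]
  simpa using hy

theorem isOpen_pos : IsOpen {p : Spc d | 0 < p.2} := isOpen_lt continuous_const continuous_snd

theorem isOpen_neg : IsOpen {p : Spc d | p.2 < 0} := isOpen_lt continuous_snd continuous_const

/-- It is enough to prove the estimate for functions with compact support. -/
theorem exists_test_pair {r : ℝ} (hr : 0 < r) {wp wm : Spc d → ℂ} (hp : ContDiff ℝ (⊤ : ℕ∞) wp)
    (hm : ContDiff ℝ (⊤ : ℕ∞) wm)
    (hs : tsupport (glue wp wm) ⊆ Metric.closedBall 0 1 ×ˢ Icc (-r) r) :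
    ∃ Wp Wm : Spc d → ℂ, Test Wp ∧ Test Wm ∧ (∀ x y, r < y → Wp (x, y) = 0) ∧
      (∀ x y, y < -r → Wm (x, y) = 0) ∧
      (∀ αp αm β s τ γ, carlemanLHS αp αm β s τ γ wp wm = carlemanLHS αp αm β s τ γ Wp Wm) ∧
      (∀ Ap Am αp αm β s τ γ, carlemanRHS Ap Am αp αm β s τ γ wp wm =
        carlemanRHS Ap Am αp αm β s τ γ Wp Wm) := by
  have hK : IsCompact (Metric.closedBall (0 : Tan d) 1 ×ˢ Icc (-r) r) :=
    (isCompact_closedBall _ _).prod isCompact_Icc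
  -- The support hypothesis concerns only the glued function: it constrains wp above the interface
  -- and wm below it, and nothing else.
  have hz : ∀ p, p ∉ Metric.closedBall (0 : Tan d) 1 ×ˢ Icc (-r) r → glue wp wm p = 0 :=
    fun p h ↦ image_eq_zero_of_notMem_tsupport fun h' ↦ h (hs h')
  have hp0 : ∀ p ∈ {p : Spc d | 0 < p.2}, p ∉ Metric.closedBall (0 : Tan d) 1 ×ˢ Icc (-r) r →
      wp p = 0 := fun p h h' ↦ by
    have h : 0 < p.2 := h
    simpa [glue, indicator, h, h.le.not_gt] using hz p h'
  have hm0 : ∀ p ∈ {p : Spc d | p.2 < 0}, p ∉ Metric.closedBall (0 : Tan d) 1 ×ˢ Icc (-r) r →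
      wm p = 0 := fun p h h' ↦ by
    have h : p.2 < 0 := h
    simpa [glue, indicator, h, h.le.not_gt] using hz p h'
  obtain ⟨Wp, tWp, eWp⟩ := exists_cutoff hp isOpen_pos hK hp0
  obtain ⟨Wm, tWm, eWm⟩ := exists_cutoff hm isOpen_neg hK hm0
  have cp : ∀ x : Tan d, ((x, 0) : Spc d) ∈ closure {p : Spc d | 0 < p.2} :=
    fun x ↦ mem_closure_pos x 0 le_rfl
  have cm : ∀ x : Tan d, ((x, 0) : Spc d) ∈ closure {p : Spc d | p.2 < 0} :=
    fun x ↦ mem_closure_neg x 0 le_rfl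
  refine ⟨Wp, Wm, tWp, tWm, fun x y hy ↦ ?_, fun x y hy ↦ ?_, fun αp αm β s τ γ ↦ ?_,
    fun Ap Am αp αm β s τ γ ↦ ?_⟩
  · have hy' : ((x, y) : Spc d) ∈ {p : Spc d | 0 < p.2} := hr.trans hy
    rw [(eWp _ hy').eq_of_nhds]
    exact hp0 _ hy' fun h ↦ absurd h.2.2 hy.not_ge
  · have hy' : ((x, y) : Spc d) ∈ {p : Spc d | p.2 < 0} := hy.trans (by linarith)
    rw [(eWm _ hy').eq_of_nhds]
    exact hm0 _ hy' fun h ↦ absurd h.2.1 hy.not_ge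
  · unfold carlemanLHS
    rw [lhsSide_congr τ αp β s γ isOpen_pos.measurableSet cp eWp tWp.smooth hp,
      lhsSide_congr τ αm β s γ isOpen_neg.measurableSet cm eWm tWm.smooth hm]
  · have e0 : theta0 wp wm = theta0 Wp Wm := funext fun x ↦ by
      unfold theta0
      rw [eqOn_closure eWp tWp.smooth.continuous hp.continuous (cp x),
        eqOn_closure eWm tWm.smooth.continuous hm.continuous (cm x)]
    have e1 : theta1 Ap Am wp wm = theta1 Ap Am Wp Wm := funext fun x ↦ by
      unfold theta1
      rw [conormal_congr Ap cp eWp tWp.smooth hp, conormal_congr Am cm eWm tWm.smooth hm]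
    have i1 : ∫⁻ p in {p : Spc d | 0 < p.2}, ‖divGrad Ap wp p‖ₑ ^ 2 *
        ENNReal.ofReal (Real.exp (2 * τ * phase αp β s γ p)) =
        ∫⁻ p in {p : Spc d | 0 < p.2}, ‖divGrad Ap Wp p‖ₑ ^ 2 *
        ENNReal.ofReal (Real.exp (2 * τ * phase αp β s γ p)) :=
      setLIntegral_congr_fun isOpen_pos.measurableSet fun p h ↦ by
        rw [divGrad_eqOn Ap eWp h]
    have i2 : ∫⁻ p in {p : Spc d | p.2 < 0}, ‖divGrad Am wm p‖ₑ ^ 2 *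
        ENNReal.ofReal (Real.exp (2 * τ * phase αm β s γ p)) =
        ∫⁻ p in {p : Spc d | p.2 < 0}, ‖divGrad Am Wm p‖ₑ ^ 2 *
        ENNReal.ofReal (Real.exp (2 * τ * phase αm β s γ p)) :=
      setLIntegral_congr_fun isOpen_neg.measurableSet fun p h ↦ by
        rw [divGrad_eqOn Am eWm h]
    unfold carlemanRHS
    rw [e0, e1, i1, i2]

end Carleman

end

/-! ### Conjugation by the weight and the operator on the Fourier side. -/

noncomputable section

namespace Carleman

open MeasureTheory Set Filter Topology FourierTransform

variable {d : ℕ}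

/-- The function `e^{τφ} f`. -/
def cw (τ α β s : ℝ) (γ : Tan d) (f : Spc d → ℂ) (p : Spc d) : ℂ :=
  Real.exp (τ * phase α β s γ p) • f p

section Linear

theorem fourier_finset_sum {ι : Type*} (S : Finset ι) {F : ι → Tan d → ℂ} (c : ι → ℂ)
    (hF : ∀ i ∈ S, Integrable (F i)) (ξ : Tan d) :
    𝓕 (fun x ↦ ∑ i ∈ S, c i * F i x) ξ = ∑ i ∈ S, c i * 𝓕 (F i) ξ := by
  simp_rw [Real.fourier_eq]
  rw [← Finset.sum_congr rfl fun i _ ↦ integral_const_mul (c i) _, ← integral_finsetSum]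
  · refine integral_congr_ae (Eventually.of_forall fun x ↦ ?_)
    simp only [Finset.smul_sum, mul_smul_comm]
  · exact fun i hi ↦ ((Real.fourierIntegral_convergent_iff ξ).2 (hF i hi)).const_mul _

theorem fourier_lin_two {f g : Tan d → ℂ} (hf : Integrable f) (hg : Integrable g) (c e : ℂ)
    (ξ : Tan d) : 𝓕 (fun x ↦ c * f x + e * g x) ξ = c * 𝓕 f ξ + e * 𝓕 g ξ := by
  simp_rw [Real.fourier_eq]
  rw [← integral_const_mul, ← integral_const_mul, ← integral_add]
  · simp only [smul_add, mul_smul_comm]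
  · exact ((Real.fourierIntegral_convergent_iff ξ).2 hf).const_mul _
  · exact ((Real.fourierIntegral_convergent_iff ξ).2 hg).const_mul _

end Linear

section Weighted

variable {τ α β s : ℝ} {γ : Tan d} {w : Spc d → ℂ}

theorem Test.cw (hw : Test w) : Test (cw τ α β s γ w) := by
  have h1 : ContDiff ℝ (⊤ : ℕ∞) (fun p ↦ Real.exp (τ * phase α β s γ p) • w p) :=
    (contDiff_weight τ α β s γ).smul hw.smooth
  have h2 : HasCompactSupport (fun p ↦ Real.exp (τ * phase α β s γ p) • w p) :=
    hw.supp.smul_left (f := fun p ↦ Real.exp (τ * phase α β s γ p))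
  exact ⟨h1, h2⟩

theorem pd_cw (hw : ContDiff ℝ (⊤ : ℕ∞) w) {i : Fin (d + 1)} {p : Spc d} {c : ℝ}
    (hc : HasLineDerivAt ℝ (phase α β s γ) c p (basisVec i)) :
    pd i (cw τ α β s γ w) p = cw τ α β s γ (pd i w) p + (τ * c : ℝ) * cw τ α β s γ w p := by
  have h1 : HasLineDerivAt ℝ w (pd i w p) p (basisVec i) :=
    ((hw.differentiable (by simp)) p).lineDifferentiableAt.hasLineDerivAt
  have h2 : HasLineDerivAt ℝ (cw τ α β s γ w)
      (cw τ α β s γ (pd i w) p + (τ * c : ℝ) * cw τ α β s γ w p) p (basisVec i) := by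
    unfold HasLineDerivAt at *
    refine ((hc.const_mul τ).exp.smul h1).congr_deriv ?_
    unfold cw
    simp only [zero_smul, add_zero, Complex.real_smul]
    push_cast
    ring
  exact h2.lineDeriv

theorem hasLineDerivAt_phase_last (p : Spc d) :
    HasLineDerivAt ℝ (phase α β s γ) (α + β * p.2) p (basisVec (Fin.last d)) := by
  unfold HasLineDerivAt phase
  rw [basisVec_last]
  have h : HasDerivAt (fun t : ℝ ↦ p.2 + t) 1 0 := (hasDerivAt_id _).const_add _
  have := ((h.const_mul α).add (((h.pow 2).const_mul β).div_const 2)).add_const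
    (s * inner ℝ γ p.1)
  refine HasDerivAt.congr_deriv (this.congr_of_eventuallyEq (Eventually.of_forall fun t ↦ ?_)) ?_
  · simp
  · simp
    ring

theorem hasLineDerivAt_phase_castSucc (p : Spc d) (j : Fin d) :
    HasLineDerivAt ℝ (phase α β s γ) (s * γ j) p (basisVec j.castSucc) := by
  unfold HasLineDerivAt phase
  rw [basisVec_castSucc]
  have h : HasDerivAt (fun t : ℝ ↦ inner ℝ γ p.1 + t * γ j) (γ j) 0 := by
    simpa using ((hasDerivAt_id (0 : ℝ)).mul_const (γ j)).const_add (inner ℝ γ p.1)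
  have := (h.const_mul s).const_add (α * p.2 + β * p.2 ^ 2 / 2)
  refine this.congr_of_eventuallyEq (Eventually.of_forall fun t ↦ ?_)
  simp [inner_add_right, inner_smul_right, EuclideanSpace.inner_single_right]

theorem fou_pd_last_cw (hw : Test w) (ξ : Tan d) (y : ℝ) :
    fou (pd (Fin.last d) (cw τ α β s γ w)) ξ y = fou (cw τ α β s γ (pd (Fin.last d) w)) ξ y
      + (τ * (α + β * y) : ℝ) * fou (cw τ α β s γ w) ξ y := by
  unfold fou
  have h := fourier_lin_two (((hw.pd (Fin.last d)).cw (τ := τ) (α := α) (β := β) (s := s)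
    (γ := γ)).slice y).integrable ((hw.cw (τ := τ) (α := α) (β := β) (s := s)
    (γ := γ)).slice y).integrable 1 (τ * (α + β * y) : ℝ) ξ
  rw [one_mul] at h
  rw [← h]
  refine congrArg (fun f : Tan d → ℂ ↦ 𝓕 f ξ) (funext fun x ↦ ?_)
  rw [pd_cw hw.smooth (hasLineDerivAt_phase_last _), one_mul]

/-- The phase is affine in x, so conjugation turns ∂_j into ∂_j − τsγ_j, whose symbol is i(2πξ_j +
iτsγ_j). -/
theorem fou_cw_pd_castSucc (hw : Test w) (j : Fin d) (ξ : Tan d) (y : ℝ) :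
    fou (cw τ α β s γ (pd j.castSucc w)) ξ y =
      Complex.I * cfreq τ s γ ((2 * Real.pi) • ξ) j * fou (cw τ α β s γ w) ξ y := by
  have h1 := fou_pd_castSucc (hw.cw (τ := τ) (α := α) (β := β) (s := s) (γ := γ)) j ξ y
  have h2 : fou (pd j.castSucc (cw τ α β s γ w)) ξ y = fou (cw τ α β s γ (pd j.castSucc w)) ξ y
      + (τ * (s * γ j) : ℝ) * fou (cw τ α β s γ w) ξ y := by
    unfold fou
    have h := fourier_lin_two (((hw.pd j.castSucc).cw (τ := τ) (α := α) (β := β) (s := s)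
      (γ := γ)).slice y).integrable ((hw.cw (τ := τ) (α := α) (β := β) (s := s)
      (γ := γ)).slice y).integrable 1 (τ * (s * γ j) : ℝ) ξ
    rw [one_mul] at h
    rw [← h]
    refine congrArg (fun f : Tan d → ℂ ↦ 𝓕 f ξ) (funext fun x ↦ ?_)
    rw [pd_cw hw.smooth (hasLineDerivAt_phase_castSucc _ _), one_mul]
  rw [h2] at h1
  unfold cfreq
  simp only [PiLp.smul_apply, smul_eq_mul]
  push_cast at *
  linear_combination h1 - (τ * s * γ j) * fou (cw τ α β s γ w) ξ y * Complex.I_sq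

theorem hasDerivAt_fou_cw (hw : Test w) (ξ : Tan d) (y : ℝ) :
    HasDerivAt (fou (cw τ α β s γ w) ξ) (fou (cw τ α β s γ (pd (Fin.last d) w)) ξ y
      + (τ * (α + β * y) : ℝ) * fou (cw τ α β s γ w) ξ y) y := by
  rw [← fou_pd_last_cw hw]
  exact hasDerivAt_fou hw.cw ξ y

/-- Mixed derivatives on the Fourier side. -/
theorem fou_cw_pd_last_castSucc (hw : Test w) (j : Fin d) (ξ : Tan d) (y : ℝ) :
    fou (cw τ α β s γ (pd (Fin.last d) (pd j.castSucc w))) ξ y =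
      Complex.I * cfreq τ s γ ((2 * Real.pi) • ξ) j *
        fou (cw τ α β s γ (pd (Fin.last d) w)) ξ y := by
  -- Both sides of the tangential identity are differentiated in y; uniqueness of the derivative
  -- gives the mixed identity after the weight terms cancel.
  have h1 := hasDerivAt_fou_cw (τ := τ) (α := α) (β := β) (s := s) (γ := γ) (hw.pd j.castSucc) ξ y
  have h2 := (hasDerivAt_fou_cw (τ := τ) (α := α) (β := β) (s := s) (γ := γ) hw ξ y).const_mul
    (Complex.I * cfreq τ s γ ((2 * Real.pi) • ξ) j)
  have h3 := h1.unique (h2.congr_of_eventuallyEq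
    (Eventually.of_forall fun y ↦ fou_cw_pd_castSucc hw j ξ y))
  rw [fou_cw_pd_castSucc hw] at h3
  linear_combination h3

theorem fou_eq_zero {W : Spc d → ℂ} {y : ℝ} (h : ∀ x, W (x, y) = 0) (ξ : Tan d) :
    fou W ξ y = 0 := by
  unfold fou
  simp_rw [h]
  rw [Real.fourier_eq]
  simp

theorem fou_cw_eq_zero {y : ℝ} (h : ∀ x, w (x, y) = 0) (ξ : Tan d) :
    fou (cw τ α β s γ w) ξ y = 0 :=
  fou_eq_zero (fun x ↦ by simp [cw, h]) ξ

theorem pd_eq_zero_of_isOpen {U : Set ℝ} (hU : IsOpen U) (h : ∀ x, ∀ y ∈ U, w (x, y) = 0)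
    (i : Fin (d + 1)) : ∀ x, ∀ y ∈ U, pd i w (x, y) = 0 := fun x y hy ↦ by
  have h1 : w =ᶠ[𝓝 (x, y)] fun _ ↦ 0 := by
    filter_upwards [(hU.preimage continuous_snd).mem_nhds (show (x, y).2 ∈ U from hy)] with q hq
    exact h q.1 q.2 hq
  unfold pd
  rw [h1.lineDeriv_eq]
  simp [lineDeriv]

end Weighted

section Operator

variable {τ α β s : ℝ} {γ : Tan d} {w : Spc d → ℂ} {A : Coeff d} {lam0 M0 : ℝ}

/-- The derivative of the coefficient `a_nj`. -/
def dcoef (A : Coeff d) (j : Fin (d + 1)) (y : ℝ) : ℝ := deriv (fun y ↦ A y (Fin.last d) j) y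

/-- The operator `div (A ∇ w)` in nondivergence form. -/
def divF (A : Coeff d) (w : Spc d → ℂ) (p : Spc d) : ℂ :=
  (∑ i, ∑ j, (A p.2 i j : ℂ) * pd i (pd j w) p)
    + ∑ j, (dcoef A j p.2 : ℂ) * pd j w p

/-- The Fourier transform of `e^{τφ} div (A ∇ w)`. -/
def fouDiv (τ α β s : ℝ) (γ : Tan d) (A : Coeff d) (w : Spc d → ℂ) (ξ : Tan d) (y : ℝ) : ℂ :=
  (∑ i, ∑ j, (A y i j : ℂ) * fou (cw τ α β s γ (pd i (pd j w))) ξ y)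
    + ∑ j, (dcoef A j y : ℂ) * fou (cw τ α β s γ (pd j w)) ξ y

theorem Admissible.lipschitzWith (h : Admissible lam0 M0 A) (i j : Fin (d + 1)) :
    LipschitzWith M0.toNNReal (fun y ↦ A y i j) := by
  refine LipschitzWith.of_dist_le' fun y y' ↦ ?_
  rw [Real.dist_eq, Real.dist_eq]
  exact h.lipschitz y' y i j

theorem Admissible.abs_deriv_le (h : Admissible lam0 M0 A) (hM : 0 ≤ M0) (i j : Fin (d + 1))
    (y : ℝ) : |deriv (fun y ↦ A y i j) y| ≤ M0 := by
  have := norm_deriv_le_of_lipschitz (h.lipschitzWith i j) (x₀ := y)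
  rwa [Real.coe_toNNReal _ hM] at this

theorem hasLineDerivAt_coeff (hw : ContDiff ℝ (⊤ : ℕ∞) w) (i j : Fin (d + 1)) (p : Spc d)
    (hA : DifferentiableAt ℝ (fun y ↦ A y i j) p.2) :
    HasLineDerivAt ℝ (fun q ↦ A q.2 i j • pd j w q)
      ((A p.2 i j : ℂ) * pd i (pd j w) p
        + ((basisVec i : Spc d).2 * deriv (fun y ↦ A y i j) p.2 : ℝ) * pd j w p) p
      (basisVec i) := by
  have h1 : HasLineDerivAt ℝ (pd j w) (pd i (pd j w) p) p (basisVec i) :=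
    (((contDiff_pd hw j).differentiable (by simp)) p).lineDifferentiableAt.hasLineDerivAt
  unfold HasLineDerivAt at *
  have h2 : HasDerivAt (fun t : ℝ ↦ (p + t • (basisVec i : Spc d)).2) (basisVec i : Spc d).2 0 := by
    simpa using ((hasDerivAt_id (0 : ℝ)).mul_const (basisVec i : Spc d).2).const_add p.2
  have h3 : HasDerivAt (fun t : ℝ ↦ A (p + t • (basisVec i : Spc d)).2 i j)
      (deriv (fun y ↦ A y i j) p.2 * (basisVec i : Spc d).2) 0 := by
    refine HasDerivAt.comp (h₂ := fun y ↦ A y i j) (0 : ℝ) ?_ h2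
    simpa using hA.hasDerivAt
  refine (h3.smul h1).congr_deriv ?_
  simp only [zero_smul, add_zero, Complex.real_smul]
  push_cast
  ring

/-- The coefficients vary only in y, so only the outer normal derivative falls on them, producing
just the derivatives of the a_nj. -/
theorem divGrad_eq_divF (hw : ContDiff ℝ (⊤ : ℕ∞) w) (p : Spc d)
    (hA : ∀ i j, DifferentiableAt ℝ (fun y ↦ A y i j) p.2) : divGrad A w p = divF A w p := by
  have h1 : ∀ i, pd i (fun q ↦ ∑ j, A q.2 i j • pd j w q) p =
      ∑ j, ((A p.2 i j : ℂ) * pd i (pd j w) p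
        + ((basisVec i : Spc d).2 * deriv (fun y ↦ A y i j) p.2 : ℝ) * pd j w p) := fun i ↦ by
    refine HasLineDerivAt.lineDeriv ?_
    exact HasDerivAt.fun_sum fun j _ ↦ hasLineDerivAt_coeff hw i j p (hA i j)
  unfold divGrad divF
  simp_rw [h1, Finset.sum_add_distrib]
  congr 1
  rw [Fin.sum_univ_castSucc]
  simp [basisVec_castSucc, basisVec_last, dcoef]

/-- Lipschitz entries are differentiable for almost every y, hence at almost every (x, y), by
quasi-invariance of the projection to y. -/
theorem ae_divGrad_eq_divF (h : Admissible lam0 M0 A) (hw : ContDiff ℝ (⊤ : ℕ∞) w) :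
    ∀ᵐ p : Spc d, divGrad A w p = divF A w p := by
  have h1 : ∀ᵐ y : ℝ, ∀ i j, DifferentiableAt ℝ (fun y ↦ A y i j) y :=
    ae_all_iff.2 fun i ↦ ae_all_iff.2 fun j ↦ (h.lipschitzWith i j).ae_differentiableAt
  have h2 : ∀ᵐ p : Spc d, ∀ i j, DifferentiableAt ℝ (fun y ↦ A y i j) p.2 :=
    (Measure.quasiMeasurePreserving_snd (μ := (volume : Measure (Tan d)))
      (ν := (volume : Measure ℝ))).ae h1
  filter_upwards [h2] with p hp
  exact divGrad_eq_divF hw p hp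

/-- The normal block gives a_nn v2. By symmetry each of the two mixed blocks gives i a_nn t v1,
whence the factor 2. The tangential block gives −a_nn(t² + Q)v. -/
theorem fouDiv_eq (hw : Test w) (ξ : Tan d) (y : ℝ) (hsymm : (A y).IsSymm) (ha : ann A y ≠ 0) :
    fouDiv τ α β s γ A w ξ y =
      ann A y * conjOp (tsym A (cfreq τ s γ ((2 * Real.pi) • ξ)))
        (qsym A (cfreq τ s γ ((2 * Real.pi) • ξ))) (fou (cw τ α β s γ w) ξ)
        (fou (cw τ α β s γ (pd (Fin.last d) w)) ξ)
        (fou (cw τ α β s γ (pd (Fin.last d) (pd (Fin.last d) w))) ξ) y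
      + ∑ j, (dcoef A j y : ℂ) * fou (cw τ α β s γ (pd j w)) ξ y := by
  have ha' : (ann A y : ℂ) ≠ 0 := by exact_mod_cast ha
  have hs : ∀ i j, A y i j = A y j i := fun i j ↦ by
    conv_lhs => rw [← hsymm]
    rfl
  obtain ⟨ζ, hζ⟩ : ∃ ζ, ζ = cfreq τ s γ ((2 * Real.pi) • ξ) := ⟨_, rfl⟩
  have ht : ann A y * tsym A ζ y = ∑ j : Fin d, (A y (Fin.last d) j.castSucc : ℂ) * ζ j := by
    unfold tsym tco
    rw [Finset.mul_sum]
    refine Finset.sum_congr rfl fun j _ ↦ ?_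
    push_cast
    field_simp
  have hq := tsym_sq_add_qsym A ζ y ha
  unfold fouDiv
  congr 1
  unfold conjOp
  simp_rw [Fin.sum_univ_castSucc, fou_cw_pd_last_castSucc hw, fou_cw_pd_castSucc (hw.pd _),
    fou_cw_pd_castSucc hw]
  rw [← hζ]
  have e1 : ∑ j : Fin d, (A y (Fin.last d) j.castSucc : ℂ) *
      (Complex.I * ζ j * fou (cw τ α β s γ (pd (Fin.last d) w)) ξ y) =
      Complex.I * (ann A y * tsym A ζ y) * fou (cw τ α β s γ (pd (Fin.last d) w)) ξ y := by
    rw [ht, Finset.mul_sum, Finset.sum_mul]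
    exact Finset.sum_congr rfl fun j _ ↦ by ring
  have e2 : ∑ j : Fin d, ((∑ k : Fin d, (A y j.castSucc k.castSucc : ℂ) *
      (Complex.I * ζ j * (Complex.I * ζ k * fou (cw τ α β s γ w) ξ y))) +
      (A y j.castSucc (Fin.last d) : ℂ) *
        (Complex.I * ζ j * fou (cw τ α β s γ (pd (Fin.last d) w)) ξ y)) =
      -(ann A y * (tsym A ζ y ^ 2 + qsym A ζ y)) * fou (cw τ α β s γ w) ξ y +
      Complex.I * (ann A y * tsym A ζ y) * fou (cw τ α β s γ (pd (Fin.last d) w)) ξ y := by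
    rw [Finset.sum_add_distrib, ← e1, hq, neg_mul, Finset.sum_mul, ← Finset.sum_neg_distrib]
    congr 1
    · refine Finset.sum_congr rfl fun j _ ↦ ?_
      rw [Finset.sum_mul, ← Finset.sum_neg_distrib]
      refine Finset.sum_congr rfl fun k _ ↦ ?_
      linear_combination ((A y j.castSucc k.castSucc : ℂ) * ζ j * ζ k *
        fou (cw τ α β s γ w) ξ y) * Complex.I_sq
    · exact Finset.sum_congr rfl fun j _ ↦ by rw [hs]
  rw [e2, e1]
  simp only [ann]
  ring

/-- Solve for the normal form, dividing by a_nn ≥ λ₀. The bound holds at every y, since `deriv` is 0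
where the derivative does not exist. -/
theorem norm_conjOp_le (h : Admissible lam0 M0 A) (hlam : 0 < lam0) (hM : 0 ≤ M0) (hw : Test w)
    (hτ : 0 ≤ τ) (hs : 0 ≤ s) (hs1 : s ≤ 1) (hγ : ‖γ‖ ≤ 1) (ξ : Tan d) (y : ℝ) :
    ‖conjOp (tsym A (cfreq τ s γ ((2 * Real.pi) • ξ)))
        (qsym A (cfreq τ s γ ((2 * Real.pi) • ξ))) (fou (cw τ α β s γ w) ξ)
        (fou (cw τ α β s γ (pd (Fin.last d) w)) ξ)
        (fou (cw τ α β s γ (pd (Fin.last d) (pd (Fin.last d) w))) ξ) y‖ ≤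
      lam0⁻¹ * (1 + (d + 1) * M0) * (‖fouDiv τ α β s γ A w ξ y‖ +
        ‖fou (cw τ α β s γ (pd (Fin.last d) w)) ξ y‖ +
        (τ + ‖(2 * Real.pi) • ξ‖) * ‖fou (cw τ α β s γ w) ξ y‖) := by
  have ha : lam0 ≤ ann A y := h.diag_lower y _
  have ha0 : 0 < ann A y := hlam.trans_le ha
  have e := fouDiv_eq (τ := τ) (α := α) (β := β) (s := s) (γ := γ) hw ξ y (h.symm y) ha0.ne'
  generalize conjOp (tsym A (cfreq τ s γ ((2 * Real.pi) • ξ)))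
        (qsym A (cfreq τ s γ ((2 * Real.pi) • ξ))) (fou (cw τ α β s γ w) ξ)
        (fou (cw τ α β s γ (pd (Fin.last d) w)) ξ)
        (fou (cw τ α β s γ (pd (Fin.last d) (pd (Fin.last d) w))) ξ) y = P at *
  rw [Fin.sum_univ_castSucc] at e
  simp_rw [fou_cw_pd_castSucc hw] at e
  have hΛ : 0 ≤ τ + ‖(2 * Real.pi) • ξ‖ := add_nonneg hτ (norm_nonneg _)
  have hζ : ∀ j, ‖cfreq τ s γ ((2 * Real.pi) • ξ) j‖ ≤ τ + ‖(2 * Real.pi) • ξ‖ :=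
    norm_cfreq_le hτ hs hs1 hγ
  generalize τ + ‖(2 * Real.pi) • ξ‖ = Λ at *
  generalize fou (cw τ α β s γ w) ξ y = V at *
  generalize fou (cw τ α β s γ (pd (Fin.last d) w)) ξ y = V1 at *
  generalize fouDiv τ α β s γ A w ξ y = G at *
  have h1 : ‖∑ j : Fin d, (dcoef A j.castSucc y : ℂ) *
      (Complex.I * cfreq τ s γ ((2 * Real.pi) • ξ) j * V)‖ ≤ d * (M0 * (Λ * ‖V‖)) := by
    refine norm_sum_le_card fun j ↦ ?_
    rw [norm_mul, norm_mul, norm_mul, Complex.norm_I, one_mul, Complex.norm_real]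
    exact mul_le_mul (h.abs_deriv_le hM _ _ _)
      (mul_le_mul_of_nonneg_right (hζ j) (norm_nonneg _)) (by positivity) hM
  have h2 : ‖(dcoef A (Fin.last d) y : ℂ) * V1‖ ≤ M0 * ‖V1‖ := by
    rw [norm_mul, Complex.norm_real]
    exact mul_le_mul_of_nonneg_right (h.abs_deriv_le hM _ _ _) (norm_nonneg _)
  have h3 : lam0 * ‖P‖ ≤ ‖G‖ + (d * (M0 * (Λ * ‖V‖)) + M0 * ‖V1‖) := by
    have e' : ann A y * P = G - (∑ j : Fin d, (dcoef A j.castSucc y : ℂ) *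
      (Complex.I * cfreq τ s γ ((2 * Real.pi) • ξ) j * V) +
      (dcoef A (Fin.last d) y : ℂ) * V1) := by rw [e]; ring
    have e2 : ‖(ann A y : ℂ) * P‖ = ann A y * ‖P‖ := by
      rw [norm_mul, Complex.norm_real, Real.norm_of_nonneg ha0.le]
    have e3 := mul_le_mul_of_nonneg_right ha (norm_nonneg P)
    rw [← e2, e'] at e3
    exact e3.trans ((norm_sub_le _ _).trans (add_le_add le_rfl
      ((norm_add_le _ _).trans (add_le_add h1 h2))))
  rw [mul_assoc, ← div_eq_inv_mul, le_div_iff₀ hlam, mul_comm]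
  refine h3.trans ?_
  have p1 : 0 ≤ (d + 1) * M0 * ‖G‖ := by positivity
  have p2 : 0 ≤ d * M0 * ‖V1‖ := by positivity
  have p3 : 0 ≤ M0 * (Λ * ‖V‖) := by positivity
  have p4 : 0 ≤ Λ * ‖V‖ := by positivity
  have p5 := norm_nonneg V1
  linarith

end Operator

end Carleman

end

/-! ### Verification of the one-sided hypotheses; Plancherel on slabs; pointwise bounds. -/

noncomputable section

namespace Carleman

open MeasureTheory Set Filter Topology FourierTransform

variable {d : ℕ}

section SideData

variable {τ α β s : ℝ} {γ : Tan d} {w : Spc d → ℂ} {A : Coeff d} {lam0 M0 B K : ℝ}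

/-- This connects the equation with the abstract problem: the symbol bounds hold with a single K
that does not depend on ξ. -/
theorem side_of_admissible {ε a b : ℝ} (h : Admissible lam0 M0 A) (hlam : 0 < lam0)
    (ht : ∀ j, BddLip B (tco A j)) (hb : ∀ j k, BddLip B (bco A j k))
    (hK1 : d * B ≤ K) (hK2 : d * (d * B) ≤ K) (hK3 : lam0⁻¹ ≤ K) (hτ : 0 ≤ τ) (hs : 0 ≤ s)
    (hs1 : s ≤ 1) (hγ : ‖γ‖ ≤ 1) (hw : Test w) (hab : a ≤ b)
    (hends : (ε = 1 ∧ a = 0 ∧ ∀ x y, b < y → w (x, y) = 0) ∨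
      (ε = -1 ∧ b = 0 ∧ ∀ x y, y < a → w (x, y) = 0))
    (hr : ∀ y ∈ Icc a b, α / 2 ≤ α + β * y ∧ α + β * y ≤ 2 * α) (ξ : Tan d) :
    Side ε a b K τ s ‖(2 * Real.pi) • ξ‖ α β (tsym A (cfreq τ s γ ((2 * Real.pi) • ξ)))
      (qsym A (cfreq τ s γ ((2 * Real.pi) • ξ))) (symbolM A ((2 * Real.pi) • ξ))
      (fou (cw τ α β s γ w) ξ) (fou (cw τ α β s γ (pd (Fin.last d) w)) ξ)
      (fou (cw τ α β s γ (pd (Fin.last d) (pd (Fin.last d) w))) ξ) := by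
  have hζ : ∀ j, ‖cfreq τ s γ ((2 * Real.pi) • ξ) j‖ ≤ τ + ‖(2 * Real.pi) • ξ‖ :=
    norm_cfreq_le hτ hs hs1 hγ
  have hΛ : 0 ≤ τ + ‖(2 * Real.pi) • ξ‖ := by positivity
  have hX := norm_nonneg ((2 * Real.pi) • ξ)
  refine ⟨hab, ?_, hr, fun y y' ↦ ?_, fun y ↦ ?_, fun y ↦ ?_, fun y y' ↦ ?_, fun y ↦ ?_,
    fun y ↦ ?_, fun y ↦ ?_, hasDerivAt_fou_cw hw ξ, hasDerivAt_fou_cw (hw.pd _) ξ, ?_⟩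
  -- Vanishing is known strictly beyond the far endpoint; continuity extends it, for w and its
  -- normal derivative, to the endpoint.
  · have key : ∀ {f : Spc d → ℂ} {U : Set ℝ} {c : ℝ}, Continuous f → c ∈ closure U →
        (∀ x, ∀ y ∈ U, f (x, y) = 0) → ∀ x, f (x, c) = 0 := fun {f U c} hf hc h x ↦
      EqOn.closure (f := fun y ↦ f (x, y)) (g := fun _ ↦ (0 : ℂ)) (fun y hy ↦ h x y hy)
        (by fun_prop) continuous_const hc
    have c0 := hw.smooth.continuous
    have c1 := (hw.pd (Fin.last d)).smooth.continuous
    rcases hends with ⟨e1, e2, e3⟩ | ⟨e1, e2, e3⟩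
    · have hc : b ∈ closure (Ioi b) := by rw [closure_Ioi]; exact self_mem_Ici
      exact Or.inl ⟨e1, e2, fou_cw_eq_zero (key c0 hc e3) ξ,
        fou_cw_eq_zero (key c1 hc (pd_eq_zero_of_isOpen isOpen_Ioi e3 _)) ξ⟩
    · have hc : a ∈ closure (Iio a) := by rw [closure_Iio]; exact self_mem_Iic
      exact Or.inr ⟨e1, e2, fou_cw_eq_zero (key c0 hc e3) ξ,
        fou_cw_eq_zero (key c1 hc (pd_eq_zero_of_isOpen isOpen_Iio e3 _)) ξ⟩
  · refine (norm_tsym_sub_le ht hζ y y').trans ?_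
    have := mul_le_mul_of_nonneg_right hK1 (mul_nonneg hΛ (abs_nonneg (y - y')))
    linarith
  · refine (norm_tsym_le ht hζ y).trans ?_
    have := mul_le_mul_of_nonneg_right hK1 hΛ
    linarith
  · refine (abs_tsym_im_le ht hτ hs hγ y).trans ?_
    have := mul_le_mul_of_nonneg_right hK1 (mul_nonneg hτ hs)
    linarith
  · refine (norm_qsym_sub_le hb hΛ hζ y y').trans ?_
    have := mul_le_mul_of_nonneg_right hK2
      (mul_nonneg (mul_nonneg hΛ hΛ) (abs_nonneg (y - y')))
    linarith
  · refine (norm_qsym_near h hlam hb hτ hs hs1 hγ y).trans ?_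
    have := mul_le_mul_of_nonneg_right hK2
      (mul_nonneg hs (sq_nonneg (τ + ‖(2 * Real.pi) • ξ‖)))
    linarith
  · have h1 := h.symbolM_lower hlam y ((2 * Real.pi) • ξ)
    have h2 : 0 ≤ symbolM A ((2 * Real.pi) • ξ) y := Real.sqrt_nonneg _
    have h3 := mul_le_mul_of_nonneg_right hK3 h2
    have h4 := mul_le_mul_of_nonneg_left h1 (inv_nonneg.2 hlam.le)
    rw [← mul_assoc, inv_mul_cancel₀ hlam.ne', one_mul] at h4
    exact h4.trans h3
  · exact (h.symbolM_upper hlam y _).trans (mul_le_mul_of_nonneg_right hK3 hX)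
  · exact continuous_iff_continuousAt.2 fun y ↦
      (hasDerivAt_fou_cw ((hw.pd _).pd _) ξ y).continuousAt

end SideData

section Slab

theorem ofReal_norm_sq (z : ℂ) : ENNReal.ofReal (‖z‖ ^ 2) = ‖z‖ₑ ^ 2 := by
  rw [ENNReal.ofReal_pow (norm_nonneg _), ofReal_norm]

/-- Tonelli and Plancherel on a horizontal slab. -/
theorem lintegral_slab {H : Spc d → ℂ} (hm : Measurable H)
    (hs : ∀ y, Test (fun x ↦ H (x, y))) {I : Set ℝ}
    (hF : Measurable (fun q : Tan d × ℝ ↦ fou H q.1 q.2)) :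
    ∫⁻ p in {p : Spc d | p.2 ∈ I}, ‖H p‖ₑ ^ 2 = ∫⁻ ξ, ∫⁻ y in I, ‖fou H ξ y‖ₑ ^ 2 := by
  have e : {p : Spc d | p.2 ∈ I} = univ ×ˢ I := by ext; simp
  rw [e, Measure.volume_eq_prod, ← Measure.prod_restrict, Measure.restrict_univ,
    lintegral_prod_symm _ (hm.enorm.pow_const 2).aemeasurable]
  refine Eq.trans ?_ (lintegral_lintegral_swap (hF.enorm.pow_const 2).aemeasurable).symm
  refine lintegral_congr fun y ↦ ?_
  exact (plancherel (hs y)).symm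

variable {τ α β s : ℝ} {γ : Tan d} {w : Spc d → ℂ}

theorem enorm_cw_sq (f : Spc d → ℂ) (p : Spc d) : ‖cw τ α β s γ f p‖ₑ ^ 2 =
    ‖f p‖ₑ ^ 2 * ENNReal.ofReal (Real.exp (2 * τ * phase α β s γ p)) := by
  unfold cw
  rw [← ofReal_norm_sq, ← ofReal_norm_sq, ← ENNReal.ofReal_mul (sq_nonneg _), norm_smul,
    Real.norm_of_nonneg (Real.exp_pos _).le, mul_pow, ← Real.exp_nat_mul]
  congr 1
  rw [mul_comm]
  congr 2
  push_cast
  ring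

/-- The Fourier counterpart of `|D^k w|^2`. -/
def sqF (τ α β s : ℝ) (γ : Tan d) : ℕ → (Spc d → ℂ) → Tan d → ℝ → ENNReal
  | 0, w, ξ, y => ‖fou (cw τ α β s γ w) ξ y‖ₑ ^ 2
  | k + 1, w, ξ, y => ∑ i, sqF τ α β s γ k (pd i w) ξ y

theorem measurable_sqF (k : ℕ) (hw : Test w) :
    Measurable (fun q : Tan d × ℝ ↦ sqF τ α β s γ k w q.1 q.2) := by
  induction k generalizing w with
  | zero => exact ((continuous_fou hw.cw).enorm.measurable).pow_const 2
  | succ k ih => exact Finset.measurable_fun_sum _ fun i _ ↦ ih (hw.pd i)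

theorem measurable_sqD (k : ℕ) (hw : Test w) : Measurable (sqD k w) := by
  induction k generalizing w with
  | zero => exact hw.smooth.continuous.enorm.measurable.pow_const 2
  | succ k ih => exact Finset.measurable_fun_sum _ fun i _ ↦ ih (hw.pd i)

theorem measurable_weight_sq :
    Measurable fun p : Spc d ↦ ENNReal.ofReal (Real.exp (2 * τ * phase α β s γ p)) :=
  ENNReal.measurable_ofReal.comp (contDiff_weight (2 * τ) α β s γ).continuous.measurable

theorem lintegral_slab_sqD (k : ℕ) (hw : Test w) {I : Set ℝ} :
    ∫⁻ p in {p : Spc d | p.2 ∈ I}, sqD k w p *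
      ENNReal.ofReal (Real.exp (2 * τ * phase α β s γ p)) =
    ∫⁻ ξ, ∫⁻ y in I, sqF τ α β s γ k w ξ y := by
  induction k generalizing w with
  | zero =>
    simp only [sqD, sqF, ← enorm_cw_sq]
    exact lintegral_slab hw.cw.smooth.continuous.measurable (fun y ↦ hw.cw.slice y)
      (continuous_fou hw.cw).measurable
  | succ k ih =>
    simp only [sqD, sqF, Finset.sum_mul]
    have hm : ∀ i, Measurable fun p ↦ sqD k (pd i w) p *
        ENNReal.ofReal (Real.exp (2 * τ * phase α β s γ p)) := fun i ↦
      (measurable_sqD k (hw.pd i)).mul measurable_weight_sq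
    rw [lintegral_finsetSum _ fun i _ ↦ hm i]
    simp_rw [ih (hw.pd _)]
    rw [← lintegral_finsetSum _ fun i _ ↦ (measurable_sqF k (hw.pd i)).lintegral_prod_right']
    refine lintegral_congr fun ξ ↦ ?_
    have hm' : ∀ i, Measurable fun y ↦ sqF τ α β s γ k (pd i w) ξ y := fun i ↦
      (measurable_sqF k (hw.pd i)).comp (measurable_const.prodMk measurable_id)
    exact (lintegral_finsetSum _ fun i _ ↦ hm' i).symm

theorem lintegral_trace_sqD (k : ℕ) (hw : Test w) :
    ∫⁻ x : Tan d, sqD k w (x, 0) *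
      ENNReal.ofReal (Real.exp (2 * τ * phase α β s γ (x, 0))) =
    ∫⁻ ξ, sqF τ α β s γ k w ξ 0 := by
  have hp : Measurable fun x : Tan d ↦ ((x, 0) : Spc d) := measurable_id.prodMk measurable_const
  induction k generalizing w with
  | zero =>
    simp only [sqD, sqF, ← enorm_cw_sq]
    exact (fou_plancherel hw.cw 0).symm
  | succ k ih =>
    simp only [sqD, sqF, Finset.sum_mul]
    have hm : ∀ i, Measurable fun x : Tan d ↦ sqD k (pd i w) (x, 0) *
        ENNReal.ofReal (Real.exp (2 * τ * phase α β s γ (x, 0))) := fun i ↦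
      ((measurable_sqD k (hw.pd i)).comp hp).mul (measurable_weight_sq.comp hp)
    rw [lintegral_finsetSum _ fun i _ ↦ hm i]
    simp_rw [ih (hw.pd _)]
    have hm' : ∀ i, Measurable fun ξ ↦ sqF τ α β s γ k (pd i w) ξ 0 := fun i ↦
      (measurable_sqF k (hw.pd i)).comp hp
    exact (lintegral_finsetSum _ fun i _ ↦ hm' i).symm

end Slab

section Pointwise

variable {τ α β s : ℝ} {γ : Tan d} {w : Spc d → ℂ}

theorem norm_fou_cw_pd_le (hw : Test w) (hτ : 0 ≤ τ) (hs : 0 ≤ s) (hs1 : s ≤ 1) (hγ : ‖γ‖ ≤ 1)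
    (i : Fin (d + 1)) (ξ : Tan d) (y : ℝ) : ‖fou (cw τ α β s γ (pd i w)) ξ y‖ ≤
      (τ + ‖(2 * Real.pi) • ξ‖) * ‖fou (cw τ α β s γ w) ξ y‖ +
        ‖fou (cw τ α β s γ (pd (Fin.last d) w)) ξ y‖ := by
  have hΛ : 0 ≤ τ + ‖(2 * Real.pi) • ξ‖ := by positivity
  refine Fin.lastCases ?_ (fun j ↦ ?_) i
  · exact le_add_of_nonneg_left (by positivity)
  · rw [fou_cw_pd_castSucc hw, norm_mul, norm_mul, Complex.norm_I, one_mul]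
    exact (mul_le_mul_of_nonneg_right (norm_cfreq_le hτ hs hs1 hγ j) (norm_nonneg _)).trans
      (le_add_of_nonneg_right (norm_nonneg _))

theorem norm_fou_cw_pd_pd_le (hw : Test w) (hτ : 0 ≤ τ) (hs : 0 ≤ s) (hs1 : s ≤ 1)
    (hγ : ‖γ‖ ≤ 1) (i j : Fin (d + 1)) (ξ : Tan d) (y : ℝ) :
    ‖fou (cw τ α β s γ (pd i (pd j w))) ξ y‖ ≤
      (τ + ‖(2 * Real.pi) • ξ‖) ^ 2 * ‖fou (cw τ α β s γ w) ξ y‖ +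
        2 * (τ + ‖(2 * Real.pi) • ξ‖) * ‖fou (cw τ α β s γ (pd (Fin.last d) w)) ξ y‖ +
        ‖fou (cw τ α β s γ (pd (Fin.last d) (pd (Fin.last d) w))) ξ y‖ := by
  have hΛ : 0 ≤ τ + ‖(2 * Real.pi) • ξ‖ := by positivity
  have h1 := norm_fou_cw_pd_le (α := α) (β := β) (hw.pd j) hτ hs hs1 hγ i ξ y
  have h2 := mul_le_mul_of_nonneg_left
    (norm_fou_cw_pd_le (α := α) (β := β) hw hτ hs hs1 hγ j ξ y) hΛ
  have h3 : ‖fou (cw τ α β s γ (pd (Fin.last d) (pd j w))) ξ y‖ ≤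
      (τ + ‖(2 * Real.pi) • ξ‖) * ‖fou (cw τ α β s γ (pd (Fin.last d) w)) ξ y‖ +
        ‖fou (cw τ α β s γ (pd (Fin.last d) (pd (Fin.last d) w))) ξ y‖ := by
    refine Fin.lastCases ?_ (fun j ↦ ?_) j
    · exact le_add_of_nonneg_left (by positivity)
    · rw [fou_cw_pd_last_castSucc hw, norm_mul, norm_mul, Complex.norm_I, one_mul]
      exact (mul_le_mul_of_nonneg_right (norm_cfreq_le hτ hs hs1 hγ j) (norm_nonneg _)).trans
        (le_add_of_nonneg_right (norm_nonneg _))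
  linarith

theorem sqF_one_le (hw : Test w) (hτ : 0 ≤ τ) (hs : 0 ≤ s) (hs1 : s ≤ 1) (hγ : ‖γ‖ ≤ 1)
    (ξ : Tan d) (y : ℝ) : sqF τ α β s γ 1 w ξ y ≤ ENNReal.ofReal ((d + 1) *
      (2 * ((τ + ‖(2 * Real.pi) • ξ‖) ^ 2 * ‖fou (cw τ α β s γ w) ξ y‖ ^ 2 +
        ‖fou (cw τ α β s γ (pd (Fin.last d) w)) ξ y‖ ^ 2))) := by
  have h : ∀ i : Fin (d + 1), sqF τ α β s γ 0 (pd i w) ξ y ≤ ENNReal.ofReal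
      (2 * ((τ + ‖(2 * Real.pi) • ξ‖) ^ 2 * ‖fou (cw τ α β s γ w) ξ y‖ ^ 2 +
        ‖fou (cw τ α β s γ (pd (Fin.last d) w)) ξ y‖ ^ 2)) := fun i ↦ by
    unfold sqF
    rw [← ofReal_norm_sq]
    refine ENNReal.ofReal_le_ofReal ?_
    refine (pow_le_pow_left₀ (norm_nonneg _)
      (norm_fou_cw_pd_le hw hτ hs hs1 hγ i ξ y) 2).trans (add_sq_le.trans (le_of_eq ?_))
    ring
  have h2 := Finset.sum_le_sum fun i (_ : i ∈ Finset.univ) ↦ h i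
  rw [Finset.sum_const, Finset.card_univ, Fintype.card_fin, nsmul_eq_mul] at h2
  rw [ENNReal.ofReal_mul (by positivity)]
  refine h2.trans (le_of_eq ?_)
  congr 1
  rw [ENNReal.ofReal_add (by positivity) (by norm_num), ENNReal.ofReal_natCast,
    ENNReal.ofReal_one]
  push_cast
  rfl

theorem sqF_two_le (hw : Test w) (hτ : 0 < τ) (hs : 0 ≤ s) (hs1 : s ≤ 1) (hγ : ‖γ‖ ≤ 1)
    (ξ : Tan d) (y : ℝ) : sqF τ α β s γ 2 w ξ y ≤ ENNReal.ofReal ((d + 1) * ((d + 1) *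
      (12 * τ * dens τ (τ + ‖(2 * Real.pi) • ξ‖) (fou (cw τ α β s γ w) ξ y)
        (fou (cw τ α β s γ (pd (Fin.last d) w)) ξ y)
        (fou (cw τ α β s γ (pd (Fin.last d) (pd (Fin.last d) w))) ξ y)))) := by
  have h : ∀ i j : Fin (d + 1), sqF τ α β s γ 0 (pd i (pd j w)) ξ y ≤ ENNReal.ofReal
      (12 * τ * dens τ (τ + ‖(2 * Real.pi) • ξ‖) (fou (cw τ α β s γ w) ξ y)
        (fou (cw τ α β s γ (pd (Fin.last d) w)) ξ y)
        (fou (cw τ α β s γ (pd (Fin.last d) (pd (Fin.last d) w))) ξ y)) := fun i j ↦ by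
    unfold sqF
    rw [← ofReal_norm_sq]
    refine ENNReal.ofReal_le_ofReal ?_
    refine (pow_le_pow_left₀ (norm_nonneg _)
      (norm_fou_cw_pd_pd_le hw hτ.le hs hs1 hγ i j ξ y) 2).trans ((add_three_sq_le _ _ _).trans ?_)
    have e : ∀ v v1 v2, 12 * τ * dens τ (τ + ‖(2 * Real.pi) • ξ‖) v v1 v2 =
        12 * ((τ + ‖(2 * Real.pi) • ξ‖) ^ 4 * ‖v‖ ^ 2 + (τ + ‖(2 * Real.pi) • ξ‖) ^ 2 * ‖v1‖ ^ 2
          + ‖v2‖ ^ 2) := fun v v1 v2 ↦ by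
      unfold dens
      field_simp
    rw [e]
    generalize fou (cw τ α β s γ w) ξ y = v
    generalize fou (cw τ α β s γ (pd (Fin.last d) w)) ξ y = v1
    generalize fou (cw τ α β s γ (pd (Fin.last d) (pd (Fin.last d) w))) ξ y = v2
    generalize τ + ‖(2 * Real.pi) • ξ‖ = Λ
    have p1 : 0 ≤ Λ ^ 4 * ‖v‖ ^ 2 := by positivity
    have p2 : 0 ≤ ‖v2‖ ^ 2 := by positivity
    linarith
  have hc : ((d + 1 : ℕ) : ENNReal) = ENNReal.ofReal (d + 1) := by
    rw [ENNReal.ofReal_add (by positivity) (by norm_num), ENNReal.ofReal_natCast,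
      ENNReal.ofReal_one]
    push_cast
    rfl
  have h2 := Finset.sum_le_sum fun i (_ : i ∈ Finset.univ) ↦
    Finset.sum_le_sum fun j (_ : j ∈ Finset.univ) ↦ h j i
  rw [Finset.sum_const, Finset.sum_const, Finset.card_univ, Fintype.card_fin, nsmul_eq_mul,
    nsmul_eq_mul, hc] at h2
  rw [ENNReal.ofReal_mul (by positivity), ENNReal.ofReal_mul (by positivity)]
  exact h2

end Pointwise

end Carleman

end

/-! ### The left-hand side bounded by the energies at each frequency. -/

noncomputable section

namespace Carleman

open MeasureTheory Set Filter Topology FourierTransform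

variable {d : ℕ}

/-- The interior energy at a frequency. -/
def intE (τ α β s : ℝ) (γ : Tan d) (I : Set ℝ) (w : Spc d → ℂ) (ξ : Tan d) : ENNReal :=
  ∫⁻ y in I, ENNReal.ofReal (dens τ (τ + ‖(2 * Real.pi) • ξ‖) (fou (cw τ α β s γ w) ξ y)
    (fou (cw τ α β s γ (pd (Fin.last d) w)) ξ y)
    (fou (cw τ α β s γ (pd (Fin.last d) (pd (Fin.last d) w))) ξ y))

/-- The boundary energy at a frequency. -/
def bdE (τ α β s : ℝ) (γ : Tan d) (w : Spc d → ℂ) (ξ : Tan d) : ENNReal :=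
  ENNReal.ofReal (trace (τ + ‖(2 * Real.pi) • ξ‖) (fou (cw τ α β s γ w) ξ)
    (fou (cw τ α β s γ (pd (Fin.last d) w)) ξ))

theorem const_mul_lintegral_le {X : Type*} [MeasurableSpace X] {μ : Measure X} {f g : X → ENNReal}
    {t N : ℝ} (h : ∀ x, ENNReal.ofReal t * f x ≤ ENNReal.ofReal N * g x) :
    ENNReal.ofReal t * ∫⁻ x, f x ∂μ ≤ ENNReal.ofReal N * ∫⁻ x, g x ∂μ := by
  rw [← lintegral_const_mul' _ _ ENNReal.ofReal_ne_top,
    ← lintegral_const_mul' _ _ ENNReal.ofReal_ne_top]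
  exact lintegral_mono h

section LeftSide

variable {τ α β s : ℝ} {γ : Tan d} {w : Spc d → ℂ}

theorem interior_zero_le (hτ : 0 < τ) (ξ : Tan d) (y : ℝ) :
    ENNReal.ofReal (τ ^ 3) * sqF τ α β s γ 0 w ξ y ≤
    ENNReal.ofReal 1 * ENNReal.ofReal (dens τ (τ + ‖(2 * Real.pi) • ξ‖)
      (fou (cw τ α β s γ w) ξ y) (fou (cw τ α β s γ (pd (Fin.last d) w)) ξ y)
      (fou (cw τ α β s γ (pd (Fin.last d) (pd (Fin.last d) w))) ξ y)) := by
  unfold sqF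
  rw [← ofReal_norm_sq, ← ENNReal.ofReal_mul (by positivity), ← ENNReal.ofReal_mul (by norm_num)]
  refine ENNReal.ofReal_le_ofReal ?_
  unfold dens
  rw [one_mul, le_div_iff₀ hτ]
  have hΛ : τ ≤ τ + ‖(2 * Real.pi) • ξ‖ := le_add_of_nonneg_right (norm_nonneg _)
  have h4 := mul_le_mul_of_nonneg_right (pow_le_pow_left₀ hτ.le hΛ 4)
    (sq_nonneg ‖fou (cw τ α β s γ w) ξ y‖)
  have p1 : 0 ≤ (τ + ‖(2 * Real.pi) • ξ‖) ^ 2 *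
    ‖fou (cw τ α β s γ (pd (Fin.last d) w)) ξ y‖ ^ 2 := by positivity
  have p2 := sq_nonneg ‖fou (cw τ α β s γ (pd (Fin.last d) (pd (Fin.last d) w))) ξ y‖
  linarith

theorem interior_one_le (hw : Test w) (hτ : 0 < τ) (hs : 0 ≤ s) (hs1 : s ≤ 1) (hγ : ‖γ‖ ≤ 1)
    (ξ : Tan d) (y : ℝ) :
    ENNReal.ofReal τ * sqF τ α β s γ 1 w ξ y ≤
    ENNReal.ofReal (2 * (d + 1)) * ENNReal.ofReal (dens τ (τ + ‖(2 * Real.pi) • ξ‖)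
      (fou (cw τ α β s γ w) ξ y) (fou (cw τ α β s γ (pd (Fin.last d) w)) ξ y)
      (fou (cw τ α β s γ (pd (Fin.last d) (pd (Fin.last d) w))) ξ y)) := by
  refine (mul_le_mul' le_rfl (sqF_one_le hw hτ.le hs hs1 hγ ξ y)).trans ?_
  rw [← ENNReal.ofReal_mul hτ.le, ← ENNReal.ofReal_mul (by positivity)]
  refine ENNReal.ofReal_le_ofReal ?_
  have hΛ : τ ≤ τ + ‖(2 * Real.pi) • ξ‖ := le_add_of_nonneg_right (norm_nonneg _)
  generalize fou (cw τ α β s γ w) ξ y = v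
  generalize fou (cw τ α β s γ (pd (Fin.last d) w)) ξ y = v1
  generalize fou (cw τ α β s γ (pd (Fin.last d) (pd (Fin.last d) w))) ξ y = v2
  generalize τ + ‖(2 * Real.pi) • ξ‖ = Λ at *
  have h : τ * (Λ ^ 2 * ‖v‖ ^ 2 + ‖v1‖ ^ 2) ≤ dens τ Λ v v1 v2 := by
    unfold dens
    rw [le_div_iff₀ hτ]
    have h2 := pow_le_pow_left₀ hτ.le hΛ 2
    have p1 := mul_le_mul_of_nonneg_right h2
      (show 0 ≤ Λ ^ 2 * ‖v‖ ^ 2 + ‖v1‖ ^ 2 by positivity)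
    have p2 := sq_nonneg ‖v2‖
    linarith
  have := mul_le_mul_of_nonneg_left h (show (0 : ℝ) ≤ 2 * (d + 1) by positivity)
  linarith

theorem interior_two_le (hw : Test w) (hτ : 0 < τ) (hs : 0 ≤ s) (hs1 : s ≤ 1) (hγ : ‖γ‖ ≤ 1)
    (ξ : Tan d) (y : ℝ) :
    ENNReal.ofReal τ⁻¹ * sqF τ α β s γ 2 w ξ y ≤
    ENNReal.ofReal (12 * (d + 1) ^ 2) * ENNReal.ofReal (dens τ (τ + ‖(2 * Real.pi) • ξ‖)
      (fou (cw τ α β s γ w) ξ y) (fou (cw τ α β s γ (pd (Fin.last d) w)) ξ y)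
      (fou (cw τ α β s γ (pd (Fin.last d) (pd (Fin.last d) w))) ξ y)) := by
  refine (mul_le_mul' le_rfl (sqF_two_le hw hτ hs hs1 hγ ξ y)).trans (le_of_eq ?_)
  rw [← ENNReal.ofReal_mul (by positivity), ← ENNReal.ofReal_mul (by positivity)]
  congr 1
  field_simp

theorem boundary_zero_le (hτ : 0 < τ) (ξ : Tan d) :
    ENNReal.ofReal (τ ^ 3) * sqF τ α β s γ 0 w ξ 0 ≤ ENNReal.ofReal 1 * bdE τ α β s γ w ξ := by
  unfold sqF bdE
  rw [← ofReal_norm_sq, ← ENNReal.ofReal_mul (by positivity), ← ENNReal.ofReal_mul (by norm_num)]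
  refine ENNReal.ofReal_le_ofReal ?_
  unfold trace
  rw [one_mul]
  have hΛ : τ ≤ τ + ‖(2 * Real.pi) • ξ‖ := le_add_of_nonneg_right (norm_nonneg _)
  have h4 := mul_le_mul_of_nonneg_right (pow_le_pow_left₀ hτ.le hΛ 3)
    (sq_nonneg ‖fou (cw τ α β s γ w) ξ 0‖)
  have p1 : 0 ≤ (τ + ‖(2 * Real.pi) • ξ‖) *
    ‖fou (cw τ α β s γ (pd (Fin.last d) w)) ξ 0‖ ^ 2 := by positivity
  linarith

theorem boundary_one_le (hw : Test w) (hτ : 0 < τ) (hs : 0 ≤ s) (hs1 : s ≤ 1) (hγ : ‖γ‖ ≤ 1)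
    (ξ : Tan d) : ENNReal.ofReal τ * sqF τ α β s γ 1 w ξ 0 ≤
      ENNReal.ofReal (2 * (d + 1)) * bdE τ α β s γ w ξ := by
  refine (mul_le_mul' le_rfl (sqF_one_le hw hτ.le hs hs1 hγ ξ 0)).trans ?_
  unfold bdE trace
  rw [← ENNReal.ofReal_mul hτ.le, ← ENNReal.ofReal_mul (by positivity)]
  refine ENNReal.ofReal_le_ofReal ?_
  have hΛ : τ ≤ τ + ‖(2 * Real.pi) • ξ‖ := le_add_of_nonneg_right (norm_nonneg _)
  generalize fou (cw τ α β s γ w) ξ 0 = v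
  generalize fou (cw τ α β s γ (pd (Fin.last d) w)) ξ 0 = v1
  generalize τ + ‖(2 * Real.pi) • ξ‖ = Λ at *
  have p1 := mul_le_mul_of_nonneg_right hΛ
      (show 0 ≤ 2 * (d + 1) * (Λ ^ 2 * ‖v‖ ^ 2 + ‖v1‖ ^ 2) by positivity)
  linarith

/-- The half-order seminorm contributes a factor X, and Xτ² ≤ Λ³, the weight of v in the trace
energy. The two lemmas that follow use the same comparison. -/
theorem half_zero_le (hτ : 0 < τ) (ξ : Tan d) :
    ENNReal.ofReal (τ ^ 2) * (ENNReal.ofReal (2 * Real.pi * ‖ξ‖) *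
      ‖fou (cw τ α β s γ w) ξ 0‖ₑ ^ 2) ≤ ENNReal.ofReal 1 * bdE τ α β s γ w ξ := by
  unfold bdE trace
  have e : 2 * Real.pi * ‖ξ‖ = ‖(2 * Real.pi) • ξ‖ := by
    rw [norm_smul, Real.norm_of_nonneg (by positivity)]
  rw [e, ← ofReal_norm_sq, ← ENNReal.ofReal_mul (by positivity),
    ← ENNReal.ofReal_mul (by positivity), ← ENNReal.ofReal_mul (by norm_num)]
  refine ENNReal.ofReal_le_ofReal ?_
  have hX := norm_nonneg ((2 * Real.pi) • ξ)
  generalize ‖(2 * Real.pi) • ξ‖ = X at *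
  generalize fou (cw τ α β s γ w) ξ 0 = v
  have p1 : 0 ≤ (τ ^ 3 + 2 * τ ^ 2 * X + 3 * τ * X ^ 2 + X ^ 3) * ‖v‖ ^ 2 := by positivity
  have p2 : 0 ≤ (τ + X) * ‖fou (cw τ α β s γ (pd (Fin.last d) w)) ξ 0‖ ^ 2 := by positivity
  linarith

/-- At y = 0 the normal derivative of the weighted function is v1 + ταv; the weight term is the
source of α² in the constant. -/
theorem half_normal_le (hw : Test w) (hτ : 0 < τ) (ξ : Tan d) :
    ENNReal.ofReal 1 * (ENNReal.ofReal (2 * Real.pi * ‖ξ‖) *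
      ‖fou (pd (Fin.last d) (cw τ α β s γ w)) ξ 0‖ₑ ^ 2) ≤
      ENNReal.ofReal (2 + 2 * α ^ 2) * bdE τ α β s γ w ξ := by
  rw [fou_pd_last_cw hw, mul_zero, add_zero]
  unfold bdE trace
  have e : 2 * Real.pi * ‖ξ‖ = ‖(2 * Real.pi) • ξ‖ := by
    rw [norm_smul, Real.norm_of_nonneg (by positivity)]
  rw [e, ← ofReal_norm_sq, ← ENNReal.ofReal_mul (by positivity),
    ← ENNReal.ofReal_mul (by norm_num), ← ENNReal.ofReal_mul (by positivity)]
  refine ENNReal.ofReal_le_ofReal ?_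
  have hX := norm_nonneg ((2 * Real.pi) • ξ)
  generalize ‖(2 * Real.pi) • ξ‖ = X at *
  generalize fou (cw τ α β s γ w) ξ 0 = v
  generalize fou (cw τ α β s γ (pd (Fin.last d) w)) ξ 0 = v1
  have h1 : ‖v1 + (τ * α : ℝ) * v‖ ^ 2 ≤ 2 * (‖v1‖ ^ 2 + (τ * α) ^ 2 * ‖v‖ ^ 2) := by
    refine (pow_le_pow_left₀ (norm_nonneg _) (norm_add_le _ _) 2).trans
      (add_sq_le.trans (le_of_eq ?_))
    rw [norm_mul, Complex.norm_real, mul_pow, Real.norm_eq_abs, sq_abs]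
  have h2 := mul_le_mul_of_nonneg_left h1 hX
  have p1 : 0 ≤ (τ ^ 3 + 2 * τ ^ 2 * X + 3 * τ * X ^ 2 + X ^ 3) * (α ^ 2 * ‖v‖ ^ 2) := by
    positivity
  have p2 : 0 ≤ (τ + X) ^ 3 * ‖v‖ ^ 2 := by positivity
  have p3 : 0 ≤ τ * ‖v1‖ ^ 2 := by positivity
  have p4 : 0 ≤ (τ + X) * (α ^ 2 * ‖v1‖ ^ 2) := by positivity
  linarith

theorem half_tangential_le (hw : Test w) (hτ : 0 < τ) (j : Fin d) (ξ : Tan d) :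
    ENNReal.ofReal 1 * (ENNReal.ofReal (2 * Real.pi * ‖ξ‖) *
      ‖fou (pd j.castSucc (cw τ α β s γ w)) ξ 0‖ₑ ^ 2) ≤
      ENNReal.ofReal 1 * bdE τ α β s γ w ξ := by
  have e : 2 * Real.pi * ‖ξ‖ = ‖(2 * Real.pi) • ξ‖ := by
    rw [norm_smul, Real.norm_of_nonneg (by positivity)]
  have e2 : ‖fou (pd j.castSucc (cw τ α β s γ w)) ξ 0‖ ≤
      ‖(2 * Real.pi) • ξ‖ * ‖fou (cw τ α β s γ w) ξ 0‖ := by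
    rw [fou_pd_castSucc hw.cw, norm_mul]
    refine mul_le_mul_of_nonneg_right ?_ (norm_nonneg _)
    rw [← e]
    have := PiLp.norm_apply_le ξ j
    simp only [norm_mul, Complex.norm_ofNat, Complex.norm_I, Complex.norm_real, mul_one]
    rw [Real.norm_of_nonneg Real.pi_pos.le]
    exact mul_le_mul_of_nonneg_left this (by positivity)
  unfold bdE trace
  rw [e, ← ofReal_norm_sq, ← ENNReal.ofReal_mul (by positivity),
    ← ENNReal.ofReal_mul (by norm_num), ← ENNReal.ofReal_mul (by norm_num)]
  refine ENNReal.ofReal_le_ofReal ?_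
  have hX := norm_nonneg ((2 * Real.pi) • ξ)
  have h2 := mul_le_mul_of_nonneg_left (pow_le_pow_left₀ (norm_nonneg _) e2 2) hX
  generalize ‖(2 * Real.pi) • ξ‖ = X at *
  generalize fou (cw τ α β s γ w) ξ 0 = v at *
  have p1 : 0 ≤ (τ ^ 3 + 3 * τ ^ 2 * X + 3 * τ * X ^ 2) * ‖v‖ ^ 2 := by
    positivity
  have p3 : 0 ≤ (τ + X) * ‖fou (cw τ α β s γ (pd (Fin.last d) w)) ξ 0‖ ^ 2 := by positivity
  linarith

theorem halfSq_le {c t N : ℝ} {g : Tan d → ℂ} {Q : Tan d → ENNReal} (hc : 0 < c)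
    (h : halfSq g = ENNReal.ofReal c * ∫⁻ ξ, ENNReal.ofReal (2 * Real.pi * ‖ξ‖) * ‖𝓕 g ξ‖ₑ ^ 2)
    (hb : ∀ ξ, ENNReal.ofReal t * (ENNReal.ofReal (2 * Real.pi * ‖ξ‖) * ‖𝓕 g ξ‖ₑ ^ 2) ≤
      ENNReal.ofReal N * Q ξ) :
    ENNReal.ofReal t * halfSq g ≤ ENNReal.ofReal (c * N) * ∫⁻ ξ, Q ξ := by
  have h1 := const_mul_lintegral_le (μ := volume) hb
  rw [h, mul_left_comm, ENNReal.ofReal_mul hc.le, mul_assoc]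
  exact mul_le_mul' le_rfl h1

theorem interior_le (k : ℕ) {t N : ℝ} (hw : Test w) (I : Set ℝ)
    (h : ∀ ξ y, ENNReal.ofReal t * sqF τ α β s γ k w ξ y ≤
      ENNReal.ofReal N * ENNReal.ofReal (dens τ (τ + ‖(2 * Real.pi) • ξ‖)
      (fou (cw τ α β s γ w) ξ y) (fou (cw τ α β s γ (pd (Fin.last d) w)) ξ y)
      (fou (cw τ α β s γ (pd (Fin.last d) (pd (Fin.last d) w))) ξ y))) :
    ENNReal.ofReal t * ∫⁻ p in {p : Spc d | p.2 ∈ I}, sqD k w p *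
      ENNReal.ofReal (Real.exp (2 * τ * phase α β s γ p)) ≤
      ENNReal.ofReal N * ∫⁻ ξ, intE τ α β s γ I w ξ := by
  rw [lintegral_slab_sqD k hw]
  exact const_mul_lintegral_le fun ξ ↦ const_mul_lintegral_le (h ξ)

theorem boundary_le (k : ℕ) {t N : ℝ} (hw : Test w)
    (h : ∀ ξ, ENNReal.ofReal t * sqF τ α β s γ k w ξ 0 ≤
      ENNReal.ofReal N * bdE τ α β s γ w ξ) :
    ENNReal.ofReal t * ∫⁻ x : Tan d, sqD k w (x, 0) *
      ENNReal.ofReal (Real.exp (2 * τ * phase α β s γ (x, 0))) ≤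
      ENNReal.ofReal N * ∫⁻ ξ, bdE τ α β s γ w ξ := by
  rw [lintegral_trace_sqD k hw]
  exact const_mul_lintegral_le h

/-- The powers τ³, τ, τ⁻¹ are made explicit, and the factors `ENNReal.ofReal 1` bring the seminorms
to the shape treated by `halfSq_le`. -/
theorem lhsSide_eq (Ω : Set (Spc d)) : lhsSide τ Ω (phase α β s γ) w =
    (ENNReal.ofReal (τ ^ 3) *
        (∫⁻ p in Ω, sqD 0 w p * ENNReal.ofReal (Real.exp (2 * τ * phase α β s γ p)))
      + ENNReal.ofReal τ *
        (∫⁻ p in Ω, sqD 1 w p * ENNReal.ofReal (Real.exp (2 * τ * phase α β s γ p)))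
      + ENNReal.ofReal τ⁻¹ *
        (∫⁻ p in Ω, sqD 2 w p * ENNReal.ofReal (Real.exp (2 * τ * phase α β s γ p))))
    + (ENNReal.ofReal (τ ^ 3) *
        (∫⁻ x : Tan d, sqD 0 w (x, 0) *
          ENNReal.ofReal (Real.exp (2 * τ * phase α β s γ (x, 0))))
      + ENNReal.ofReal τ *
        (∫⁻ x : Tan d, sqD 1 w (x, 0) *
          ENNReal.ofReal (Real.exp (2 * τ * phase α β s γ (x, 0)))))
    + ENNReal.ofReal (τ ^ 2) * halfSq (fun x ↦ cw τ α β s γ w (x, 0))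
    + ENNReal.ofReal 1 * halfSq (fun x ↦ pd (Fin.last d) (cw τ α β s γ w) (x, 0))
    + ∑ j : Fin d, ENNReal.ofReal 1 * halfSq (fun x ↦ pd j.castSucc (cw τ α β s γ w) (x, 0)) := by
  have z0 : τ ^ (3 - 2 * ((0 : ℕ) : ℤ)) = τ ^ 3 := by norm_cast
  have z1 : τ ^ (3 - 2 * ((1 : ℕ) : ℤ)) = τ := by norm_num
  have z2 : τ ^ (3 - 2 * ((2 : ℕ) : ℤ)) = τ⁻¹ := by norm_num
  simp only [ENNReal.ofReal_one, one_mul]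
  unfold lhsSide
  simp only [Finset.sum_range_succ, Finset.sum_range_zero, zero_add, z0, z1, z2]
  rfl

/-- The left-hand side is controlled by the energies of the Fourier transforms. -/
theorem lhsSide_le {c : ℝ} (hc : 0 < c)
    (hhalf : ∀ g : Tan d → ℂ, Test g → halfSq g =
      ENNReal.ofReal c * ∫⁻ ξ, ENNReal.ofReal (2 * Real.pi * ‖ξ‖) * ‖𝓕 g ξ‖ₑ ^ 2)
    (hw : Test w) (hτ : 0 < τ) (hs : 0 ≤ s) (hs1 : s ≤ 1) (hγ : ‖γ‖ ≤ 1) (I : Set ℝ) :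
    lhsSide τ {p : Spc d | p.2 ∈ I} (phase α β s γ) w ≤
      ENNReal.ofReal (1 + 2 * (d + 1) + 12 * (d + 1) ^ 2 + (1 + 2 * (d + 1)) + c * 1
        + c * (2 + 2 * α ^ 2) + d * (c * 1)) *
      ∫⁻ ξ, (intE τ α β s γ I w ξ + bdE τ α β s γ w ξ) := by
  have hi : ∫⁻ ξ, intE τ α β s γ I w ξ ≤ ∫⁻ ξ, (intE τ α β s γ I w ξ + bdE τ α β s γ w ξ) :=
    lintegral_mono fun ξ ↦ le_self_add
  have hb : ∫⁻ ξ, bdE τ α β s γ w ξ ≤ ∫⁻ ξ, (intE τ α β s γ I w ξ + bdE τ α β s γ w ξ) :=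
    lintegral_mono fun ξ ↦ le_add_self
  have hcw : Test (cw τ α β s γ w) := hw.cw
  have i0 := interior_le 0 hw I (interior_zero_le (α := α) (β := β) (s := s) (γ := γ) (w := w) hτ)
  have i1 := interior_le 1 hw I (interior_one_le (α := α) (β := β) hw hτ hs hs1 hγ)
  have i2 := interior_le 2 hw I (interior_two_le (α := α) (β := β) hw hτ hs hs1 hγ)
  have b0 := boundary_le 0 hw (boundary_zero_le (α := α) (β := β) (s := s) (γ := γ) (w := w) hτ)
  have b1 := boundary_le 1 hw (boundary_one_le (α := α) (β := β) hw hτ hs hs1 hγ)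
  have h0 : ENNReal.ofReal (τ ^ 2) * halfSq (fun x ↦ cw τ α β s γ w (x, 0)) ≤
      ENNReal.ofReal (c * 1) * ∫⁻ ξ, bdE τ α β s γ w ξ :=
    halfSq_le hc (hhalf _ (hcw.slice 0)) fun ξ ↦ half_zero_le hτ ξ
  have h1 : ENNReal.ofReal 1 * halfSq (fun x ↦ pd (Fin.last d) (cw τ α β s γ w) (x, 0)) ≤
      ENNReal.ofReal (c * (2 + 2 * α ^ 2)) * ∫⁻ ξ, bdE τ α β s γ w ξ :=
    halfSq_le hc (hhalf _ ((hcw.pd _).slice 0)) fun ξ ↦ half_normal_le hw hτ ξ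
  have h2 : ∑ j : Fin d, ENNReal.ofReal 1 *
      halfSq (fun x ↦ pd j.castSucc (cw τ α β s γ w) (x, 0)) ≤
      ENNReal.ofReal (d * (c * 1)) * ∫⁻ ξ, bdE τ α β s γ w ξ := by
    have h : ∀ j : Fin d, ENNReal.ofReal 1 *
        halfSq (fun x ↦ pd j.castSucc (cw τ α β s γ w) (x, 0)) ≤
        ENNReal.ofReal (c * 1) * ∫⁻ ξ, bdE τ α β s γ w ξ := fun j ↦
      halfSq_le hc (hhalf _ ((hcw.pd _).slice 0)) fun ξ ↦ half_tangential_le hw hτ j ξ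
    refine (Finset.sum_le_sum fun j _ ↦ h j).trans (le_of_eq ?_)
    rw [Finset.sum_const, Finset.card_univ, Fintype.card_fin, nsmul_eq_mul,
      ENNReal.ofReal_mul (p := (d : ℝ)) (by positivity), ENNReal.ofReal_natCast, mul_assoc]
  rw [lhsSide_eq]
  generalize ∫⁻ ξ, (intE τ α β s γ I w ξ + bdE τ α β s γ w ξ) = T at hi hb
  replace i0 := i0.trans (mul_le_mul' le_rfl hi)
  replace i1 := i1.trans (mul_le_mul' le_rfl hi)
  replace i2 := i2.trans (mul_le_mul' le_rfl hi)
  replace b0 := b0.trans (mul_le_mul' le_rfl hb)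
  replace b1 := b1.trans (mul_le_mul' le_rfl hb)
  replace h0 := h0.trans (mul_le_mul' le_rfl hb)
  replace h1 := h1.trans (mul_le_mul' le_rfl hb)
  replace h2 := h2.trans (mul_le_mul' le_rfl hb)
  refine (add_le_add (add_le_add (add_le_add (add_le_add (add_le_add (add_le_add i0 i1) i2)
    (add_le_add b0 b1)) h0) h1) h2).trans (le_of_eq ?_)
  rw [ENNReal.ofReal_add (by positivity) (by positivity),
    ENNReal.ofReal_add (by positivity) (by positivity),
    ENNReal.ofReal_add (by positivity) (by positivity),
    ENNReal.ofReal_add (p := 1 + 2 * ((d : ℝ) + 1) + 12 * (d + 1) ^ 2)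
      (by positivity) (by positivity),
    ENNReal.ofReal_add (p := 1 + 2 * ((d : ℝ) + 1)) (by positivity) (by positivity),
    ENNReal.ofReal_add (p := 1) (by positivity) (by positivity)]
  ring

end LeftSide

end Carleman

end

/-! ### The source and the jumps on the Fourier side. -/

noncomputable section

namespace Carleman

open MeasureTheory Set Filter Topology FourierTransform

variable {d : ℕ}

section TestAlgebra

theorem Test.sum_const_mul {ι : Type*} (S : Finset ι) {F : ι → Tan d → ℂ} (c : ι → ℂ)
    (hF : ∀ i, Test (F i)) : Test (fun x ↦ ∑ i ∈ S, c i * F i x) := by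
  have h1 : ContDiff ℝ (⊤ : ℕ∞) (fun x ↦ ∑ i ∈ S, c i * F i x) :=
    ContDiff.sum fun i _ ↦ contDiff_const.mul (hF i).smooth
  refine ⟨h1, ?_⟩
  have h2 : HasCompactSupport (∑ i ∈ S, fun x ↦ c i * F i x) := by
    classical
    induction S using Finset.induction_on with
    | empty => simpa using HasCompactSupport.zero
    | insert i S hi ih =>
      rw [Finset.sum_insert hi]
      exact HasCompactSupport.add ((hF i).supp.mul_left (f := fun _ ↦ c i))
        (ih (ContDiff.sum fun i _ ↦ contDiff_const.mul (hF i).smooth))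
  have e : (fun x ↦ ∑ i ∈ S, c i * F i x) = ∑ i ∈ S, fun x ↦ c i * F i x := by
    ext x
    simp
  rwa [e]

theorem Test.tpd {g : Tan d → ℂ} (hg : Test g) (j : Fin d) : Test (tpd j g) := by
  have e : Carleman.tpd j g = fun x ↦ fderiv ℝ g x (EuclideanSpace.single j (1 : ℝ)) :=
    funext fun x ↦ (hg.smooth.differentiable (by simp) x).lineDeriv_eq_fderiv
  rw [e]
  exact ⟨(hg.smooth.fderiv_right (by simp)).clm_apply contDiff_const, hg.supp.fderiv_apply ℝ _⟩

end TestAlgebra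

section Source

variable {τ α β s : ℝ} {γ : Tan d} {w : Spc d → ℂ} {A : Coeff d} {lam0 M0 : ℝ}

theorem Admissible.measurable_entry (h : Admissible lam0 M0 A) (i j : Fin (d + 1)) :
    Measurable (fun y ↦ (A y i j : ℂ)) :=
  Complex.measurable_ofReal.comp (h.lipschitzWith i j).continuous.measurable

theorem measurable_dcoef (A : Coeff d) (j : Fin (d + 1)) :
    Measurable (fun y ↦ (dcoef A j y : ℂ)) :=
  Complex.measurable_ofReal.comp (measurable_deriv _)

theorem measurable_fouDiv (h : Admissible lam0 M0 A) (hw : Test w) :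
    Measurable (fun q : Tan d × ℝ ↦ fouDiv τ α β s γ A w q.1 q.2) := by
  unfold fouDiv
  refine Measurable.add ?_ ?_
  · refine Finset.measurable_fun_sum _ fun i _ ↦ Finset.measurable_fun_sum _ fun j _ ↦ ?_
    exact ((h.measurable_entry i j).comp measurable_snd).mul
      (continuous_fou ((hw.pd j).pd i).cw).measurable
  · refine Finset.measurable_fun_sum _ fun j _ ↦ ?_
    exact ((measurable_dcoef A j).comp measurable_snd).mul
      (continuous_fou (hw.pd j).cw).measurable

theorem measurable_cw_divF (h : Admissible lam0 M0 A) (hw : Test w) :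
    Measurable (cw τ α β s γ (divF A w)) := by
  have h1 : Measurable (divF A w) := by
    unfold divF
    refine Measurable.add ?_ ?_
    · refine Finset.measurable_fun_sum _ fun i _ ↦ Finset.measurable_fun_sum _ fun j _ ↦ ?_
      exact ((h.measurable_entry i j).comp measurable_snd).mul
        ((hw.pd j).pd i).smooth.continuous.measurable
    · refine Finset.measurable_fun_sum _ fun j _ ↦ ?_
      exact ((measurable_dcoef A j).comp measurable_snd).mul
        (hw.pd j).smooth.continuous.measurable
  unfold cw
  exact (contDiff_weight τ α β s γ).continuous.measurable.smul h1

theorem cw_divF_eq (y : ℝ) (x : Tan d) : cw τ α β s γ (divF A w) (x, y) =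
    ∑ i : (Fin (d + 1) × Fin (d + 1)) ⊕ Fin (d + 1),
      Sum.elim (fun k ↦ (A y k.1 k.2 : ℂ)) (fun j ↦ (dcoef A j y : ℂ)) i *
        Sum.elim (fun k x ↦ cw τ α β s γ (pd k.1 (pd k.2 w)) (x, y))
          (fun j x ↦ cw τ α β s γ (pd j w) (x, y)) i x := by
  rw [Fintype.sum_sum_type, Fintype.sum_prod_type]
  unfold cw divF
  simp only [Sum.elim_inl, Sum.elim_inr, Complex.real_smul, mul_add, Finset.mul_sum]
  congr 1
  · exact Finset.sum_congr rfl fun i _ ↦ Finset.sum_congr rfl fun j _ ↦ by ring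
  · exact Finset.sum_congr rfl fun j _ ↦ by ring

theorem test_source (hw : Test w) (y : ℝ) (i : (Fin (d + 1) × Fin (d + 1)) ⊕ Fin (d + 1)) :
    Test (Sum.elim (fun k x ↦ cw τ α β s γ (pd k.1 (pd k.2 w)) (x, y))
          (fun j x ↦ cw τ α β s γ (pd j w) (x, y)) i : Tan d → ℂ) := by
  rcases i with k | j
  · exact ((hw.pd k.2).pd k.1).cw.slice y
  · exact (hw.pd j).cw.slice y

theorem test_cw_divF (hw : Test w) (y : ℝ) : Test (fun x ↦ cw τ α β s γ (divF A w) (x, y)) := by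
  simp_rw [cw_divF_eq]
  exact Test.sum_const_mul _ _ (test_source hw y)

theorem fou_cw_divF (hw : Test w) (ξ : Tan d) (y : ℝ) :
    fou (cw τ α β s γ (divF A w)) ξ y = fouDiv τ α β s γ A w ξ y := by
  unfold fou
  simp_rw [cw_divF_eq]
  rw [fourier_finset_sum _ _ fun i _ ↦ (test_source hw y i).integrable, Fintype.sum_sum_type,
    Fintype.sum_prod_type]
  rfl

theorem lintegral_fouDiv (h : Admissible lam0 M0 A) (hw : Test w) (I : Set ℝ) :
    ∫⁻ ξ, ∫⁻ y in I, ‖fouDiv τ α β s γ A w ξ y‖ₑ ^ 2 =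
      ∫⁻ p in {p : Spc d | p.2 ∈ I}, ‖divGrad A w p‖ₑ ^ 2 *
        ENNReal.ofReal (Real.exp (2 * τ * phase α β s γ p)) := by
  have h1 := lintegral_slab (I := I)
    (measurable_cw_divF (τ := τ) (α := α) (β := β) (s := s) (γ := γ) h hw)
    (test_cw_divF hw) (by simp_rw [fou_cw_divF hw]; exact measurable_fouDiv h hw)
  simp_rw [fou_cw_divF hw] at h1
  rw [← h1]
  refine lintegral_congr_ae (ae_restrict_of_ae ?_)
  filter_upwards [ae_divGrad_eq_divF h hw.smooth] with p hp
  rw [enorm_cw_sq, hp]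

end Source

section Jump

variable {τ α β s : ℝ} {γ : Tan d} {w : Spc d → ℂ} {A : Coeff d}

theorem phase_zero (α α' β β' s : ℝ) (γ x : Tan d) :
    phase α β s γ (x, 0) = phase α' β' s γ (x, 0) := by
  simp [phase]

theorem conormal_eq (A : Coeff d) (w : Spc d → ℂ) (x : Tan d) :
    conormal A w x = -∑ j, (A 0 (Fin.last d) j : ℂ) * pd j w (x, 0) := by
  unfold conormal
  rw [Fin.sum_univ_castSucc]
  simp [nu, Fin.castSucc_ne_last]

theorem weight_conormal_eq (x : Tan d) :
    Real.exp (τ * phase α β s γ (x, 0)) • conormal A w x =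
      ∑ j, (-(A 0 (Fin.last d) j : ℂ)) * cw τ α β s γ (pd j w) (x, 0) := by
  rw [conormal_eq, Complex.real_smul, mul_neg, Finset.mul_sum, ← Finset.sum_neg_distrib]
  refine Finset.sum_congr rfl fun j _ ↦ ?_
  unfold cw
  rw [Complex.real_smul]
  ring

theorem test_weight_conormal (hw : Test w) :
    Test (fun x ↦ Real.exp (τ * phase α β s γ (x, 0)) • conormal A w x) := by
  simp_rw [weight_conormal_eq]
  exact Test.sum_const_mul _ _ fun j ↦ (hw.pd j).cw.slice 0

/-- The overall sign comes from ν = −e_n. The tangential coefficients combine into a_nn times it,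
matching the flux in the transmission condition. -/
theorem fourier_weight_conormal (hw : Test w) (ha : ann A 0 ≠ 0) (ξ : Tan d) :
    𝓕 (fun x ↦ Real.exp (τ * phase α β s γ (x, 0)) • conormal A w x) ξ =
      -(ann A 0 * (fou (cw τ α β s γ (pd (Fin.last d) w)) ξ 0 +
        Complex.I * tsym A (cfreq τ s γ ((2 * Real.pi) • ξ)) 0 * fou (cw τ α β s γ w) ξ 0)) := by
  simp_rw [weight_conormal_eq]
  rw [fourier_finset_sum _ _ fun j _ ↦ ((hw.pd j).cw.slice 0).integrable]
  have ha' : (ann A 0 : ℂ) ≠ 0 := by exact_mod_cast ha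
  have e : ∀ j, 𝓕 (fun x ↦ cw τ α β s γ (pd j w) (x, 0)) ξ = fou (cw τ α β s γ (pd j w)) ξ 0 :=
    fun j ↦ rfl
  simp_rw [e]
  rw [Fin.sum_univ_castSucc]
  simp_rw [fou_cw_pd_castSucc hw]
  unfold tsym tco
  rw [mul_add, Finset.mul_sum, Finset.sum_mul, Finset.mul_sum, neg_add, ← Finset.sum_neg_distrib,
    add_comm]
  congr 1
  · unfold ann
    ring
  · refine Finset.sum_congr rfl fun j _ ↦ ?_
    push_cast
    field_simp

theorem enorm_exp_smul_sq (φ τ : ℝ) (z : ℂ) :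
    ‖Real.exp (τ * φ) • z‖ₑ ^ 2 = ENNReal.ofReal (Real.exp (2 * τ * φ)) * ‖z‖ₑ ^ 2 := by
  rw [← ofReal_norm_sq, ← ofReal_norm_sq, ← ENNReal.ofReal_mul (Real.exp_pos _).le, norm_smul,
    Real.norm_of_nonneg (Real.exp_pos _).le, mul_pow, ← Real.exp_nat_mul]
  congr 3
  push_cast
  ring

/-- By convexity (τ + X)³ ≤ 4(τ³ + X³), and X³|ĝ₀|² is X times the sum of the squared transforms of
the ∂_j g₀, that is, the half-order seminorm of the tangential gradient. -/
theorem jump_le {g₀ g₁ : Tan d → ℂ} (h₀ : Test g₀) (hτ : 0 ≤ τ) (ξ : Tan d) :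
    ENNReal.ofReal (jump (τ + ‖(2 * Real.pi) • ξ‖) (𝓕 g₀ ξ) (𝓕 g₁ ξ)) ≤
      ENNReal.ofReal 4 * ((∑ j, ENNReal.ofReal (2 * Real.pi * ‖ξ‖) * ‖𝓕 (tpd j g₀) ξ‖ₑ ^ 2)
        + ENNReal.ofReal (2 * Real.pi * ‖ξ‖) * ‖𝓕 g₁ ξ‖ₑ ^ 2
        + ENNReal.ofReal τ * ‖𝓕 g₁ ξ‖ₑ ^ 2 + ENNReal.ofReal (τ ^ 3) * ‖𝓕 g₀ ξ‖ₑ ^ 2) := by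
  have e : ‖(2 * Real.pi) • ξ‖ = 2 * Real.pi * ‖ξ‖ := by
    rw [norm_smul, Real.norm_of_nonneg (by positivity)]
  have hs : ∑ j, ‖𝓕 (tpd j g₀) ξ‖ ^ 2 = (2 * Real.pi * ‖ξ‖) ^ 2 * ‖𝓕 g₀ ξ‖ ^ 2 := by
    rw [mul_pow _ ‖ξ‖, EuclideanSpace.norm_sq_eq, Finset.mul_sum, Finset.sum_mul]
    refine Finset.sum_congr rfl fun j _ ↦ ?_
    rw [fourier_tpd h₀, norm_mul, norm_mul, norm_mul, norm_mul, Complex.norm_I, Complex.norm_real,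
      Complex.norm_real, Complex.norm_ofNat, Real.norm_of_nonneg Real.pi_pos.le]
    ring
  have hX : 0 ≤ 2 * Real.pi * ‖ξ‖ := by positivity
  rw [e, ← Finset.mul_sum]
  simp_rw [← ofReal_norm_sq]
  rw [← ENNReal.ofReal_sum_of_nonneg fun j _ ↦ sq_nonneg _, hs]
  unfold jump
  generalize 2 * Real.pi * ‖ξ‖ = X at *
  rw [← ENNReal.ofReal_mul hX, ← ENNReal.ofReal_mul hX, ← ENNReal.ofReal_mul hτ,
    ← ENNReal.ofReal_mul (by positivity), ← ENNReal.ofReal_add (by positivity) (by positivity),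
    ← ENNReal.ofReal_add (by positivity) (by positivity),
    ← ENNReal.ofReal_add (by positivity) (by positivity), ← ENNReal.ofReal_mul (by norm_num)]
  refine ENNReal.ofReal_le_ofReal ?_
  have p1 : 0 ≤ 3 * (τ + X) * (τ - X) ^ 2 * ‖𝓕 g₀ ξ‖ ^ 2 := by positivity
  have p2 : 0 ≤ (τ + X) * ‖𝓕 g₁ ξ‖ ^ 2 := by positivity
  linarith

/-- The constant contains c⁻¹ to invert the Fourier formula for the seminorm, and 1 so that it also
dominates the L² terms. -/
theorem lintegral_jump_le {c : ℝ} (hc : 0 < c)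
    (hhalf : ∀ g : Tan d → ℂ, Test g → halfSq g =
      ENNReal.ofReal c * ∫⁻ ξ, ENNReal.ofReal (2 * Real.pi * ‖ξ‖) * ‖𝓕 g ξ‖ₑ ^ 2)
    {g₀ g₁ : Tan d → ℂ} (h₀ : Test g₀) (h₁ : Test g₁) (hτ : 0 ≤ τ) :
    ∫⁻ ξ, ENNReal.ofReal (jump (τ + ‖(2 * Real.pi) • ξ‖) (𝓕 g₀ ξ) (𝓕 g₁ ξ)) ≤
      ENNReal.ofReal (4 * (1 + c⁻¹)) * ((∑ j, halfSq (tpd j g₀)) + halfSq g₁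
        + ENNReal.ofReal τ * (∫⁻ x, ‖g₁ x‖ₑ ^ 2)
        + ENNReal.ofReal (τ ^ 3) * (∫⁻ x, ‖g₀ x‖ₑ ^ 2)) := by
  have hinv : ∀ g : Tan d → ℂ, Test g →
      ∫⁻ ξ, ENNReal.ofReal (2 * Real.pi * ‖ξ‖) * ‖𝓕 g ξ‖ₑ ^ 2 ≤
        ENNReal.ofReal (1 + c⁻¹) * halfSq g := fun g hg ↦ by
    rw [hhalf g hg, ← mul_assoc, ← ENNReal.ofReal_mul (by positivity)]
    have : (1 : ENNReal) ≤ ENNReal.ofReal ((1 + c⁻¹) * c) := by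
      rw [← ENNReal.ofReal_one]
      refine ENNReal.ofReal_le_ofReal ?_
      rw [add_mul, inv_mul_cancel₀ hc.ne']
      linarith
    exact le_mul_of_one_le_left' this
  have hone : (1 : ENNReal) ≤ ENNReal.ofReal (1 + c⁻¹) := by
    rw [← ENNReal.ofReal_one]
    exact ENNReal.ofReal_le_ofReal (le_add_of_nonneg_right (by positivity))
  have hm : ∀ g : Tan d → ℂ, Test g →
      Measurable fun ξ ↦ ENNReal.ofReal (2 * Real.pi * ‖ξ‖) * ‖𝓕 g ξ‖ₑ ^ 2 := fun g hg ↦ by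
    have := hg.continuous_fourier
    fun_prop
  have m0 : Measurable fun ξ ↦ ‖𝓕 g₀ ξ‖ₑ ^ 2 := by
    have := h₀.continuous_fourier
    fun_prop
  have m1 : Measurable fun ξ ↦ ‖𝓕 g₁ ξ‖ₑ ^ 2 := by
    have := h₁.continuous_fourier
    fun_prop
  refine (lintegral_mono fun ξ ↦ jump_le h₀ hτ ξ).trans ?_
  rw [lintegral_const_mul' _ _ ENNReal.ofReal_ne_top, ENNReal.ofReal_mul (by norm_num), mul_assoc]
  refine mul_le_mul' le_rfl ?_
  rw [lintegral_add_right _ (m0.const_mul _), lintegral_add_right _ (m1.const_mul _),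
    lintegral_add_right _ (hm g₁ h₁), lintegral_finsetSum _ fun j _ ↦ hm _ (h₀.tpd j),
    lintegral_const_mul _ m0, lintegral_const_mul _ m1, plancherel h₀, plancherel h₁]
  simp only [mul_add, Finset.mul_sum]
  refine add_le_add (add_le_add (add_le_add ?_ (hinv g₁ h₁)) ?_) ?_
  · exact Finset.sum_le_sum fun j _ ↦ hinv _ (h₀.tpd j)
  · exact le_mul_of_one_le_left' hone
  · exact le_mul_of_one_le_left' hone

end Jump

section Assembly

variable {τ α β s : ℝ} {γ : Tan d} {w : Spc d → ℂ}

theorem dens_fou_eq_zero {U : Set ℝ} (hU : IsOpen U) (h : ∀ x, ∀ y ∈ U, w (x, y) = 0)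
    (ξ : Tan d) {y : ℝ} (hy : y ∈ U) (Λ : ℝ) :
    dens τ Λ (fou (cw τ α β s γ w) ξ y) (fou (cw τ α β s γ (pd (Fin.last d) w)) ξ y)
      (fou (cw τ α β s γ (pd (Fin.last d) (pd (Fin.last d) w))) ξ y) = 0 := by
  have h1 := pd_eq_zero_of_isOpen hU h (Fin.last d)
  have h2 := pd_eq_zero_of_isOpen hU h1 (Fin.last d)
  rw [fou_cw_eq_zero (fun x ↦ h x y hy), fou_cw_eq_zero (fun x ↦ h1 x y hy),
    fou_cw_eq_zero (fun x ↦ h2 x y hy)]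
  simp [dens]

theorem intE_Ioi_le {r : ℝ} (hr : 0 ≤ r) (h : ∀ x y, r < y → w (x, y) = 0) (ξ : Tan d) :
    intE τ α β s γ (Ioi 0) w ξ ≤ intE τ α β s γ (Ioc 0 r) w ξ := by
  unfold intE
  rw [← Ioc_union_Ioi_eq_Ioi hr]
  refine (lintegral_union_le _ _ _).trans (le_of_eq ?_)
  rw [setLIntegral_congr_fun (g := fun _ ↦ 0) measurableSet_Ioi fun y hy ↦ ?_, lintegral_zero,
    add_zero]
  beta_reduce
  rw [dens_fou_eq_zero isOpen_Ioi h ξ hy, ENNReal.ofReal_zero]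

theorem intE_Iio_le {r : ℝ} (hr : 0 ≤ r) (h : ∀ x y, y < -r → w (x, y) = 0) (ξ : Tan d) :
    intE τ α β s γ (Iio 0) w ξ ≤ intE τ α β s γ (Ioc (-r) 0) w ξ := by
  unfold intE
  rw [← Iio_union_Ico_eq_Iio (neg_nonpos.2 hr)]
  refine (lintegral_union_le _ _ _).trans (le_of_eq ?_)
  rw [setLIntegral_congr_fun (g := fun _ ↦ 0) measurableSet_Iio fun y hy ↦ ?_, lintegral_zero,
    zero_add, setLIntegral_congr Ico_ae_eq_Ioc]
  beta_reduce
  rw [dens_fou_eq_zero isOpen_Iio h ξ hy, ENNReal.ofReal_zero]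

end Assembly

end Carleman

end

/-! ### Assembly: from each frequency to the Carleman estimate. -/

noncomputable section

namespace Carleman

open MeasureTheory Set Filter Topology FourierTransform

variable {d : ℕ}

/-- The right-hand side controls the data of the problems on the Fourier side. -/
theorem lintegral_data_le {lam0 M0 c r : ℝ} (hlam : 0 < lam0) (hc : 0 < c)
    (hhalf : ∀ g : Tan d → ℂ, Test g → halfSq g =
      ENNReal.ofReal c * ∫⁻ ξ, ENNReal.ofReal (2 * Real.pi * ‖ξ‖) * ‖𝓕 g ξ‖ₑ ^ 2)
    {Ap Am : Coeff d} (hAp : Admissible lam0 M0 Ap) (hAm : Admissible lam0 M0 Am)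
    {Wp Wm : Spc d → ℂ} (hp : Test Wp) (hm : Test Wm) {αp αm β s τ : ℝ} {γ : Tan d}
    (hτ : 0 ≤ τ) :
    ∫⁻ ξ, ((∫⁻ y in Ioc 0 r, ‖fouDiv τ αp β s γ Ap Wp ξ y‖ₑ ^ 2)
      + (∫⁻ y in Ioc (-r) 0, ‖fouDiv τ αm β s γ Am Wm ξ y‖ₑ ^ 2)
      + ENNReal.ofReal (jump (τ + ‖(2 * Real.pi) • ξ‖)
        (fou (cw τ αp β s γ Wp) ξ 0 - fou (cw τ αm β s γ Wm) ξ 0)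
        (ann Ap 0 * (fou (cw τ αp β s γ (pd (Fin.last d) Wp)) ξ 0 + Complex.I *
          tsym Ap (cfreq τ s γ ((2 * Real.pi) • ξ)) 0 * fou (cw τ αp β s γ Wp) ξ 0)
          - ann Am 0 * (fou (cw τ αm β s γ (pd (Fin.last d) Wm)) ξ 0 + Complex.I *
          tsym Am (cfreq τ s γ ((2 * Real.pi) • ξ)) 0 * fou (cw τ αm β s γ Wm) ξ 0)))) ≤
      ENNReal.ofReal (4 * (1 + c⁻¹)) * carlemanRHS Ap Am αp αm β s τ γ Wp Wm := by
  have hap : ann Ap 0 ≠ 0 := (hlam.trans_le (hAp.diag_lower 0 _)).ne'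
  have ham : ann Am 0 ≠ 0 := (hlam.trans_le (hAm.diag_lower 0 _)).ne'
  obtain ⟨g₀, hg₀⟩ : ∃ g : Tan d → ℂ, g = fun x ↦
      Real.exp (τ * phase αp β s γ (x, 0)) • theta0 Wp Wm x := ⟨_, rfl⟩
  obtain ⟨g₁, hg₁⟩ : ∃ g : Tan d → ℂ, g = fun x ↦
      Real.exp (τ * phase αp β s γ (x, 0)) • theta1 Ap Am Wp Wm x := ⟨_, rfl⟩
  have e0 : g₀ = fun x ↦ cw τ αp β s γ Wp (x, 0) - cw τ αm β s γ Wm (x, 0) := by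
    rw [hg₀]
    funext x
    unfold theta0 cw
    -- On y = 0 the phase does not involve α, so both sides carry the same weight and the jump of
    -- the weighted functions is the weighted jump.
    rw [smul_sub, phase_zero αm αp β β]
  have e1 : g₁ = fun x ↦ Real.exp (τ * phase αp β s γ (x, 0)) • conormal Ap Wp x -
      Real.exp (τ * phase αm β s γ (x, 0)) • conormal Am Wm x := by
    rw [hg₁]
    funext x
    unfold theta1
    rw [smul_sub, phase_zero αm αp β β]
  have tp := hp.cw (τ := τ) (α := αp) (β := β) (s := s) (γ := γ)
  have tm := hm.cw (τ := τ) (α := αm) (β := β) (s := s) (γ := γ)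
  have cp := test_weight_conormal (τ := τ) (α := αp) (β := β) (s := s) (γ := γ) (A := Ap) hp
  have cm := test_weight_conormal (τ := τ) (α := αm) (β := β) (s := s) (γ := γ) (A := Am) hm
  have t0 : Test g₀ := by
    rw [e0]
    exact ⟨(tp.slice 0).smooth.sub (tm.slice 0).smooth, (tp.slice 0).supp.sub (tm.slice 0).supp⟩
  have t1 : Test g₁ := by
    rw [e1]
    exact ⟨cp.smooth.sub cm.smooth, cp.supp.sub cm.supp⟩
  have f0 : ∀ ξ, 𝓕 g₀ ξ = fou (cw τ αp β s γ Wp) ξ 0 - fou (cw τ αm β s γ Wm) ξ 0 := fun ξ ↦ by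
    have := fourier_lin_two (tp.slice 0).integrable (tm.slice 0).integrable 1 (-1) ξ
    simp only [one_mul, neg_one_mul, ← sub_eq_add_neg] at this
    rw [e0]
    exact this
  have f1 : ∀ ξ, 𝓕 g₁ ξ =
      -(ann Ap 0 * (fou (cw τ αp β s γ (pd (Fin.last d) Wp)) ξ 0 + Complex.I *
          tsym Ap (cfreq τ s γ ((2 * Real.pi) • ξ)) 0 * fou (cw τ αp β s γ Wp) ξ 0)
          - ann Am 0 * (fou (cw τ αm β s γ (pd (Fin.last d) Wm)) ξ 0 + Complex.I *
          tsym Am (cfreq τ s γ ((2 * Real.pi) • ξ)) 0 * fou (cw τ αm β s γ Wm) ξ 0)) := fun ξ ↦ by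
    have := fourier_lin_two cp.integrable cm.integrable 1 (-1) ξ
    simp only [one_mul, neg_one_mul, ← sub_eq_add_neg] at this
    rw [e1, this, fourier_weight_conormal hp hap, fourier_weight_conormal hm ham]
    ring
  have hJ := lintegral_jump_le hc hhalf t0 t1 hτ
  have hj : ∀ ξ, jump (τ + ‖(2 * Real.pi) • ξ‖)
        (fou (cw τ αp β s γ Wp) ξ 0 - fou (cw τ αm β s γ Wm) ξ 0)
        (ann Ap 0 * (fou (cw τ αp β s γ (pd (Fin.last d) Wp)) ξ 0 + Complex.I *
          tsym Ap (cfreq τ s γ ((2 * Real.pi) • ξ)) 0 * fou (cw τ αp β s γ Wp) ξ 0)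
          - ann Am 0 * (fou (cw τ αm β s γ (pd (Fin.last d) Wm)) ξ 0 + Complex.I *
          tsym Am (cfreq τ s γ ((2 * Real.pi) • ξ)) 0 * fou (cw τ αm β s γ Wm) ξ 0)) =
      jump (τ + ‖(2 * Real.pi) • ξ‖) (𝓕 g₀ ξ) (𝓕 g₁ ξ) := fun ξ ↦ by
    rw [f0, f1]
    unfold jump
    rw [norm_neg]
  simp_rw [hj]
  have mp : Measurable fun ξ ↦ ∫⁻ y in Ioc 0 r, ‖fouDiv τ αp β s γ Ap Wp ξ y‖ₑ ^ 2 :=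
    ((measurable_fouDiv hAp hp).enorm.pow_const 2).lintegral_prod_right'
  have mm : Measurable fun ξ ↦ ∫⁻ y in Ioc (-r) 0, ‖fouDiv τ αm β s γ Am Wm ξ y‖ₑ ^ 2 :=
    ((measurable_fouDiv hAm hm).enorm.pow_const 2).lintegral_prod_right'
  have mpm : Measurable fun ξ ↦ (∫⁻ y in Ioc 0 r, ‖fouDiv τ αp β s γ Ap Wp ξ y‖ₑ ^ 2) +
      ∫⁻ y in Ioc (-r) 0, ‖fouDiv τ αm β s γ Am Wm ξ y‖ₑ ^ 2 := mp.add mm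
  rw [lintegral_add_left mpm, lintegral_add_left mp]
  have ip : ∫⁻ ξ, ∫⁻ y in Ioc 0 r, ‖fouDiv τ αp β s γ Ap Wp ξ y‖ₑ ^ 2 ≤
      ∫⁻ p in {p : Spc d | 0 < p.2}, ‖divGrad Ap Wp p‖ₑ ^ 2 *
        ENNReal.ofReal (Real.exp (2 * τ * phase αp β s γ p)) := by
    refine le_trans ?_ (lintegral_fouDiv hAp hp (Ioi 0)).le
    exact lintegral_mono fun ξ ↦ lintegral_mono_set Ioc_subset_Ioi_self
  have im : ∫⁻ ξ, ∫⁻ y in Ioc (-r) 0, ‖fouDiv τ αm β s γ Am Wm ξ y‖ₑ ^ 2 ≤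
      ∫⁻ p in {p : Spc d | p.2 < 0}, ‖divGrad Am Wm p‖ₑ ^ 2 *
        ENNReal.ofReal (Real.exp (2 * τ * phase αm β s γ p)) := by
    refine le_trans ?_ (lintegral_fouDiv hAm hm (Iio 0)).le
    refine lintegral_mono fun ξ ↦ ?_
    rw [setLIntegral_congr (Iio_ae_eq_Iic (a := (0 : ℝ)))]
    exact lintegral_mono_set Ioc_subset_Iic_self
  have hN : (1 : ENNReal) ≤ ENNReal.ofReal (4 * (1 + c⁻¹)) := by
    rw [← ENNReal.ofReal_one]
    refine ENNReal.ofReal_le_ofReal ?_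
    have : 0 < c⁻¹ := inv_pos.2 hc
    linarith
  have hR : carlemanRHS Ap Am αp αm β s τ γ Wp Wm =
      (∫⁻ p in {p : Spc d | 0 < p.2}, ‖divGrad Ap Wp p‖ₑ ^ 2 *
        ENNReal.ofReal (Real.exp (2 * τ * phase αp β s γ p))) +
      (∫⁻ p in {p : Spc d | p.2 < 0}, ‖divGrad Am Wm p‖ₑ ^ 2 *
        ENNReal.ofReal (Real.exp (2 * τ * phase αm β s γ p))) +
      ((∑ j, halfSq (tpd j g₀)) + halfSq g₁
        + ENNReal.ofReal τ * (∫⁻ x, ‖g₁ x‖ₑ ^ 2)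
        + ENNReal.ofReal (τ ^ 3) * (∫⁻ x, ‖g₀ x‖ₑ ^ 2)) := by
    rw [hg₀, hg₁]
    simp_rw [enorm_exp_smul_sq]
    unfold carlemanRHS
    simp only [← add_assoc]
  rw [hR, mul_add, mul_add]
  exact add_le_add (add_le_add (ip.trans (le_mul_of_one_le_left' hN))
    (im.trans (le_mul_of_one_le_left' hN))) hJ

theorem measurable_fouDiv_right {lam0 M0 τ α β s : ℝ} {γ : Tan d} {A : Coeff d} {w : Spc d → ℂ}
    (hA : Admissible lam0 M0 A) (hw : Test w) (ξ : Tan d) :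
    Measurable (fouDiv τ α β s γ A w ξ) :=
  Measurable.comp (g := fun q : Tan d × ℝ ↦ fouDiv τ α β s γ A w q.1 q.2) (f := fun y ↦ (ξ, y))
    (measurable_fouDiv hA hw) (measurable_const.prodMk measurable_id)

theorem norm_conjOp_le_of_le {lam0 M0 K τ α β s : ℝ} {γ : Tan d} {A : Coeff d} {w : Spc d → ℂ}
    (hA : Admissible lam0 M0 A) (hlam : 0 < lam0) (hM : 0 ≤ M0)
    (hK : lam0⁻¹ * (1 + (d + 1) * M0) ≤ K) (hw : Test w) (hτ : 0 ≤ τ) (hs : 0 ≤ s) (hs1 : s ≤ 1)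
    (hγ : ‖γ‖ ≤ 1) (ξ : Tan d) (I : Set ℝ) : ∀ᵐ y, y ∈ I →
      ‖conjOp (tsym A (cfreq τ s γ ((2 * Real.pi) • ξ)))
        (qsym A (cfreq τ s γ ((2 * Real.pi) • ξ))) (fou (cw τ α β s γ w) ξ)
        (fou (cw τ α β s γ (pd (Fin.last d) w)) ξ)
        (fou (cw τ α β s γ (pd (Fin.last d) (pd (Fin.last d) w))) ξ) y‖ ≤
      K * (‖fouDiv τ α β s γ A w ξ y‖ + ‖fou (cw τ α β s γ (pd (Fin.last d) w)) ξ y‖ +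
        (τ + ‖(2 * Real.pi) • ξ‖) * ‖fou (cw τ α β s γ w) ξ y‖) :=
  Eventually.of_forall fun y _ ↦ (norm_conjOp_le hA hlam hM hw hτ hs hs1 hγ ξ y).trans
    (mul_le_mul_of_nonneg_right hK (by positivity))

/-- The estimate at a fixed tangential frequency. -/
theorem frequency_estimate (d : ℕ) {lam0 M0 αp αm ℓ : ℝ} (hlam : 0 < lam0) (hM : 0 < M0)
    (hαp : 0 < αp) (hαm : 0 < αm) (hℓ : ℓ < αp / αm) :
    ∃ s₀ τ₀ β₀ C : ℝ, 0 < s₀ ∧ s₀ < 1 ∧ 1 ≤ τ₀ ∧ 0 < β₀ ∧ 0 < C ∧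
      ∀ {β r τ s : ℝ} {γ : Tan d} {Ap Am : Coeff d} {Wp Wm : Spc d → ℂ}, β₀ ≤ β → 0 < r →
        β * r ≤ αp / 2 → β * r ≤ αm / 2 → Admissible lam0 M0 Ap → Admissible lam0 M0 Am →
        ratioL Ap Am ≤ ℓ → τ₀ ≤ τ → 0 ≤ s → s ≤ s₀ → ‖γ‖ ≤ 1 → Test Wp → Test Wm →
        (∀ x y, r < y → Wp (x, y) = 0) → (∀ x y, y < -r → Wm (x, y) = 0) → ∀ ξ : Tan d,
        (intE τ αp β s γ (Ioi 0) Wp ξ + bdE τ αp β s γ Wp ξ) +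
        (intE τ αm β s γ (Iio 0) Wm ξ + bdE τ αm β s γ Wm ξ) ≤ ENNReal.ofReal C *
      ((∫⁻ y in Ioc 0 r, ‖fouDiv τ αp β s γ Ap Wp ξ y‖ₑ ^ 2)
      + (∫⁻ y in Ioc (-r) 0, ‖fouDiv τ αm β s γ Am Wm ξ y‖ₑ ^ 2)
      + ENNReal.ofReal (jump (τ + ‖(2 * Real.pi) • ξ‖)
        (fou (cw τ αp β s γ Wp) ξ 0 - fou (cw τ αm β s γ Wm) ξ 0)
        (ann Ap 0 * (fou (cw τ αp β s γ (pd (Fin.last d) Wp)) ξ 0 + Complex.I *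
          tsym Ap (cfreq τ s γ ((2 * Real.pi) • ξ)) 0 * fou (cw τ αp β s γ Wp) ξ 0)
          - ann Am 0 * (fou (cw τ αm β s γ (pd (Fin.last d) Wm)) ξ 0 + Complex.I *
          tsym Am (cfreq τ s γ ((2 * Real.pi) • ξ)) 0 * fou (cw τ αm β s γ Wm) ξ 0)))) := by
  obtain ⟨B, hB1, -, hB⟩ := Admissible.exists_bddLip d hlam hM
  have hB0 : 0 < B := lt_of_lt_of_le (inv_pos.2 hlam) hB1
  -- K is a sum of all the bounds required of it: 1, those for t, those for Q, ellipticity, and the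
  -- first-order terms. It depends only on d, λ₀ and M₀.
  obtain ⟨K, hKd⟩ : ∃ K, K = 1 + d * B + d * (d * B) + lam0⁻¹ * (1 + (d + 1) * M0) := ⟨_, rfl⟩
  have q1 : 0 ≤ d * B := by positivity
  have q2 : 0 ≤ d * (d * B) := by positivity
  have q3 : 0 < lam0⁻¹ := inv_pos.2 hlam
  have q4 : 0 ≤ lam0⁻¹ * ((d + 1) * M0) := by positivity
  rw [mul_add, mul_one] at hKd
  have hK : 1 ≤ K := by linarith
  have hK1 : d * B ≤ K := by linarith
  have hK2 : d * (d * B) ≤ K := by linarith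
  have hK3 : lam0⁻¹ ≤ K := by linarith
  have hK4 : lam0⁻¹ * (1 + (d + 1) * M0) ≤ K := by rw [mul_add, mul_one]; linarith
  have hentry : ∀ A : Coeff d, Admissible lam0 M0 A → |ann A 0| ≤ K ∧ 1 ≤ K * ann A 0 :=
    fun A hA ↦ by
      have h1 := hA.diag_lower 0 (Fin.last d)
      refine ⟨(hA.abs_entry_le hlam 0 _ _).trans hK3, ?_⟩
      have h2 := mul_le_mul hK3 h1 hlam.le (by linarith)
      rwa [inv_mul_cancel₀ hlam.ne'] at h2
  obtain ⟨s₀, τ₀, β₀, C, hs₀, hs₀1, hτ₀, hβ₀, hC, key⟩ := transmission_lower hK hαp hαm hℓ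
  refine ⟨s₀, τ₀, β₀, C, hs₀, hs₀1, hτ₀, hβ₀, hC, ?_⟩
  intro β r τ s γ Ap Am Wp Wm hβ hr0 hrp hrm hAp hAm hL hτ hs hss hγ hWp hWm zp zm ξ
  have hβp : 0 < β := hβ₀.trans_le hβ
  have hτ0 : 0 ≤ τ := by linarith
  have hs1 : s ≤ 1 := by linarith
  have sp := side_of_admissible (ε := 1) (a := 0) (b := r) (α := αp) (β := β) hAp hlam
    (hB Ap hAp).1 (hB Ap hAp).2 hK1 hK2 hK3 hτ0 hs hs1 hγ hWp hr0.le
    (Or.inl ⟨rfl, rfl, zp⟩) (fun y hy ↦ by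
      have h1 := mul_nonneg hβp.le hy.1
      have h2 := mul_le_mul_of_nonneg_left hy.2 hβp.le
      constructor <;> linarith) ξ
  have sm := side_of_admissible (ε := -1) (a := -r) (b := 0) (α := αm) (β := β) hAm hlam
    (hB Am hAm).1 (hB Am hAm).2 hK1 hK2 hK3 hτ0 hs hs1 hγ hWm (by linarith)
    (Or.inr ⟨rfl, rfl, zm⟩) (fun y hy ↦ by
      have h1 := mul_nonneg hβp.le (sub_nonneg.2 hy.2)
      have h2 := mul_le_mul_of_nonneg_left hy.1 hβp.le
      constructor <;> linarith) ξ
  have hGp : Measurable (fouDiv τ αp β s γ Ap Wp ξ) :=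
    measurable_fouDiv_right hAp hWp ξ
  have hGm : Measurable (fouDiv τ αm β s γ Am Wm ξ) :=
    measurable_fouDiv_right hAm hWm ξ
  have cp := norm_conjOp_le_of_le (α := αp) (β := β) hAp hlam hM.le hK4 hWp hτ0 hs hs1 hγ ξ
    (Icc 0 r)
  have cm := norm_conjOp_le_of_le (α := αm) (β := β) hAm hlam hM.le hK4 hWm hτ0 hs hs1 hγ ξ
    (Icc (-r) 0)
  have h := key sp sm hτ hs hss (norm_nonneg _) hβ (hentry Ap hAp).1 (hentry Am hAm).1
    (hentry Ap hAp).2 (hentry Am hAm).2 (hAp.symbolM_le_of_ratioL hAm hlam hL _)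
    cp cm hGp.aestronglyMeasurable hGm.aestronglyMeasurable
  refine le_trans ?_ h
  have i1 := intE_Ioi_le (τ := τ) (α := αp) (β := β) (s := s) (γ := γ) hr0.le zp ξ
  have i2 := intE_Iio_le (τ := τ) (α := αm) (β := β) (s := s) (γ := γ) hr0.le zm ξ
  rw [add_add_add_comm, ← add_assoc]
  exact add_le_add (add_le_add (add_le_add i1 i2) le_rfl) le_rfl

/-- The Carleman estimate. -/
theorem carleman_estimate (hd : 1 ≤ d) {lam0 M0 αp αm ℓ : ℝ} (hlam : 0 < lam0) (hM : 0 < M0)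
    (hαp : 0 < αp) (hαm : 0 < αm) (hℓ : ℓ < αp / αm) :
    ∃ τ₀ s₀ C β₀ : ℝ, 0 < τ₀ ∧ 0 < s₀ ∧ s₀ < 1 ∧ 0 < C ∧ 0 < β₀ ∧
      ∀ β : ℝ, β₀ ≤ β → ∃ r₀ : ℝ, 0 < r₀ ∧
        ∀ Ap Am : Coeff d, Admissible lam0 M0 Ap → Admissible lam0 M0 Am → ratioL Ap Am ≤ ℓ →
        ∀ τ s : ℝ, τ₀ ≤ τ → 0 < s → s ≤ s₀ → ∀ γ : Tan d, ‖γ‖ ≤ 1 →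
        ∀ wp wm : Spc d → ℂ, ContDiff ℝ (⊤ : ℕ∞) wp → ContDiff ℝ (⊤ : ℕ∞) wm →
          tsupport (glue wp wm) ⊆ Metric.closedBall 0 1 ×ˢ Icc (-r₀) r₀ →
          carlemanLHS αp αm β s τ γ wp wm ≤
            ENNReal.ofReal C * carlemanRHS Ap Am αp αm β s τ γ wp wm := by
  obtain ⟨c, hc, hhalf⟩ := exists_halfSq_eq hd
  obtain ⟨s₀, τ₀, β₀, C, hs₀, hs₀1, hτ₀, hβ₀, hC, key⟩ :=
    frequency_estimate d hlam hM hαp hαm hℓ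
  obtain ⟨N, hN⟩ : ∃ N : ℝ → ℝ, N = fun α ↦ 1 + 2 * (d + 1) + 12 * (d + 1) ^ 2 +
    (1 + 2 * (d + 1)) + c * 1 + c * (2 + 2 * α ^ 2) + d * (c * 1) := ⟨_, rfl⟩
  have hN0 : ∀ α, 0 < N α := fun α ↦ by rw [hN]; positivity
  refine ⟨τ₀, s₀, (N αp + N αm) * (C * (4 * (1 + c⁻¹))), β₀, by linarith, hs₀, hs₀1,
    mul_pos (add_pos (hN0 _) (hN0 _)) (by positivity), hβ₀, fun β hβ ↦ ?_⟩
  have hβp : 0 < β := hβ₀.trans_le hβ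
  -- This gives βr ≤ α_±/2, hence α/2 ≤ α + βy ≤ 2α throughout the support; it is the only reason
  -- for r₀ to depend on β.
  obtain ⟨r, hr⟩ : ∃ r, r = min αp αm / (2 * β) := ⟨_, rfl⟩
  have hmin : 0 < min αp αm := lt_min hαp hαm
  have hr0 : 0 < r := by rw [hr]; positivity
  have hβr : β * r = min αp αm / 2 := by rw [hr]; field_simp
  have hrp : β * r ≤ αp / 2 := by linarith [min_le_left αp αm]
  have hrm : β * r ≤ αm / 2 := by linarith [min_le_right αp αm]
  refine ⟨r, hr0, fun Ap Am hAp hAm hL τ s hτ hs hss γ hγ wp wm hwp hwm hsupp ↦ ?_⟩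
  have hτ0 : 0 < τ := by linarith
  have hs1 : s ≤ 1 := by linarith
  obtain ⟨Wp, Wm, hWp, hWm, zp, zm, eL, eR⟩ := exists_test_pair hr0 hwp hwm hsupp
  rw [eL, eR]
  have hpt := key hβ hr0 hrp hrm hAp hAm hL hτ hs.le hss hγ hWp hWm zp zm
  have lp := lhsSide_le hc hhalf (α := αp) (β := β) hWp hτ0 hs.le hs1 hγ (Ioi 0)
  have lm := lhsSide_le hc hhalf (α := αm) (β := β) hWm hτ0 hs.le hs1 hγ (Iio 0)
  have hdata := lintegral_data_le (r := r) hlam hc hhalf hAp hAm hWp hWm (αp := αp) (αm := αm)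
    (β := β) (s := s) (γ := γ) hτ0.le
  have hint := (lintegral_mono (μ := volume) hpt).trans_eq (lintegral_const_mul' _ _ ENNReal.ofReal_ne_top)
  -- The lower integral is superadditive without measurability, and this is the direction needed to
  -- separate the two sides.
  have hsplit := (le_lintegral_add _ _).trans hint
  have lp' := lp.trans (mul_le_mul' (ENNReal.ofReal_le_ofReal
    (show _ ≤ N αp + N αm by have := hN0 αm; rw [hN] at *; linarith)) le_rfl)
  have lm' := lm.trans (mul_le_mul' (ENNReal.ofReal_le_ofReal
    (show _ ≤ N αp + N αm by have := hN0 αp; rw [hN] at *; linarith)) le_rfl)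
  refine (add_le_add lp' lm').trans ?_
  rw [← mul_add, ENNReal.ofReal_mul (add_pos (hN0 _) (hN0 _)).le, mul_assoc,
    ENNReal.ofReal_mul hC.le, mul_assoc]
  exact mul_le_mul' le_rfl (hsplit.trans (mul_le_mul' le_rfl hdata))

end Carleman

end

theorem theorem3p1 (d : ℕ) (hd : 1 ≤ d) (lam0 M0 : ℝ) (hlam0 : 0 < lam0) (hlam0' : lam0 ≤ 1)
    (hM0 : 0 < M0) :
    (∀ Ap Am : Carleman.Coeff d, Carleman.Admissible lam0 M0 Ap → Carleman.Admissible lam0 M0 Am →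
      Carleman.ratioL Ap Am ≤ (lam0 ^ 2)⁻¹) ∧
    ∀ αp αm ℓ : ℝ, 0 < αp → 0 < αm → ℓ < αp / αm →
      ∃ τ₀ s₀ C β₀ : ℝ, 0 < τ₀ ∧ 0 < s₀ ∧ s₀ < 1 ∧ 0 < C ∧ 0 < β₀ ∧
        ∀ β : ℝ, β₀ ≤ β → ∃ r₀ : ℝ, 0 < r₀ ∧
          ∀ Ap Am : Carleman.Coeff d,
            Carleman.Admissible lam0 M0 Ap → Carleman.Admissible lam0 M0 Am →
            Carleman.ratioL Ap Am ≤ ℓ →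
          ∀ τ s : ℝ, τ₀ ≤ τ → 0 < s → s ≤ s₀ →
          ∀ γ : Carleman.Tan d, ‖γ‖ ≤ 1 →
          ∀ wp wm : Carleman.Spc d → ℂ,
            ContDiff ℝ (⊤ : ℕ∞) wp → ContDiff ℝ (⊤ : ℕ∞) wm →
            tsupport (Carleman.glue wp wm) ⊆ Metric.closedBall 0 1 ×ˢ Set.Icc (-r₀) r₀ →
            Carleman.carlemanLHS αp αm β s τ γ wp wm ≤
              ENNReal.ofReal C * Carleman.carlemanRHS Ap Am αp αm β s τ γ wp wm := by
  exact ⟨fun _ _ hAp hAm ↦ hAp.ratioL_le hAm hlam0,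
    fun _ _ _ hαp hαm hℓ ↦ Carleman.carleman_estimate hd hlam0 hM0 hαp hαm hℓ⟩
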